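/- **Setting.** Let $\Gamma$ be a finite group acting by automorphisms $\rho(\gamma)$ on a lattice $X$ (a free abelian group of finite rank); put $E = X\otimes_{\mathbb Z}\mathbb R$, with the induced representation $\rho$ of $\Gamma$. Let $\Gamma\ltimes X$ act on $E$ by $\rho(y\gamma)e = y+\rho(\gamma)e$ ($y \in X$, $\gamma\in\Gamma$); an element of $\Gamma\ltimes X$ is *elliptic* if it has an isolated fixpoint in $E$ (a property that is invariant under conjugation). For a group $G$ let $G_{\mathbb C}(G)$ be the Grothendieck group of finite dimensional complex representations of $G$, tensored with $\mathbb C$. Define $$\mathrm{Ell}(\Gamma\ltimes X) = G_{\mathbb C}(\Gamma\ltimes X)\Big/\sum_{H\le\Gamma,\ E^{\rho(H)}\neq0}\mathrm{Ind}_{H\ltimes X}^{\Gamma\ltimes X}\,G_{\mathbb C}(H\ltimes X),\qquad EP_{\Gamma\ltimes X}(U,V)=\sum_{n\ge0}(-1)^n\dim\mathrm{Ext}^n_{\Gamma\ltimes X}(U,V)$$ for finite dimensional $\Gamma\ltimes X$-representations $U,V$. For a finite group $G$ with a finite dimensional representation $E'$ define likewise $$\mathrm{Ell}(G)=G_{\mathbb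 C}(G)\Big/\sum_{H\le G,\ E'^H\ne0}\mathrm{Ind}_H^G\,G_{\mathbb C}(H),\qquad e_G(U,V)=\sum_{n\ge0}(-1)^n\dim\mathrm{Hom}_G\big(U\otimes\textstyle\bigwedge^nE',V\big).$$ Let $T=\mathrm{Hom}_{\mathbb Z}(X,\mathbb C^\times)$. For $t\in T$ let $\Gamma_t=\{\gamma\in\Gamma: t\circ\rho(\gamma)=t\}$, and form $\mathrm{Ell}(\Gamma_t)$ and $e_{\Gamma_t}$ with respect to the cotangent space $E'=I_t/I_t^2$ of $T$ at $t$, where $I_t\subset\mathbb C[X]=\mathcal O(T)$ is the ideal of functions vanishing at $t$. For a finite dimensional representation $V$ of $\Gamma_t$ let $V_t$ be the representation of $\Gamma_t\ltimes X$ on $V$ in which $X$ acts by the character $t$ and $\Gamma_t$ acts as on $V$, and put $\mathrm{Ind}_t(V)=\mathrm{Ind}_{\Gamma_t\ltimes X}^{\Gamma\ltimes X}V_t$. Extend $\mathrm{Ind}_t$ linearly to $G_{\mathbb C}(\Gamma_t)\to G_{\mathbb C}(\Gamma\ltimes X)$. **Theorem.** a) $\Gamma\ltimes X$ has finitely many elliptic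 conjugacy classes, and $\dim \mathrm{Ell}(\Gamma\ltimes X)$ is finite and equals their number. b) For all finite dimensional $\Gamma\ltimes X$-representations $U,V$ the spaces $\mathrm{Ext}^n_{\Gamma\ltimes X}(U,V)$ are finite dimensional and vanish for large $n$, and $EP_{\Gamma\ltimes X}$, extended to be conjugate-linear in the first and linear in the second variable, induces a (positive definite) Hermitian inner product on $\mathrm{Ell}(\Gamma\ltimes X)$. c) For every $t\in T$, $\mathrm{Ind}_t$ induces a linear map $\mathrm{Ell}(\Gamma_t)\to\mathrm{Ell}(\Gamma\ltimes X)$, and $$EP_{\Gamma\ltimes X}(\mathrm{Ind}_tU,\mathrm{Ind}_tV)=e_{\Gamma_t}(U,V)$$ for all finite dimensional $\Gamma_t$-representations $U,V$. The pairing $e_{\Gamma_t}$ induces a sesquilinear form on $\mathrm{Ell}(\Gamma_t)$, and the map $\mathrm{Ell}(\Gamma_t)\to\mathrm{Ell}(\Gamma\ltimes X)$ is an isometry from this form to the one in b). d) If $t$ runs through any set of representatives of the $\Gamma$-orbits in $T$ (where $\gamma$ acts by $t\mapsto t\circ\rho(\gamma)^{-1}$), then the map $\bigoplus_{t\in T/\Gamma}\mathrm{Ind}_t:\bigoplus_{t\in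 T/\Gamma}\mathrm{Ell}(\Gamma_t)\to\mathrm{Ell}(\Gamma\ltimes X)$ is an isomorphism. -/

import Mathlib

open CategoryTheory TensorProduct

noncomputable section

namespace EllipticTheory

/-! ### Complexified Grothendieck groups of finite dimensional representations -/

section Grothendieck

variable (G : Type) [Group G]

/-- Complex `G`-modules have enough projectives, so that their `Ext` groups are available. -/
instance instHasExtRep : HasExt.{0} (Rep.{0} ℂ G) :=
  hasExt_of_enoughProjectives.{0} (Rep.{0} ℂ G)

/-- Finite dimensional complex representations of `G` (the objects of `Mod_fin(G)`). -/
abbrev FinRep : Type 1 := {V : Rep.{0} ℂ G // Module.Finite ℂ V}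

/-- The relations `[V] = [V'] + [V'']` for short exact sequences `0 → V' → V → V'' → 0`
of finite dimensional representations. -/
def grothendieckRel : AddSubgroup (FreeAbelianGroup (FinRep G)) :=
  AddSubgroup.closure {x | ∃ (S : ShortComplex (Rep.{0} ℂ G)) (h₁ : Module.Finite ℂ S.X₁)
    (h₂ : Module.Finite ℂ S.X₂) (h₃ : Module.Finite ℂ S.X₃), S.ShortExact ∧
      x = FreeAbelianGroup.of ⟨S.X₂, h₂⟩ - FreeAbelianGroup.of ⟨S.X₁, h₁⟩
        - FreeAbelianGroup.of ⟨S.X₃, h₃⟩}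

/-- The Grothendieck group `G(G)` of finite dimensional complex representations of `G`. -/
abbrev GrothendieckGroup : Type 1 := FreeAbelianGroup (FinRep G) ⧸ grothendieckRel G

/-- The complexified Grothendieck group `G_ℂ(G) = ℂ ⊗_ℤ G(G)`. -/
abbrev GC : Type 1 := ℂ ⊗[ℤ] GrothendieckGroup G

variable {G}

/-- The class `[V] ∈ G_ℂ(G)` of a finite dimensional representation. -/
def cls (V : FinRep G) : GC G :=
  (1 : ℂ) ⊗ₜ[ℤ] (QuotientAddGroup.mk (FreeAbelianGroup.of V) : GrothendieckGroup G)

variable {H : Type} [Group H]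

/-- The linear map `[V] ↦ [F V]` induced by an exact functor which preserves finite
dimensionality. -/
def mapGC (F : Rep.{0} ℂ G ⥤ Rep.{0} ℂ H) [F.PreservesZeroMorphisms]
    (hfin : ∀ V : Rep.{0} ℂ G, Module.Finite ℂ V → Module.Finite ℂ (F.obj V))
    (hex : ∀ S : ShortComplex (Rep.{0} ℂ G), S.ShortExact → (S.map F).ShortExact) :
    GC G →ₗ[ℂ] GC H :=
  LinearMap.baseChange ℂ (AddMonoidHom.toIntLinearMap
    (QuotientAddGroup.map (grothendieckRel G) (grothendieckRel H)
      (FreeAbelianGroup.map fun V : FinRep G => (⟨F.obj V.1, hfin V.1 V.2⟩ : FinRep H)) (by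
        rw [grothendieckRel, AddSubgroup.closure_le]
        rintro x ⟨S, h₁, h₂, h₃, hS, rfl⟩
        refine AddSubgroup.subset_closure
          ⟨S.map F, hfin _ h₁, hfin _ h₂, hfin _ h₃, hex S hS, ?_⟩
        simp only [map_sub, FreeAbelianGroup.map_of_apply]
        rfl)))

theorem mapGC_cls (F : Rep.{0} ℂ G ⥤ Rep.{0} ℂ H) [F.PreservesZeroMorphisms]
    (hfin : ∀ V : Rep.{0} ℂ G, Module.Finite ℂ V → Module.Finite ℂ (F.obj V))
    (hex : ∀ S : ShortComplex (Rep.{0} ℂ G), S.ShortExact → (S.map F).ShortExact)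
    (V : FinRep G) : mapGC F hfin hex (cls V) = cls ⟨F.obj V.1, hfin V.1 V.2⟩ := by
  simp [mapGC, cls]

/-- The Euler-Poincaré characteristic `EP_G(U,V) = ∑ (-1)ⁿ dim Extⁿ_G(U,V)`. -/
def EP (U V : Rep.{0} ℂ G) : ℤ :=
  ∑ᶠ n : ℕ, (-1) ^ n * (Module.finrank ℂ (Abelian.Ext U V n) : ℤ)

end Grothendieck

/-! ### Induction from subgroups of finite index -/

section Induction

variable {G : Type} [Group G] (S : Subgroup G) [S.FiniteIndex]

/-- The functor `Ind_S^G`. -/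
abbrev indF : Rep.{0} ℂ S ⥤ Rep.{0} ℂ G := Rep.indFunctor.{0} ℂ S.subtype

theorem indF_finite (V : Rep.{0} ℂ S) (hV : Module.Finite ℂ V) :
    Module.Finite ℂ ((indF S).obj V) := by
  have hfin : Finite (Quotient (QuotientGroup.rightRel S)) :=
    Finite.of_equiv _ (QuotientGroup.quotientRightRelEquivQuotientLeftRel S).symm
  have key : ∀ (s : S) (g : G) (v : V),
      Representation.IndV.mk S.subtype V.ρ (s * g) v =
        Representation.IndV.mk S.subtype V.ρ g (V.ρ s⁻¹ v) := by
    intro s g v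
    refine (Representation.Coinvariants.mk_eq_iff _).2 ?_
    refine Representation.Coinvariants.mem_ker_of_eq s
      ((MonoidAlgebra.single g 1 : MonoidAlgebra ℂ G) ⊗ₜ[ℂ] (V.ρ s⁻¹ v)) _ ?_
    simp
  change Module.Finite ℂ (Representation.IndV S.subtype V.ρ)
  have hrange : (⨆ q : Quotient (QuotientGroup.rightRel S),
      LinearMap.range (Representation.IndV.mk S.subtype V.ρ q.out)) = ⊤ := by
    rw [← top_le_iff, ← Submodule.ker_mkQ (⨆ q : Quotient (QuotientGroup.rightRel S),
      LinearMap.range (Representation.IndV.mk S.subtype V.ρ q.out)), top_le_iff,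
      LinearMap.ker_eq_top]
    refine Representation.IndV.hom_ext _ _ fun g => ?_
    ext v
    simp only [LinearMap.comp_apply, LinearMap.zero_apply, Submodule.mkQ_apply,
      Submodule.Quotient.mk_eq_zero]
    obtain ⟨s, hs⟩ : ∃ s : S, g = s * (Quotient.mk (QuotientGroup.rightRel S) g).out := by
      obtain ⟨s, hs⟩ := Quotient.mk_out (s := QuotientGroup.rightRel S) g
      exact ⟨s⁻¹, by rw [← hs]; simp [Subgroup.smul_def]⟩
    have hmem : Representation.IndV.mk S.subtype V.ρ g v ∈
        ⨆ q : Quotient (QuotientGroup.rightRel S),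
          LinearMap.range (Representation.IndV.mk S.subtype V.ρ q.out) := by
      have hk := key s (Quotient.mk (QuotientGroup.rightRel S) g).out v
      rw [← hs] at hk
      rw [hk]
      exact Submodule.mem_iSup_of_mem (Quotient.mk (QuotientGroup.rightRel S) g)
        (LinearMap.mem_range_self _ _)
    exact hmem
  exact ⟨hrange ▸ Submodule.fg_iSup _ fun q => (Module.Finite.iff_fg.1 (Module.Finite.range _))⟩

instance indF_preservesZero : (indF S).PreservesZeroMorphisms := by
  have : (indF S).IsLeftAdjoint := (Rep.indResAdjunction.{0} ℂ S.subtype).isLeftAdjoint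
  exact Functor.preservesZeroMorphisms_of_isLeftAdjoint _

theorem indF_shortExact (T : ShortComplex (Rep.{0} ℂ S)) (hT : T.ShortExact) :
    (T.map (indF S)).ShortExact := by
  have h₁ : (indF S).IsLeftAdjoint := (Rep.indResAdjunction.{0} ℂ S.subtype).isLeftAdjoint
  have h₂ : (indF S).IsRightAdjoint :=
    Rep.instIsRightAdjointSubtypeMemSubgroupIndFunctorSubtype.{0} ℂ S
  have := Limits.PreservesLimits.preservesFiniteLimits (indF S)
  exact hT.map_of_exact (indF S)

/-- Induction `Ind_S^G : G_ℂ(S) → G_ℂ(G)`, `[V] ↦ [Ind_S^G V]`. -/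
def indGC : GC S →ₗ[ℂ] GC G := mapGC (indF S) (indF_finite S) (indF_shortExact S)

end Induction

/-! ### Elliptic representation theory of a finite group `G` with respect to a
complex representation `(ρ, E)` -/

section Finite

variable {G : Type} [Group G] {E : Type} [AddCommGroup E] [Module ℂ E]

/-- The `n`-th exterior power of a representation. -/
def extPow (ρ : Representation ℂ G E) (n : ℕ) : Representation ℂ G (⋀[ℂ]^n E) where
  toFun g := exteriorPower.map n (ρ g)
  map_one' := by rw [map_one]; exact exteriorPower.map_id
  map_mul' g h := by rw [map_mul]; exact exteriorPower.map_comp (ρ h) (ρ g)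

/-- Reeder's elliptic pairing `e_G(U,V) = ∑ (-1)ⁿ dim Hom_G(U ⊗ ⋀ⁿ E, V)`. -/
def ellPairing (ρ : Representation ℂ G E) (U V : Rep.{0} ℂ G) : ℤ :=
  ∑ᶠ n : ℕ, (-1) ^ n * (Module.finrank ℂ
    (Representation.IntertwiningMap (U.ρ.tprod (extPow ρ n)) V.ρ) : ℤ)

variable [Finite G]

/-- The span of the `Ind_H^G G_ℂ(H)`, over all subgroups `H` of `G` with `E^H ≠ 0`. -/
def ellRel (ρ : Representation ℂ G E) : Submodule ℂ (GC G) :=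
  ⨆ (H : Subgroup G) (_ : Representation.invariants (ρ.comp H.subtype) ≠ ⊥), LinearMap.range (indGC H)

/-- The space `Ell(G)` of elliptic trace functions of a finite group with respect to `(ρ, E)`. -/
abbrev Ell (ρ : Representation ℂ G E) : Type 1 := GC G ⧸ ellRel ρ

end Finite

/-! ### The group `Γ ⋉ X` -/

section Lattice

variable (Γ X : Type) [Group Γ] [AddCommGroup X] [DistribMulAction Γ X]

/-- The action of `Γ` on the lattice `X`, written multiplicatively. -/
def latticeAut : Γ →* MulAut (Multiplicative X) where
  toFun γ := AddEquiv.toMultiplicative (DistribMulAction.toAddAut Γ X γ)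
  map_one' := by ext x; simp
  map_mul' γ δ := by ext x; simp [mul_smul]

/-- The semidirect product `Γ ⋉ X`, with elements `x γ` (`x ∈ X`, `γ ∈ Γ`). -/
abbrev Crossed : Type := Multiplicative X ⋊[latticeAut Γ X] Γ

/-- The real vector space `E = X ⊗_ℤ ℝ`. -/
abbrev RealSpace : Type := ℝ ⊗[ℤ] X

/-- The action `ρ` of `Γ` on `E`. -/
def realRep : Representation ℝ Γ (RealSpace X) where
  toFun γ := LinearMap.baseChange ℝ
    (AddMonoidHom.toIntLinearMap (DistribSMul.toAddMonoidHom X γ))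
  map_one' := by ext x; simp
  map_mul' γ δ := by ext x; simp [mul_smul]

variable {Γ X}

/-- The affine action of `Γ ⋉ X` on `E`: `ρ(y γ) e = y + ρ(γ) e`. -/
def affineAct (w : Crossed Γ X) (e : RealSpace X) : RealSpace X :=
  (1 : ℝ) ⊗ₜ[ℤ] (Multiplicative.toAdd w.left) + realRep Γ X w.right e

/-- `w ∈ Γ ⋉ X` is elliptic if it has an isolated fixpoint in `E`, where `E` carries its usual
topology as a finite dimensional real vector space. -/
def IsElliptic (w : Crossed Γ X) : Prop :=
  ∃ e : RealSpace X, affineAct w e = e ∧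
    ∃ N : Set (RealSpace X), @IsOpen _ (moduleTopology ℝ (RealSpace X)) N ∧ e ∈ N ∧
      ∀ e' ∈ N, affineAct w e' = e' → e' = e

variable (Γ X) in
/-- The set of elliptic conjugacy classes of `Γ ⋉ X`. -/
def ellipticClasses : Set (ConjClasses (Crossed Γ X)) :=
  ConjClasses.mk '' {w : Crossed Γ X | IsElliptic w}

variable (X) in
/-- The subgroup `H ⋉ X` of `Γ ⋉ X`, for a subgroup `H` of `Γ`. -/
abbrev crossedSub (H : Subgroup Γ) : Subgroup (Crossed Γ X) :=
  H.comap (SemidirectProduct.rightHom : Crossed Γ X →* Γ)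

instance crossedSub_finiteIndex [Finite Γ] (H : Subgroup Γ) : (crossedSub X H).FiniteIndex :=
  ⟨by
    rw [Subgroup.index_comap_of_surjective _ SemidirectProduct.rightHom_surjective]
    exact Subgroup.FiniteIndex.index_ne_zero⟩

variable (Γ X) in
/-- The span of the `Ind_{H ⋉ X}^{Γ ⋉ X} G_ℂ(H ⋉ X)`, over all subgroups `H` of `Γ`
with `E^H ≠ 0`. -/
def ellLatticeRel [Finite Γ] : Submodule ℂ (GC (Crossed Γ X)) :=
  ⨆ (H : Subgroup Γ) (_ : Representation.invariants ((realRep Γ X).comp H.subtype) ≠ ⊥),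
    LinearMap.range (indGC (crossedSub X H))

variable (Γ X) in
/-- The space `Ell(Γ ⋉ X)` of elliptic trace functions. -/
abbrev EllLattice [Finite Γ] : Type 1 := GC (Crossed Γ X) ⧸ ellLatticeRel Γ X

/-! ### The torus `T = Hom(X, ℂˣ)`, stabilizers, cotangent spaces and `Ind_t` -/

variable (X) in
/-- The complex torus `T = Hom_ℤ(X, ℂˣ)`. -/
abbrev Torus : Type := Multiplicative X →* ℂˣ

variable (Γ) in
/-- The stabilizer `Γ_t = {γ ∈ Γ | t ∘ ρ(γ) = t}`. -/
def stab (t : Torus X) : Subgroup Γ where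
  carrier := {γ | t.comp (latticeAut Γ X γ).toMonoidHom = t}
  one_mem' := MonoidHom.ext fun x => by simp
  mul_mem' := by
    intro γ δ hγ hδ
    refine MonoidHom.ext fun x => ?_
    have h₁ := DFunLike.congr_fun hγ (latticeAut Γ X δ x)
    have h₂ := DFunLike.congr_fun hδ x
    simp only [MonoidHom.comp_apply, MulEquiv.coe_toMonoidHom, map_mul, MulAut.mul_apply]
      at h₁ h₂ ⊢
    rw [h₁, h₂]
  inv_mem' := by
    intro γ hγ
    refine MonoidHom.ext fun x => ?_
    have h₁ := DFunLike.congr_fun hγ (latticeAut Γ X γ⁻¹ x)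
    simp only [MonoidHom.comp_apply, MulEquiv.coe_toMonoidHom, map_inv,
      MulAut.apply_inv_self] at h₁ ⊢
    rw [h₁]

theorem stab_apply {t : Torus X} (γ : stab Γ t) (x : Multiplicative X) :
    t (latticeAut Γ X γ x) = t x := DFunLike.congr_fun γ.2 x

variable (Γ) in
/-- `R ⊆ T` contains exactly one point of each `Γ`-orbit. -/
def IsOrbitTransversal (R : Set (Torus X)) : Prop :=
  ∀ t : Torus X, ∃! r : Torus X, r ∈ R ∧ ∃ γ : Γ, r.comp (latticeAut Γ X γ).toMonoidHom = t

/-- Evaluation at `t` on the coordinate ring `𝒪(T) = ℂ[X]`. -/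
def evalAt (t : Torus X) : MonoidAlgebra ℂ (Multiplicative X) →ₐ[ℂ] ℂ :=
  MonoidAlgebra.lift ℂ ℂ (Multiplicative X) ((Units.coeHom ℂ).comp t)

/-- The ideal `I_t ⊆ ℂ[X]` of the functions vanishing at `t`. -/
abbrev vanishingIdeal (t : Torus X) : Ideal (MonoidAlgebra ℂ (Multiplicative X)) :=
  RingHom.ker (evalAt t)

/-- The action of `γ ∈ Γ` on `ℂ[X] = 𝒪(T)` by algebra automorphisms. -/
def actAlg (γ : Γ) : MonoidAlgebra ℂ (Multiplicative X) →ₐ[ℂ] MonoidAlgebra ℂ (Multiplicative X) :=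
  MonoidAlgebra.mapDomainAlgHom ℂ ℂ (latticeAut Γ X γ).toMonoidHom

theorem actAlg_one : actAlg (X := X) (1 : Γ) = AlgHom.id ℂ _ := by
  ext x
  simp [actAlg]

theorem actAlg_mul (γ δ : Γ) : actAlg (X := X) (γ * δ) = (actAlg γ).comp (actAlg δ) := by
  ext x
  simp [actAlg]

theorem evalAt_actAlg {t : Torus X} (γ : stab Γ t) :
    (evalAt t).comp (actAlg (γ : Γ)) = evalAt t := by
  ext x
  simp [evalAt, actAlg, stab_apply γ x]

theorem vanishingIdeal_le {t : Torus X} (γ : stab Γ t) :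
    vanishingIdeal t ≤ (vanishingIdeal t).comap (actAlg (γ : Γ)) := by
  intro f hf
  have := DFunLike.congr_fun (evalAt_actAlg γ) f
  simp only [AlgHom.comp_apply] at this
  simpa [RingHom.mem_ker, this] using hf

variable (Γ) in
/-- The representation of `Γ_t` on the cotangent space `I_t / I_t²` to `T` at `t`. -/
def cotangentRep (t : Torus X) : Representation ℂ (stab Γ t) (vanishingIdeal t).Cotangent where
  toFun γ := Ideal.mapCotangent _ _ (actAlg (γ : Γ)) (vanishingIdeal_le γ)
  map_one' := by
    refine LinearMap.ext fun f => ?_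
    obtain ⟨f, rfl⟩ := Ideal.toCotangent_surjective _ f
    rw [Ideal.mapCotangent_toCotangent]
    refine congrArg _ (Subtype.ext ?_)
    exact DFunLike.congr_fun (actAlg_one (Γ := Γ) (X := X)) f.1
  map_mul' γ δ := by
    refine LinearMap.ext fun f => ?_
    obtain ⟨f, rfl⟩ := Ideal.toCotangent_surjective _ f
    rw [Module.End.mul_apply, Ideal.mapCotangent_toCotangent, Ideal.mapCotangent_toCotangent,
      Ideal.mapCotangent_toCotangent]
    refine congrArg _ (Subtype.ext ?_)
    exact DFunLike.congr_fun (actAlg_mul (γ : Γ) (δ : Γ)) f.1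

/-- The representation `V_t` of `Γ_t ⋉ X` on `V`: `X` acts by the character `t`, and `Γ_t` acts
as on the given representation, so that `x γ` acts as `t(x) γ`. -/
def twist (t : Torus X) {V : Type} [AddCommGroup V] [Module ℂ V]
    (σ : Representation ℂ (stab Γ t) V) :
    Representation ℂ (crossedSub X (stab Γ t)) V where
  toFun w := (t w.1.left : ℂ) • σ ⟨w.1.right, w.2⟩
  map_one' := by
    have : (⟨(1 : crossedSub X (stab Γ t)).1.right, (1 : crossedSub X (stab Γ t)).2⟩ : stab Γ t)
        = 1 := rfl
    rw [this]
    simp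
  map_mul' w z := by
    have h : (⟨(w * z).1.right, (w * z).2⟩ : stab Γ t)
        = ⟨w.1.right, w.2⟩ * ⟨z.1.right, z.2⟩ := rfl
    have h' : t (latticeAut Γ X w.1.right z.1.left) = t z.1.left :=
      stab_apply (⟨w.1.right, w.2⟩ : stab Γ t) z.1.left
    rw [h, map_mul]
    simp [h', smul_smul, mul_comm]

variable (Γ) in
/-- The functor `V ↦ V_t`. -/
def twistF (t : Torus X) : Rep.{0} ℂ (stab Γ t) ⥤ Rep.{0} ℂ (crossedSub X (stab Γ t)) where
  obj V := Rep.of (twist t V.ρ)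
  map f := Rep.ofHom ⟨f.hom.toLinearMap, fun w => by
    ext v
    have := Rep.hom_comm_apply f ⟨w.1.right, w.2⟩ v
    simp [twist, this]⟩

theorem twistF_finite (t : Torus X) (V : Rep.{0} ℂ (stab Γ t)) (hV : Module.Finite ℂ V) :
    Module.Finite ℂ ((twistF Γ t).obj V) := hV

instance twistF_preservesZero (t : Torus X) : (twistF Γ t).PreservesZeroMorphisms where
  map_zero _ _ := rfl

theorem twistF_shortExact (t : Torus X) (S : ShortComplex (Rep.{0} ℂ (stab Γ t)))
    (hS : S.ShortExact) : (S.map (twistF Γ t)).ShortExact where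
  exact := by
    have h := hS.exact.map (forget₂ (Rep.{0} ℂ (stab Γ t)) (ModuleCat ℂ))
    exact (forget₂ (Rep.{0} ℂ (crossedSub X (stab Γ t))) (ModuleCat ℂ)).reflects_exact_of_faithful
      _ h
  mono_f := (Rep.mono_iff_injective _).2 ((Rep.mono_iff_injective S.f).1 hS.mono_f)
  epi_g := (Rep.epi_iff_surjective _).2 ((Rep.epi_iff_surjective S.g).1 hS.epi_g)

variable [Finite Γ]

variable (Γ) in
/-- The functor `Ind_t : V ↦ Ind_{Γ_t ⋉ X}^{Γ ⋉ X} V_t`. -/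
abbrev indTF (t : Torus X) : Rep.{0} ℂ (stab Γ t) ⥤ Rep.{0} ℂ (Crossed Γ X) :=
  twistF Γ t ⋙ indF (crossedSub X (stab Γ t))

variable (Γ) in
/-- The linear map `Ind_t : G_ℂ(Γ_t) → G_ℂ(Γ ⋉ X)`, `[V] ↦ [Ind_t V]`. -/
def indT (t : Torus X) : GC (stab Γ t) →ₗ[ℂ] GC (Crossed Γ X) :=
  indGC (crossedSub X (stab Γ t)) ∘ₗ mapGC (twistF Γ t) (twistF_finite t) (twistF_shortExact t)

theorem indT_cls (t : Torus X) (V : FinRep (stab Γ t)) :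
    indT Γ t (cls V) =
      cls ⟨(indTF Γ t).obj V.1, indF_finite _ _ (twistF_finite t V.1 V.2)⟩ := by
  simp only [indT, LinearMap.comp_apply, indGC, mapGC_cls]
  rfl

end Lattice

end EllipticTheory

end

open CategoryTheory TensorProduct

noncomputable section

namespace EllipticTheory

/-! ### Grothendieck groups, additive functions and traces -/

section Grothendieck

variable {G : Type} [Group G]

/-! Everything is read off from coefficients of characters. On a coset `Xγ` the character of a
finite dimensional representation is a combination `yγ ↦ ∑ a_{γ,t} t(y)` of elements of `T`; the
finitely many nonzero `a_{γ,t}` (`coefGC`) are unique by Dedekind independence. Characters separate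
the points of `G_ℂ` (`charGC_injective`), hence so do the `a_{γ,t}`. They are `Γ`-equivariant
(`coefGC_moveT`) and vanish unless `γ ∈ Γ_t` (`coefGC_eq_zero`). Conversely, for `γ ∈ Γ_s`, a
combination of classes induced from `⟨γ⟩ ⋉ X` (`latElem γ s`) has as coefficients the orbit sum of
the point mass at `(γ,s)`, and `|Γ| x = ∑ a_{γ,s}(x) latElem γ s`. If `γ` has a nonzero fixpoint in
`E`, then `latElem γ s` is one of the relations of `Ell`; if not, no class induced from `H ⋉ X` with
`E^H ≠ 0` has a coefficient at `γ`. So an element is a relation exactly when its coefficients vanish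
at all `γ` with `det(1-γ) ≠ 0` (`mem_ellLatticeRel`).

For a), `yγ` is elliptic exactly when `det(1-γ) ≠ 0`, so `Ell` embeds into the functions on the
elliptic classes. There are finitely many of these because `X/(1-γ)X` is finite, and Fourier
inversion on this quotient produces every function (`ellipticChar_surjective`).

For b), the form is `(1/|Γ|) ∑_γ det(1-γ⁻¹) ∑_s conj(a_{γ,s}) a_{γ,s}` (`ellForm`), positive
definite because `det(1-γ) ≥ 0` for `γ` of finite order. To identify it with `EP` (`EP_eq_ellForm`),
write the class of `V` through the `latElem`s; this leaves the case of a representation induced from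
a character `s·χ` of `C ⋉ X` with `C` cyclic. The group `C ⋉ X` acts affinely on `ℂ ⊗ X`, with `C`
diagonal in suitable coordinates. The polynomials on this space, twisted by `s·χ`, form an injective
representation: Matlis duality for `ℂ[X]` at `s`, then averaging over `C`. Imposing `∂_j = 0` for
one `j` after the other leads from all polynomials down to the constants `s·χ`, through exact
sequences `0 → N_{T∪{j}} → N_T → N_T ⊗ ω_j → 0`. This makes all `Ext` finite, and each step inserts
a factor `1 - ω_j(c)`; their product is `det(1-c⁻¹)` (`EP_indF_tower`). At the top of the tower
`Hom` only sees the weight `s` part of `U`.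

For c) and d), `I_t/I_t²` is `ℂ ⊗ X` equivariantly, and `∑ (-1)ⁿ tr ⋀ⁿ γ = det(1-γ)` brings
`e_{Γ_t}` into the same shape as `ellForm` (`ellPairing_cotangentRep`). The coefficients of `Ind_t
V` live on the orbit of `t`, and at `t` they are the character of `V`; hence coefficients split
along a transversal of `T/Γ` (`indT_bijective`). -/

theorem shortExact_exact {S : ShortComplex (Rep.{0} ℂ G)} (hS : S.ShortExact) :
    Function.Exact S.f.hom.toLinearMap S.g.hom.toLinearMap := by
  have h := hS.exact.map (forget₂ (Rep.{0} ℂ G) (ModuleCat ℂ))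
  rw [ShortComplex.moduleCat_exact_iff] at h
  refine fun x => ⟨h x, ?_⟩
  rintro ⟨y, rfl⟩
  exact congr($(S.zero).hom.toLinearMap y)

theorem shortExact_injective {S : ShortComplex (Rep.{0} ℂ G)} (hS : S.ShortExact) :
    Function.Injective S.f.hom.toLinearMap := (Rep.mono_iff_injective _).1 hS.mono_f

theorem shortExact_surjective {S : ShortComplex (Rep.{0} ℂ G)} (hS : S.ShortExact) :
    Function.Surjective S.g.hom.toLinearMap := (Rep.epi_iff_surjective _).1 hS.epi_g

theorem shortExact_of {S : ShortComplex (Rep.{0} ℂ G)}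
    (h₁ : Function.Injective S.f.hom.toLinearMap)
    (h₂ : Function.Exact S.f.hom.toLinearMap S.g.hom.toLinearMap)
    (h₃ : Function.Surjective S.g.hom.toLinearMap) : S.ShortExact where
  exact := by
    refine (forget₂ (Rep.{0} ℂ G) (ModuleCat ℂ)).reflects_exact_of_faithful _ ?_
    rw [ShortComplex.moduleCat_exact_iff]
    exact fun x hx => (h₂ x).1 hx
  mono_f := (Rep.mono_iff_injective _).2 h₁
  epi_g := (Rep.epi_iff_surjective _).2 h₃

/-- The short complex `0 → W → V → V ⧸ W → 0` attached to a stable subspace. -/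
def subquotient (V : Rep.{0} ℂ G) (W : Submodule ℂ V) (hW : ∀ g, W ≤ W.comap (V.ρ g)) :
    ShortComplex (Rep.{0} ℂ G) :=
  ShortComplex.mk (V.subtype W hW) (V.mkQ W hW) (by
    ext x
    exact (Submodule.Quotient.mk_eq_zero W).2 x.2)

theorem subquotient_shortExact (V : Rep.{0} ℂ G) (W : Submodule ℂ V)
    (hW : ∀ g, W ≤ W.comap (V.ρ g)) : (subquotient V W hW).ShortExact :=
  shortExact_of W.injective_subtype (LinearMap.exact_subtype_mkQ W) W.mkQ_surjective

theorem cls_eq_add {S : ShortComplex (Rep.{0} ℂ G)} (hS : S.ShortExact)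
    (h₁ : Module.Finite ℂ S.X₁) (h₂ : Module.Finite ℂ S.X₂) (h₃ : Module.Finite ℂ S.X₃) :
    cls ⟨S.X₂, h₂⟩ = cls ⟨S.X₁, h₁⟩ + cls ⟨S.X₃, h₃⟩ := by
  have : (QuotientAddGroup.mk (FreeAbelianGroup.of (⟨S.X₂, h₂⟩ : FinRep G)) : GrothendieckGroup G)
      = QuotientAddGroup.mk (FreeAbelianGroup.of (⟨S.X₁, h₁⟩ : FinRep G)
        + FreeAbelianGroup.of ⟨S.X₃, h₃⟩) := by
    rw [QuotientAddGroup.eq]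
    rw [← neg_mem_iff]
    refine AddSubgroup.subset_closure ⟨S, h₁, h₂, h₃, hS, ?_⟩
    abel
  simp only [cls]
  rw [this, QuotientAddGroup.mk_add, TensorProduct.tmul_add]

/-- Additivity in short exact sequences of a function on finite dimensional representations. -/
def IsAdditive {M : Type*} [AddCommGroup M] (φ : FinRep G → M) : Prop :=
  ∀ (S : ShortComplex (Rep.{0} ℂ G)) (h₁ : Module.Finite ℂ S.X₁)
    (h₂ : Module.Finite ℂ S.X₂) (h₃ : Module.Finite ℂ S.X₃), S.ShortExact →
      φ ⟨S.X₂, h₂⟩ = φ ⟨S.X₁, h₁⟩ + φ ⟨S.X₃, h₃⟩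

/-- The linear extension of an additive function to the complexified Grothendieck group. -/
def liftGC {M : Type*} [AddCommGroup M] [Module ℂ M] (φ : FinRep G → M) (hφ : IsAdditive φ) :
    GC G →ₗ[ℂ] M :=
  LinearMap.liftBaseChange ℂ (AddMonoidHom.toIntLinearMap
    (QuotientAddGroup.lift (grothendieckRel G) (FreeAbelianGroup.lift φ) (by
      rw [grothendieckRel, AddSubgroup.closure_le]
      rintro x ⟨S, h₁, h₂, h₃, hS, rfl⟩
      simp [hφ S h₁ h₂ h₃ hS])))

@[simp]
theorem liftGC_cls {M : Type*} [AddCommGroup M] [Module ℂ M] (φ : FinRep G → M)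
    (hφ : IsAdditive φ) (V : FinRep G) : liftGC φ hφ (cls V) = φ V := by
  simp [liftGC, cls]

theorem span_cls : Submodule.span ℂ (Set.range (cls (G := G))) = ⊤ := by
  rw [eq_top_iff]
  rintro x -
  induction x using TensorProduct.induction_on with
  | zero => exact zero_mem _
  | add x y hx hy => exact add_mem hx hy
  | tmul c y =>
    rw [← mul_one c, ← smul_eq_mul, ← TensorProduct.smul_tmul']
    refine Submodule.smul_mem _ _ ?_
    obtain ⟨y, rfl⟩ := QuotientAddGroup.mk_surjective y
    induction y using FreeAbelianGroup.induction_on with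
    | zero => simp
    | of V => exact Submodule.subset_span ⟨V, rfl⟩
    | neg V h => simpa [TensorProduct.tmul_neg] using h
    | add x y hx hy => simpa [TensorProduct.tmul_add] using add_mem hx hy

theorem GC_hom_ext {M : Type*} [AddCommGroup M] [Module ℂ M] {f g : GC G →ₗ[ℂ] M}
    (h : ∀ V, f (cls V) = g (cls V)) : f = g :=
  LinearMap.ext_on_range span_cls h

/-- Dévissage: a property of finite dimensional representations which is stable under extensions
holds for all of them as soon as it holds for the zero and the irreducible ones. -/
theorem FinRep.devissage {P : FinRep G → Prop}
    (h0 : ∀ V : FinRep G, Subsingleton V.1 → P V)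
    (hirr : ∀ V : FinRep G, V.1.ρ.IsIrreducible → P V)
    (hext : ∀ (S : ShortComplex (Rep.{0} ℂ G)) (h₁ : Module.Finite ℂ S.X₁)
      (h₂ : Module.Finite ℂ S.X₂) (h₃ : Module.Finite ℂ S.X₃), S.ShortExact →
      P ⟨S.X₁, h₁⟩ → P ⟨S.X₃, h₃⟩ → P ⟨S.X₂, h₂⟩) (V : FinRep G) : P V := by
  obtain ⟨V, hV⟩ := V
  induction hn : Module.finrank ℂ V using Nat.strong_induction_on generalizing V with
  | _ n ih =>
  rcases subsingleton_or_nontrivial V with hs | hs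
  · exact h0 _ hs
  by_cases hi : V.ρ.IsIrreducible
  · exact hirr _ hi
  have : ∃ W : Subrepresentation V.ρ, W ≠ ⊥ ∧ W ≠ ⊤ := by
    by_contra! hW
    have : (⊥ : Subrepresentation V.ρ) ≠ ⊤ := fun h => by
      have h' := congrArg Subrepresentation.toSubmodule h
      exact bot_ne_top (α := Submodule ℂ V) h'
    have : Nontrivial (Subrepresentation V.ρ) := ⟨⟨⊥, ⊤, this⟩⟩
    refine hi ⟨?_⟩
    intro W
    by_cases h : W = ⊥
    · exact Or.inl h
    · exact Or.inr (hW W h)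
  obtain ⟨W, hb, ht⟩ := this
  have hb' : W.toSubmodule ≠ ⊥ := fun h => hb (Subrepresentation.toSubmodule_injective h)
  have ht' : W.toSubmodule ≠ ⊤ := fun h => ht (Subrepresentation.toSubmodule_injective h)
  have hs := subquotient_shortExact V W.toSubmodule W.apply_mem_toSubmodule
  have hlt := Submodule.finrank_lt ht'
  have hadd := W.toSubmodule.finrank_quotient_add_finrank
  have hpos : 0 < Module.finrank ℂ W.toSubmodule :=
    Module.finrank_pos_iff.2 ((Submodule.nontrivial_iff_ne_bot).2 hb')
  refine hext _ (inferInstanceAs (Module.Finite ℂ W.toSubmodule)) hV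
    (inferInstanceAs (Module.Finite ℂ (V ⧸ W.toSubmodule))) hs ?_ ?_
  · exact ih _ (hn ▸ hlt) _ _ rfl
  · exact ih (Module.finrank ℂ (V ⧸ W.toSubmodule)) (by omega) _ _ rfl

/-- For `V = 0` the sequence `0 → V → V → V → 0` with zero maps is exact, whence `[V] = [V] + [V]`.
-/
theorem cls_eq_zero (V : FinRep G) (hV : Subsingleton V.1) : cls V = 0 := by
  have h := cls_eq_add (S := ShortComplex.mk (0 : V.1 ⟶ V.1) (0 : V.1 ⟶ V.1) (by simp))
    (shortExact_of (fun _ _ _ => Subsingleton.elim _ _)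
      (fun x => by simp [Subsingleton.elim x 0])
      (fun x => ⟨0, Subsingleton.elim _ _⟩)) V.2 V.2 V.2
  simpa using h

theorem cls_congr {V W : FinRep G} (e : V.1 ≅ W.1) : cls V = cls W := by
  let Z : Rep.{0} ℂ G := Rep.trivial ℂ G PUnit
  have hZ : Module.Finite ℂ Z := inferInstanceAs (Module.Finite ℂ PUnit)
  have hsub : Subsingleton Z := inferInstanceAs (Subsingleton PUnit)
  have h := cls_eq_add (S := ShortComplex.mk (e.hom : V.1 ⟶ W.1) (0 : W.1 ⟶ Z) (by simp))
    (shortExact_of (Representation.equivOfIso e).injective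
      (fun x => by
        simp only [Rep.zero_hom, Representation.IntertwiningMap.zero_toLinearMap,
          LinearMap.zero_apply, true_iff]
        exact (Representation.equivOfIso e).surjective x)
      (fun x => ⟨0, Subsingleton.elim _ _⟩)) V.2 W.2 hZ
  rw [cls_eq_zero ⟨Z, hZ⟩ hsub, add_zero] at h
  exact h.symm

theorem span_cls_irreducible :
    Submodule.span ℂ (cls '' {V : FinRep G | V.1.ρ.IsIrreducible}) = ⊤ := by
  rw [eq_top_iff, ← span_cls, Submodule.span_le]
  rintro _ ⟨V, rfl⟩
  refine FinRep.devissage (P := fun V => cls V ∈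
    Submodule.span ℂ (cls '' {V : FinRep G | V.1.ρ.IsIrreducible})) ?_ ?_ ?_ V
  · intro V hV
    rw [cls_eq_zero V hV]
    exact zero_mem _
  · exact fun V hV => Submodule.subset_span ⟨V, hV, rfl⟩
  · intro S h₁ h₂ h₃ hS H₁ H₃
    rw [cls_eq_add hS h₁ h₂ h₃]
    exact add_mem H₁ H₃

/-! ### Characters -/

/-- Choose a section `s` of `g` and a retraction `r` of `f`. With `p = 1 - s g` the projection onto
the image of `f`, one has `p = f r p`, so `T₂ = T₂ f r p + T₂ s g`. Moving `r p` and `g` around the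
trace leaves `T₁` and `T₃`. -/
theorem trace_eq_add_of_exact {V₁ V₂ V₃ : Type*} [AddCommGroup V₁] [Module ℂ V₁] [AddCommGroup V₂]
    [Module ℂ V₂] [AddCommGroup V₃] [Module ℂ V₃] [Module.Finite ℂ V₁] [Module.Finite ℂ V₂]
    [Module.Finite ℂ V₃] {f : V₁ →ₗ[ℂ] V₂} {g : V₂ →ₗ[ℂ] V₃} (hf : Function.Injective f)
    (hfg : Function.Exact f g) (hg : Function.Surjective g) {T₁ : V₁ →ₗ[ℂ] V₁} {T₂ : V₂ →ₗ[ℂ] V₂}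
    {T₃ : V₃ →ₗ[ℂ] V₃} (h₁ : T₂ ∘ₗ f = f ∘ₗ T₁) (h₂ : T₃ ∘ₗ g = g ∘ₗ T₂) :
    LinearMap.trace ℂ V₂ T₂ = LinearMap.trace ℂ V₁ T₁ + LinearMap.trace ℂ V₃ T₃ := by
  obtain ⟨s, hs⟩ := g.exists_rightInverse_of_surjective (LinearMap.range_eq_top.2 hg)
  obtain ⟨r, hr⟩ := f.exists_leftInverse_of_injective (LinearMap.ker_eq_bot.2 hf)
  let p : V₂ →ₗ[ℂ] V₂ := LinearMap.id - s ∘ₗ g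
  have hgp : ∀ v, g (p v) = 0 := fun v => by
    simp [p, show g (s (g v)) = g v from DFunLike.congr_fun hs (g v)]
  have hp : f ∘ₗ (r ∘ₗ p) = p := by
    ext v
    obtain ⟨u, hu⟩ := (hfg (p v)).1 (hgp v)
    simp only [LinearMap.comp_apply, ← hu]
    rw [show r (f u) = u from DFunLike.congr_fun hr u]
  have hpf : p ∘ₗ f = f := by
    ext v
    simp [p, hfg.apply_apply_eq_zero]
  have e : T₂ = (T₂ ∘ₗ f) ∘ₗ (r ∘ₗ p) + (T₂ ∘ₗ s) ∘ₗ g := by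
    rw [LinearMap.comp_assoc, hp]
    ext v
    simp [p]
  rw [e, map_add, LinearMap.trace_comp_comm' (r ∘ₗ p), LinearMap.trace_comp_comm' g]
  congr 1
  · rw [h₁, LinearMap.comp_assoc, ← LinearMap.comp_assoc T₁ f p, hpf, ← LinearMap.comp_assoc, hr,
      LinearMap.id_comp]
  · rw [← LinearMap.comp_assoc, ← h₂, LinearMap.comp_assoc, hs, LinearMap.comp_id]

theorem character_isAdditive :
    IsAdditive (fun V : FinRep G => (V.1.ρ.character : G → ℂ)) := by
  intro S h₁ h₂ h₃ hS
  funext g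
  refine trace_eq_add_of_exact (shortExact_injective hS) (shortExact_exact hS)
    (shortExact_surjective hS) ?_ ?_
  · exact (S.f.hom.isIntertwining' g).symm
  · exact (S.g.hom.isIntertwining' g).symm

variable (G) in
/-- The character map `G_ℂ(G) → (G → ℂ)`. -/
def charGC : GC G →ₗ[ℂ] (G → ℂ) :=
  liftGC (fun V : FinRep G => (V.1.ρ.character : G → ℂ)) character_isAdditive

@[simp]
theorem charGC_cls (V : FinRep G) : charGC G (cls V) = V.1.ρ.character := liftGC_cls _ _ _

theorem charGC_conj (x : GC G) (g h : G) : charGC G x (h * g * h⁻¹) = charGC G x g := by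
  have : (LinearMap.proj (h * g * h⁻¹) : (G → ℂ) →ₗ[ℂ] ℂ) ∘ₗ charGC G
      = LinearMap.proj g ∘ₗ charGC G := GC_hom_ext fun V => by
    rw [LinearMap.comp_apply, LinearMap.comp_apply, charGC_cls]
    exact Representation.char_conj _ _ _
  exact DFunLike.congr_fun this x

end Grothendieck

/-! ### Independence of irreducible characters -/

section
variable {G : Type} [Group G]
open scoped MonoidAlgebra

/-- Jacobson density: finitely many pairwise non-isomorphic irreducible representations are separated
by elements of the group algebra. -/
theorem exists_asAlgebraHom_eq {ι : Type*} [Finite ι] [DecidableEq ι] (V : ι → Rep.{0} ℂ G)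
    [∀ i, Module.Finite ℂ (V i)] (hirr : ∀ i, (V i).ρ.IsIrreducible)
    (hne : ∀ i j, i ≠ j → IsEmpty ((V i).ρ.Equiv (V j).ρ)) (i₀ : ι) :
    ∃ r : ℂ[G], ∀ i, (V i).ρ.asAlgebraHom r = if i = i₀ then 1 else 0 := by
  classical
  have := Fintype.ofFinite ι
  let M := ∀ i, (V i).ρ.asModule
  have hsimple : ∀ i, IsSimpleModule ℂ[G] (V i).ρ.asModule := fun i =>
    (Representation.irreducible_iff_isSimpleModule_asModule _).1 (hirr i)
  have hzero : ∀ i j, i ≠ j → ∀ φ : (V i).ρ.asModule →ₗ[ℂ[G]] (V j).ρ.asModule, φ = 0 := by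
    intro i j hij φ
    have := hne i j hij
    have h1 := hirr i
    have h2 := hirr j
    refine (Representation.IntertwiningMap.equivLinearMapAsModule _ _).symm.injective ?_
    exact Subsingleton.elim _ _
  -- By Schur there are no maps between different factors, so the projection to the factor `i₀`
  -- commutes with every `ℂ[G]`-endomorphism of `M`; density then realises it by an element of
  -- `ℂ[G]` on any finite set, here a union of bases.
  let f : Module.End (Module.End ℂ[G] M) M :=
    { toFun := fun m => Pi.single i₀ (m i₀)
      map_add' := fun m m' =>
        (LinearMap.single ℂ[G] (fun i => (V i).ρ.asModule) i₀).map_add (m i₀) (m' i₀)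
      map_smul' := fun φ m => by
        ext j
        change (Pi.single i₀ (φ m i₀) : M) j = φ (Pi.single i₀ (m i₀)) j
        have key : ∀ i x, i ≠ j → φ (Pi.single i x) j = 0 := fun i x hij =>
          DFunLike.congr_fun (hzero i j hij
            ((LinearMap.proj j ∘ₗ φ) ∘ₗ LinearMap.single ℂ[G] (fun i => (V i).ρ.asModule) i)) x
        by_cases hj : j = i₀
        · subst hj
          rw [Pi.single_eq_same]
          conv_lhs => rw [← Finset.univ_sum_single m, map_sum, Finset.sum_apply]
          exact Finset.sum_eq_single _ (fun b _ hb => key _ _ hb) (by simp)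
        · rw [Pi.single_eq_of_ne hj, key _ _ (Ne.symm hj)] }
  let B := fun i => Module.finBasis ℂ (V i)
  let s : Finset M := Finset.univ.biUnion fun i => Finset.univ.image fun k =>
    (Pi.single i ((V i).ρ.asModuleEquiv.symm (B i k)) : M)
  obtain ⟨r, hr⟩ := jacobson_density (R := ℂ[G]) f s
  refine ⟨r, fun i => ?_⟩
  refine (B i).ext fun k => ?_
  have h := congrFun (hr (Pi.single i ((V i).ρ.asModuleEquiv.symm (B i k)))
    (Finset.mem_biUnion.2 ⟨i, Finset.mem_univ _, Finset.mem_image_of_mem _ (Finset.mem_univ _)⟩)) i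
  change (Pi.single i₀ _ : M) i = r • (Pi.single i _ : M) i at h
  rw [Pi.single_eq_same] at h
  have h' := congrArg (V i).ρ.asModuleEquiv h
  rw [Representation.asModuleEquiv_map_smul] at h'
  simp only [LinearEquiv.apply_symm_apply] at h'
  rw [← h']
  split_ifs with hi
  · subst hi
    simp
  · rw [Pi.single_eq_of_ne hi]
    simp

theorem trace_asAlgebraHom (V : Rep.{0} ℂ G) (r : ℂ[G]) :
    LinearMap.trace ℂ V (V.ρ.asAlgebraHom r) = ∑ g ∈ r.coeff.support, r.coeff g * V.ρ.character g := by
  rw [Representation.asAlgebraHom_def, MonoidAlgebra.lift_apply]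
  simp [Finsupp.sum, Representation.character]

/-- Characters separate the points of `G_ℂ(G)`. -/
theorem charGC_injective : Function.Injective (charGC G) := by
  classical
  let r : Setoid {V : FinRep G // V.1.ρ.IsIrreducible} :=
    { r := fun V W => Nonempty (V.1.1.ρ.Equiv W.1.1.ρ)
      iseqv := ⟨fun _ => ⟨.refl _⟩, fun ⟨e⟩ => ⟨e.symm⟩, fun ⟨e⟩ ⟨f⟩ => ⟨e.trans f⟩⟩ }
  let S : Quotient r → FinRep G := fun q => q.out.1
  have hS : ∀ q, (S q).1.ρ.IsIrreducible := fun q => q.out.2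
  have hspan : ⊤ ≤ Submodule.span ℂ (Set.range fun q => cls (S q)) := by
    rw [← span_cls_irreducible, Submodule.span_le]
    rintro _ ⟨V, hV, rfl⟩
    obtain ⟨e⟩ : Nonempty ((S ⟦⟨V, hV⟩⟧).1.ρ.Equiv V.1.ρ) := Quotient.mk_out (s := r) ⟨V, hV⟩
    exact Submodule.subset_span ⟨_, cls_congr (Rep.mkIso e)⟩
  have hli : LinearIndependent ℂ fun q => charGC G (cls (S q)) := by
    rw [linearIndependent_iff']
    intro s c hc i hi
    have hne : ∀ q q' : s, q ≠ q' → IsEmpty ((S q).1.ρ.Equiv (S q').1.ρ) := by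
      refine fun q q' hq => ⟨fun e => hq (Subtype.ext ?_)⟩
      rw [← Quotient.out_eq q.1, ← Quotient.out_eq q'.1]
      exact Quotient.sound ⟨e⟩
    have : ∀ q : s, Module.Finite ℂ (S q).1 := fun q => (S q).2
    -- Evaluating a linear relation between characters at `a` leaves only `c i * dim (S i)`, and the
    -- dimension is nonzero in `ℂ`.
    obtain ⟨a, ha⟩ := exists_asAlgebraHom_eq (ι := s) (fun q => (S q).1) (fun q => hS q)
      hne ⟨i, hi⟩
    have h0 : ∑ q ∈ s, c q * (∑ g ∈ a.coeff.support, a.coeff g * (S q).1.ρ.character g) = 0 := by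
      have : ∀ g, ∑ q ∈ s, c q * (S q).1.ρ.character g = 0 := fun g => by
        simpa using congrFun hc g
      simp only [Finset.mul_sum]
      rw [Finset.sum_comm]
      refine Finset.sum_eq_zero fun g _ => ?_
      rw [← mul_zero (a.coeff g), ← this g, Finset.mul_sum]
      exact Finset.sum_congr rfl fun q _ => by ring
    rw [← Finset.sum_coe_sort, Finset.sum_eq_single ⟨i, hi⟩] at h0
    · rw [← trace_asAlgebraHom, ha, if_pos rfl, LinearMap.trace_one] at h0
      refine (mul_eq_zero.1 h0).resolve_right ?_
      have h1 := hS i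
      have : Nontrivial (S i).1 := by
        by_contra hn
        rw [not_nontrivial_iff_subsingleton] at hn
        refine bot_ne_top (α := Subrepresentation (S i).1.ρ) ?_
        refine Subrepresentation.toSubmodule_injective ?_
        exact Subsingleton.elim (α := Submodule ℂ (S i).1) _ _
      have := (S i).2
      exact_mod_cast Module.finrank_pos.ne'
    · intro q _ hq
      rw [← trace_asAlgebraHom, ha, if_neg hq, map_zero, mul_zero]
    · simp
  rw [injective_iff_map_eq_zero]
  intro x hx
  obtain ⟨l, rfl⟩ := (Finsupp.mem_span_range_iff_exists_finsupp).1 (hspan (Submodule.mem_top (x := x)))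
  have := linearIndependent_iff.1 hli l (by
    rw [← hx, map_finsuppSum, Finsupp.linearCombination_apply]
    simp)
  simp [this]

end

/-! ### Characters of induced representations -/

section InducedCharacter

variable {G : Type} [Group G] (S : Subgroup G)

open scoped Classical in
/-- The contribution of the coset `S r` to the value at `g` of the character induced from `V`. -/
def indTerm (V : Rep.{0} ℂ S) (g r : G) : ℂ :=
  if h : r * g * r⁻¹ ∈ S then V.ρ.character ⟨r * g * r⁻¹, h⟩ else 0

theorem indTerm_mul (V : Rep.{0} ℂ S) (g r : G) (s : S) :
    indTerm S V g (s * r) = indTerm S V g r := by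
  have e : (s : G) * r * g * (s * r)⁻¹ = s * (r * g * r⁻¹) * (s : G)⁻¹ := by group
  have hiff : (s : G) * r * g * (s * r)⁻¹ ∈ S ↔ r * g * r⁻¹ ∈ S := by
    rw [e, S.mul_mem_cancel_right (S.inv_mem s.2), S.mul_mem_cancel_left s.2]
  unfold indTerm
  by_cases h : r * g * r⁻¹ ∈ S
  · rw [dif_pos h, dif_pos (hiff.2 h), ← Representation.char_conj V.ρ ⟨_, h⟩ s]
    congr 1
    exact Subtype.ext e
  · rw [dif_neg h, dif_neg (mt hiff.1 h)]

variable [S.FiniteIndex]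

attribute [local instance] Subgroup.fintypeQuotientOfFiniteIndex

-- Through `Ind ≅ Coind` the identity of `Ind V` is `∑ i_q p_q` over the cosets `q`. Cyclicity of
-- the trace turns the trace of `g` into a sum of traces of `p_q g i_q` on `V`; this map vanishes
-- unless `g` fixes the coset, where it is the action of a conjugate of `g`.
open scoped Classical in
theorem character_indF (V : Rep.{0} ℂ S) [Module.Finite ℂ V] (g : G) :
    ((indF S).obj V).ρ.character g =
      ∑ q : Quotient (QuotientGroup.rightRel S), indTerm S V g q.out := by
  let W := (indF S).obj V
  have : Module.Finite ℂ W := indF_finite S V inferInstance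
  let p : Quotient (QuotientGroup.rightRel S) → W →ₗ[ℂ] V := fun q =>
    LinearMap.proj q.out ∘ₗ (V.ρ.coindV S.subtype).subtype ∘ₗ V.indToCoind
  let i : Quotient (QuotientGroup.rightRel S) → V →ₗ[ℂ] W := fun q =>
    Representation.IndV.mk S.subtype V.ρ q.out
  have hid : ∑ q, i q ∘ₗ p q = LinearMap.id := by
    have h := Rep.indToCoind_coindToInd V
    rw [← h]
    refine LinearMap.ext fun w => ?_
    rw [LinearMap.sum_apply, LinearMap.comp_apply, Rep.coindToInd_apply]
    refine Finset.sum_congr rfl fun q _ => ?_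
    conv_rhs => rw [← Quotient.out_eq q]
    rfl
  have e : W.ρ g = ∑ q, (W.ρ g ∘ₗ i q) ∘ₗ p q := by
    simp_rw [LinearMap.comp_assoc]
    refine LinearMap.ext fun w => ?_
    simp only [LinearMap.sum_apply, LinearMap.comp_apply]
    rw [← map_sum]
    congr 1
    simpa using (DFunLike.congr_fun hid w).symm
  change LinearMap.trace ℂ W (W.ρ g) = _
  rw [e, map_sum]
  refine Finset.sum_congr rfl fun q _ => ?_
  rw [LinearMap.trace_comp_comm' (p q) (W.ρ g ∘ₗ i q)]
  have key : ∀ v, (p q ∘ₗ W.ρ g ∘ₗ i q) v = Rep.indToCoindAux V q.out v (q.out * g) := by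
    intro v
    change (V.indToCoind (W.ρ g (Representation.IndV.mk S.subtype V.ρ q.out v))).1 q.out = _
    have : W.ρ g (Representation.IndV.mk S.subtype V.ρ q.out v)
        = Representation.IndV.mk S.subtype V.ρ (q.out * g⁻¹) v := by
      simp [W]
    rw [this]
    simp only [Rep.indToCoind, LinearMap.comp_apply, Representation.Coinvariants.lift_mk,
      TensorProduct.mk_apply, TensorProduct.lift.tmul]
    simpa using congrFun (LinearMap.codRestrict_apply
      (p := V.ρ.coindV S.subtype) (V.indToCoindAux (q.out * g⁻¹)) (h := fun _ _ _ => by simp) v) q.out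
  unfold indTerm
  have hrel : (QuotientGroup.rightRel S).r (q.out * g) q.out ↔ q.out * g * q.out⁻¹ ∈ S := by
    rw [Setoid.comm', QuotientGroup.rightRel_apply]
  split_ifs with h
  · refine congrArg _ (LinearMap.ext fun v => ?_)
    rw [key, Rep.indToCoindAux, LinearMap.pi_apply, dif_pos (hrel.2 h)]
  · rw [show p q ∘ₗ W.ρ g ∘ₗ i q = 0 from LinearMap.ext fun v => by
      rw [key, Rep.indToCoindAux_of_not_rel _ _ _ (mt hrel.1 h)]; rfl, map_zero]

/-- The terms are constant on cosets of `S`, every coset meets `j(R)` by `hj`, and its preimage in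
`R` is a coset of `j⁻¹(S)`. Summing over the group `R` instead of over coset representatives
therefore only costs the factor `|j⁻¹(S)|`. -/
theorem card_mul_character_indF {R : Type} [Group R] [Fintype R] (j : R →* G)
    (hj : ∀ g : G, ∃ (s : S) (r : R), g = s * j r) (V : Rep.{0} ℂ S) [Module.Finite ℂ V] (g : G) :
    (Nat.card (S.comap j) : ℂ) * ((indF S).obj V).ρ.character g = ∑ r : R, indTerm S V g (j r) := by
  classical
  have hout : ∀ r : R, indTerm S V g (j r) =
      indTerm S V g (Quotient.mk (QuotientGroup.rightRel S) (j r)).out := by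
    intro r
    obtain ⟨s, hs⟩ := Quotient.mk_out (s := QuotientGroup.rightRel S) (j r)
    rw [← hs]
    exact (indTerm_mul S V g (j r) s).symm
  rw [character_indF, Finset.mul_sum]
  simp_rw [hout]
  rw [← Finset.sum_fiberwise (s := Finset.univ)
    (g := fun r : R => Quotient.mk (QuotientGroup.rightRel S) (j r))]
  refine Finset.sum_congr rfl fun q _ => ?_
  rw [Finset.sum_congr rfl (g := fun _ => indTerm S V g q.out)
    (fun r hr => by rw [(Finset.mem_filter.1 hr).2]), Finset.sum_const, nsmul_eq_mul]
  congr 2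
  obtain ⟨s, r₀, hr₀⟩ := hj q.out
  have hq : Quotient.mk (QuotientGroup.rightRel S) (j r₀) = q := by
    rw [← Quotient.out_eq q, hr₀]
    exact Quotient.sound ⟨s⁻¹, by simp [Subgroup.smul_def]⟩
  rw [show Nat.card (S.comap j) = ((S.comap j : Set R).toFinset).card from
    Nat.card_eq_card_toFinset _]
  refine Finset.card_bij (fun k _ => k * r₀) ?_ ?_ ?_
  · intro k hk
    rw [Finset.mem_filter]
    refine ⟨Finset.mem_univ _, ?_⟩
    rw [← hq]
    exact Quotient.sound ⟨⟨j k, (Set.mem_toFinset (s := ((S.comap j : Subgroup R) : Set R))).1 hk⟩, by simp [Subgroup.smul_def]⟩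
  · intro a _ b _ h
    exact mul_right_cancel h
  · intro r hr
    refine ⟨r * r₀⁻¹, ?_, by group⟩
    have h := (Finset.mem_filter.1 hr).2
    rw [← hq] at h
    have := QuotientGroup.rightRel_apply.1 (Quotient.exact h.symm)
    refine Set.mem_toFinset.2 ?_
    simpa using this

end InducedCharacter

/-! ### Operators of finite order and one dimensional representations -/

section FiniteOrder

variable {V : Type*} [AddCommGroup V] [Module ℂ V]

/-- An endomorphism of finite order of a complex vector space is diagonalizable. -/
theorem exists_eigenbasis [Module.Finite ℂ V] (T : V →ₗ[ℂ] V) {n : ℕ} (hn : 0 < n) (hT : T ^ n = 1) :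
    ∃ (b : Module.Basis (Fin (Module.finrank ℂ V)) ℂ V) (ω : Fin (Module.finrank ℂ V) → ℂ),
      ∀ i, T (b i) = ω i • b i := by
  have hss : Module.End.IsSemisimple T := by
    -- `T` is a root of `Xⁿ - 1`, which is separable in characteristic zero.
    refine Module.End.isSemisimple_of_squarefree_aeval_eq_zero
      (p := Polynomial.X ^ n - Polynomial.C 1) ?_ ?_
    · exact (Polynomial.separable_X_pow_sub_C (1 : ℂ) (by exact_mod_cast hn.ne')
        one_ne_zero).squarefree
    · simp [hT]
  let S : Set V := {v | ∃ μ : ℂ, T v = μ • v}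
  have hS : ⊤ ≤ Submodule.span ℂ S := by
    rw [← Module.End.IsSemisimple.iSup_eigenspace_eq_top hss, iSup_le_iff]
    exact fun μ v hv => Submodule.subset_span ⟨μ, Module.End.mem_eigenspace_iff.1 hv⟩
  let b := Module.Basis.ofSpan hS
  let e := b.indexEquiv (Module.finBasis ℂ V)
  have hb : ∀ i, ∃ μ : ℂ, T (b.reindex e i) = μ • b.reindex e i := fun i => by
    rw [Module.Basis.reindex_apply]
    exact Module.Basis.ofSpan_subset hS ⟨_, rfl⟩
  choose ω hω using hb
  exact ⟨b.reindex e, ω, hω⟩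

theorem eigenvalue_pow_eq_one {T : V →ₗ[ℂ] V} {n : ℕ} (hT : T ^ n = 1) {v : V} (hv : v ≠ 0)
    {μ : ℂ} (h : T v = μ • v) : μ ^ n = 1 := by
  have : ∀ m : ℕ, (T ^ m) v = μ ^ m • v := by
    intro m
    induction m with
    | zero => simp
    | succ m ih => rw [pow_succ', Module.End.mul_apply, ih, map_smul, h, smul_smul, pow_succ]
  have h' := this n
  rw [hT, Module.End.one_apply] at h'
  by_contra hne
  refine hv ((smul_eq_zero.1 (?_ : (μ ^ n - 1) • v = 0)).resolve_left (sub_ne_zero.2 hne))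
  rw [sub_smul, ← h', one_smul, sub_self]

theorem trace_eq_sum_of_eigenbasis {ι : Type*} [Fintype ι] (b : Module.Basis ι ℂ V) {ω : ι → ℂ}
    {T : V →ₗ[ℂ] V} (h : ∀ i, T (b i) = ω i • b i) : LinearMap.trace ℂ V T = ∑ i, ω i := by
  classical
  rw [LinearMap.trace_eq_matrix_trace ℂ b, Matrix.trace]
  refine Finset.sum_congr rfl fun i _ => ?_
  simp [LinearMap.toMatrix_apply, h]

/-- The eigenvalues are roots of unity, so conjugating them is the same as inverting them. -/
theorem star_trace_eq [Module.Finite ℂ V] {T T' : V →ₗ[ℂ] V} {n : ℕ} (hn : 0 < n) (hT : T ^ n = 1) (hT' : T' * T = 1) :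
    starRingEnd ℂ (LinearMap.trace ℂ V T) = LinearMap.trace ℂ V T' := by
  obtain ⟨b, ω, hb⟩ := exists_eigenbasis T hn hT
  have hω : ∀ i, ‖ω i‖ = 1 := fun i =>
    Complex.norm_eq_one_of_pow_eq_one (eigenvalue_pow_eq_one hT (b.ne_zero i) (hb i)) hn.ne'
  have hb' : ∀ i, T' (b i) = starRingEnd ℂ (ω i) • b i := by
    intro i
    have h1 : T' (T (b i)) = b i := DFunLike.congr_fun hT' (b i)
    rw [hb, map_smul] at h1
    have h2 : starRingEnd ℂ (ω i) * ω i = 1 := by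
      rw [mul_comm, Complex.mul_conj, Complex.normSq_eq_norm_sq, hω]; simp
    conv_rhs => rw [← h1, smul_smul, h2, one_smul]
  rw [trace_eq_sum_of_eigenbasis b hb, trace_eq_sum_of_eigenbasis b hb', map_sum]

theorem star_character [Module.Finite ℂ V] {G : Type*} [Group G] [Finite G] (ρ : Representation ℂ G V) (g : G) :
    starRingEnd ℂ (ρ.character g) = ρ.character g⁻¹ := by
  refine star_trace_eq (Nat.card_pos (α := G)) ?_ ?_
  · rw [← map_pow, pow_card_eq_one', map_one]
  · rw [← map_mul, inv_mul_cancel, map_one]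

end FiniteOrder

/-- A one-dimensional representation is given by a character. -/
theorem exists_character_of_finrank_eq_one {K : Type*} [Group K] {V : Type*} [AddCommGroup V]
    [Module ℂ V] (ρ : Representation ℂ K V) (h : Module.finrank ℂ V = 1) :
    ∃ ψ : K →* ℂˣ, ∀ k v, ρ k v = (ψ k : ℂ) • v := by
  choose c hc using fun k => (LinearMap.existsUnique_eq_smul_id_of_finrank_eq_one h (ρ k)).exists
  have hnt : Nontrivial V := Module.nontrivial_of_finrank_eq_succ h
  obtain ⟨v, hv⟩ := exists_ne (0 : V)
  have key : ∀ k w, ρ k w = c k • w := fun k w => by rw [hc k]; simp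
  let φ : K →* ℂ :=
    { toFun := c
      map_one' := by
        have := key 1 v
        rw [map_one, Module.End.one_apply] at this
        exact smul_left_injective ℂ hv (by simp [← this])
      map_mul' := fun a b => by
        have := key (a * b) v
        rw [map_mul, Module.End.mul_apply, key b, map_smul, key a, smul_smul] at this
        exact smul_left_injective ℂ hv (by simp [← this, mul_comm]) }
  exact ⟨φ.toHomUnits, key⟩

/-- Commuting operators on a nonzero space have a common eigenvector. -/
theorem exists_weight_vector {K : Type} [CommGroup K] (V : FinRep K) (hV : Nontrivial V.1) :
    ∃ (ψ : K →* ℂˣ) (v : V.1), v ≠ 0 ∧ ∀ k, V.1.ρ k v = (ψ k : ℂ) • v := by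
  revert hV
  refine FinRep.devissage (P := fun V : FinRep K => Nontrivial V.1 →
    ∃ (ψ : K →* ℂˣ) (v : V.1), v ≠ 0 ∧ ∀ k, V.1.ρ k v = (ψ k : ℂ) • v) ?_ ?_ ?_ V
  · intro V h h'
    exact (not_nontrivial_iff_subsingleton.2 h h').elim
  · intro V hirr hV
    have := V.2
    obtain ⟨ψ, hψ⟩ := exists_character_of_finrank_eq_one V.1.ρ
      (Representation.IsIrreducible.finrank_eq_one_of_isMulCommutative V.1.ρ)
    obtain ⟨v, hv⟩ := exists_ne (0 : V.1)
    exact ⟨ψ, v, hv, fun k => hψ k v⟩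
  · intro S h₁ h₂ h₃ hS H₁ H₃ hV
    have hinj := shortExact_injective hS
    rcases subsingleton_or_nontrivial S.X₁ with hs | hs
    · have hg : Function.Injective S.g.hom.toLinearMap := by
        rw [injective_iff_map_eq_zero]
        intro v hv
        obtain ⟨u, rfl⟩ := (shortExact_exact hS v).1 hv
        rw [Subsingleton.elim u 0, map_zero]
      obtain ⟨ψ, v, hv, h⟩ := H₃ (@Function.Injective.nontrivial _ _ hV _ hg)
      obtain ⟨u, rfl⟩ := shortExact_surjective hS v
      refine ⟨ψ, u, fun h0 => hv (by rw [h0, map_zero]), fun k => hg ?_⟩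
      rw [map_smul, ← h k]
      exact Rep.hom_comm_apply S.g k u
    · obtain ⟨ψ, v, hv, h⟩ := H₁ hs
      refine ⟨ψ, S.f.hom.toLinearMap v, fun h0 => hv (hinj (by rw [h0, map_zero])), fun k => ?_⟩
      rw [← map_smul, ← h k]
      exact (Rep.hom_comm_apply S.f k v).symm

/-! ### Weight spaces for the action of the lattice -/

section Weights

variable {Γ X : Type} [Group Γ] [AddCommGroup X] [DistribMulAction Γ X]

open SemidirectProduct

/-- The action `t ↦ t ∘ ρ(γ)⁻¹` of `Γ` on `T`. -/
def moveT (γ : Γ) (t : Torus X) : Torus X := t.comp (latticeAut Γ X γ⁻¹).toMonoidHom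

theorem moveT_apply (γ : Γ) (t : Torus X) (x : Multiplicative X) :
    moveT γ t x = t (latticeAut Γ X γ⁻¹ x) := rfl

theorem moveT_one (t : Torus X) : moveT (1 : Γ) t = t := by
  ext x
  simp [moveT_apply]

theorem moveT_mul (γ δ : Γ) (t : Torus X) : moveT (γ * δ) t = moveT γ (moveT δ t) := by
  ext x
  simp [moveT_apply]

theorem moveT_injective (γ : Γ) : Function.Injective (moveT (X := X) γ) := by
  intro s t h
  rw [← moveT_one (Γ := Γ) s, ← moveT_one (Γ := Γ) t, ← inv_mul_cancel γ, moveT_mul, moveT_mul, h]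

theorem mem_stab_iff {γ : Γ} {t : Torus X} : γ ∈ stab Γ t ↔ moveT γ t = t := by
  rw [← inv_mem_iff]
  rfl

/-- The functions on `X` given by the elements of `T`. -/
def torusFun (t : Torus X) : Multiplicative X → ℂ := fun x => t x

theorem torusFun_linearIndependent : LinearIndependent ℂ (torusFun (X := X)) := by
  refine (linearIndependent_monoidHom (Multiplicative X) ℂ).comp
    (fun t : Torus X => (Units.coeHom ℂ).comp t) ?_
  intro s t h
  ext x
  exact DFunLike.congr_fun h x

variable (V : Rep.{0} ℂ (Crossed Γ X))

/-- The eigenspace of `X` in `V` for the character `t`. -/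
def weightSpace (t : Torus X) : Submodule ℂ V where
  carrier := {v | ∀ x, V.ρ (inl x) v = (t x : ℂ) • v}
  add_mem' hv hw x := by rw [map_add, hv x, hw x, smul_add]
  zero_mem' x := by simp
  smul_mem' c v hv x := by rw [map_smul, hv x, smul_comm]

variable {V}

/-- Rests on `x γ = γ (γ⁻¹ x)` in `Γ ⋉ X`: the group `Γ` permutes the weight spaces as it permutes
`T`. -/
theorem inr_mem_weightSpace {t : Torus X} {v : V} (hv : v ∈ weightSpace V t) (γ : Γ) :
    V.ρ (inr γ) v ∈ weightSpace V (moveT γ t) := by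
  intro x
  have h : inl x * inr γ = (inr γ * inl (latticeAut Γ X γ⁻¹ x) : Crossed Γ X) := by
    ext <;> simp
  rw [← Module.End.mul_apply, ← map_mul, h, map_mul, Module.End.mul_apply, hv, map_smul]
  rfl

variable (V) in
/-- The representation of `Γ_t` on the weight space for `t`. -/
def weightRep (t : Torus X) : Representation ℂ (stab Γ t) (weightSpace V t) where
  toFun γ := (V.ρ (inr (γ : Γ))).restrict fun v hv => by
    have := inr_mem_weightSpace hv (γ : Γ)
    rwa [mem_stab_iff.1 γ.2] at this
  map_one' := by ext; simp
  map_mul' γ δ := by ext; simp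

/-- The weight vectors span a subspace which is stable under `Γ ⋉ X`, since `Γ` permutes weights,
and which is nonzero because the commuting operators from `X` have a common eigenvector.
Irreducibility makes it everything; in general `X` need not act semisimply. -/
theorem exists_weight_basis [Module.Finite ℂ V] (hV : V.ρ.IsIrreducible) :
    ∃ (b : Module.Basis (Fin (Module.finrank ℂ V)) ℂ V)
      (σ : Fin (Module.finrank ℂ V) → Torus X), ∀ i, b i ∈ weightSpace V (σ i) := by
  let S : Set V := {v | ∃ t, v ∈ weightSpace V t}
  have hnt : Nontrivial V := by
    by_contra hn
    rw [not_nontrivial_iff_subsingleton] at hn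
    exact bot_ne_top (α := Subrepresentation V.ρ) (Subrepresentation.toSubmodule_injective
      (Subsingleton.elim (α := Submodule ℂ V) _ _))
  let W : Subrepresentation V.ρ :=
    { toSubmodule := Submodule.span ℂ S
      apply_mem_toSubmodule := by
        intro g v hv
        have : Submodule.span ℂ S ≤ (Submodule.span ℂ S).comap (V.ρ g) := by
          rw [Submodule.span_le]
          rintro v ⟨t, hv⟩
          refine Submodule.subset_span ⟨moveT g.right t, ?_⟩
          rw [← inl_left_mul_inr_right g, map_mul, Module.End.mul_apply,
            inr_mem_weightSpace hv]
          refine Submodule.smul_mem _ _ ?_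
          simpa using inr_mem_weightSpace hv g.right
        exact this hv }
  have hW : W = ⊤ := by
    refine (hV.eq_bot_or_eq_top W).resolve_left fun h => ?_
    obtain ⟨t, v, hv, h'⟩ := exists_weight_vector
      (⟨Rep.of (V.ρ.comp (inl : Multiplicative X →* Crossed Γ X)), ‹_›⟩ : FinRep (Multiplicative X))
      hnt
    have : v ∈ W.toSubmodule := Submodule.subset_span ⟨t, h'⟩
    rw [h] at this
    exact hv this
  have hS : ⊤ ≤ Submodule.span ℂ S := (congrArg Subrepresentation.toSubmodule hW).ge
  let b := Module.Basis.ofSpan hS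
  let e := b.indexEquiv (Module.finBasis ℂ V)
  have hb : ∀ i, ∃ t, b.reindex e i ∈ weightSpace V t := fun i => by
    rw [Module.Basis.reindex_apply]
    exact Module.Basis.ofSpan_subset hS ⟨_, rfl⟩
  choose σ hσ using hb
  exact ⟨b.reindex e, σ, hσ⟩

variable {ι : Type*} (b : Module.Basis ι ℂ V) {σ : ι → Torus X}
  (hb : ∀ i, b i ∈ weightSpace V (σ i))

include hb

theorem coord_inl (i : ι) (x : Multiplicative X) (v : V) :
    b.coord i (V.ρ (inl x) v) = (σ i x : ℂ) * b.coord i v := by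
  classical
  have : b.coord i ∘ₗ V.ρ (inl x) = (σ i x : ℂ) • b.coord i := by
    refine b.ext fun j => ?_
    rw [LinearMap.comp_apply, hb j x]
    simp only [map_smul, LinearMap.smul_apply, Module.Basis.coord_apply, Module.Basis.repr_self,
      smul_eq_mul, Finsupp.single_apply]
    split_ifs with h
    · rw [h]
    · simp
  exact DFunLike.congr_fun this v

theorem coord_eq_zero {t : Torus X} {v : V} (hv : v ∈ weightSpace V t) {i : ι} (h : σ i ≠ t) :
    b.coord i v = 0 := by
  by_contra h0
  refine h (MonoidHom.ext fun x => Units.ext ?_)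
  have := coord_inl b hb i x v
  rw [hv x, map_smul, smul_eq_mul] at this
  exact (mul_right_cancel₀ h0 this).symm

theorem character_eq_sum [Fintype ι] (y : Multiplicative X) (γ : Γ) :
    V.ρ.character ⟨y, γ⟩ = ∑ i, (σ i y : ℂ) * b.coord i (V.ρ (inr γ) (b i)) := by
  classical
  rw [Representation.character, LinearMap.trace_eq_matrix_trace ℂ b, Matrix.trace]
  refine Finset.sum_congr rfl fun i _ => ?_
  rw [Matrix.diag_apply, LinearMap.toMatrix_apply, ← coord_inl b hb, mk_eq_inl_mul_inr, map_mul]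
  rfl

/-- The basis vectors of weight `t` define a projection `P` onto the weight space, and the trace of
`γ` there is the trace of `P γ` on `V`, computed in the full basis. -/
theorem character_weightRep [Fintype ι] [DecidableEq (Torus X)] [Module.Finite ℂ V] (t : Torus X)
    (γ : stab Γ t) : (weightRep V t).character γ =
      ∑ i, if σ i = t then b.coord i (V.ρ (inr (γ : Γ)) (b i)) else 0 := by
  classical
  let P : V →ₗ[ℂ] V := b.constr ℂ fun i => if σ i = t then b i else 0
  have hP : ∀ v, P v ∈ weightSpace V t := by
    intro v
    rw [b.constr_apply_fintype ℂ]
    refine Submodule.sum_mem _ fun i _ => Submodule.smul_mem _ _ ?_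
    split_ifs with h
    · exact h ▸ hb i
    · exact zero_mem _
  have hP' : ∀ v ∈ weightSpace V t, P v = v := by
    intro v hv
    conv_rhs => rw [← b.sum_repr v]
    rw [b.constr_apply_fintype ℂ]
    refine Finset.sum_congr rfl fun i _ => ?_
    split_ifs with h
    · rfl
    · rw [show b.equivFun v i = b.coord i v from rfl, coord_eq_zero b hb hv h, zero_smul,
        show b.repr v i = b.coord i v from rfl, coord_eq_zero b hb hv h, zero_smul]
  let p : V →ₗ[ℂ] weightSpace V t := P.codRestrict _ hP
  have h1 : weightRep V t γ = (p ∘ₗ V.ρ (inr (γ : Γ))) ∘ₗ (weightSpace V t).subtype := by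
    ext v
    exact (hP' _ (weightRep V t γ v).2).symm
  rw [Representation.character, h1, LinearMap.trace_comp_comm',
    LinearMap.trace_eq_matrix_trace ℂ b, Matrix.trace]
  refine Finset.sum_congr rfl fun i _ => ?_
  rw [Matrix.diag_apply, LinearMap.toMatrix_apply]
  change b.coord i (P (V.ρ (inr (γ : Γ)) (b i))) = _
  rw [b.constr_apply_fintype ℂ, map_sum]
  rw [Finset.sum_eq_single i]
  · split_ifs <;> simp
  · intro j _ hj
    split_ifs <;> simp [hj]
  · simp

end Weights

/-! ### The coefficients `a_{γ,t}` of characters -/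

section Coefficients

variable {Γ X : Type} [Group Γ] [AddCommGroup X] [DistribMulAction Γ X]

open SemidirectProduct

/-- The restriction of characters of `Γ ⋉ X` to the coset `X γ`. -/
def cosetChar (γ : Γ) : GC (Crossed Γ X) →ₗ[ℂ] (Multiplicative X → ℂ) :=
  LinearMap.funLeft ℂ ℂ (fun y : Multiplicative X => (⟨y, γ⟩ : Crossed Γ X)) ∘ₗ
    charGC (Crossed Γ X)

theorem cosetChar_apply (γ : Γ) (x : GC (Crossed Γ X)) (y : Multiplicative X) :
    cosetChar γ x y = charGC _ x ⟨y, γ⟩ := rfl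

/-- Classes of irreducibles span `G_ℂ`, and for these a weight basis displays the character on `Xγ`
as a combination of weights. -/
theorem cosetChar_mem (γ : Γ) (x : GC (Crossed Γ X)) :
    cosetChar γ x ∈ Submodule.span ℂ (Set.range (torusFun (X := X))) := by
  have : ⊤ ≤ (Submodule.span ℂ (Set.range (torusFun (X := X)))).comap (cosetChar γ) := by
    rw [← span_cls_irreducible, Submodule.span_le]
    rintro _ ⟨V, hV, rfl⟩
    have := V.2
    obtain ⟨b, σ, hb⟩ := exists_weight_basis (V := V.1) hV
    have e : cosetChar γ (cls V) =
        ∑ i, (b.coord i (V.1.ρ (inr γ) (b i))) • torusFun (σ i) := by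
      funext y
      rw [cosetChar_apply, charGC_cls, character_eq_sum b hb]
      simp [torusFun, mul_comm]
    rw [SetLike.mem_coe, Submodule.mem_comap, e]
    exact Submodule.sum_mem _ fun i _ => Submodule.smul_mem _ _ (Submodule.subset_span ⟨_, rfl⟩)
  exact this Submodule.mem_top

/-- The coefficients `a_{γ,t}` in the expansion `χ(yγ) = ∑_t a_{γ,t} t(y)` of characters of
`Γ ⋉ X`. -/
def coefGC (γ : Γ) : GC (Crossed Γ X) →ₗ[ℂ] (Torus X →₀ ℂ) :=
  torusFun_linearIndependent.repr.comp
    ((cosetChar γ).codRestrict _ (cosetChar_mem γ))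

theorem linearCombination_coefGC (γ : Γ) (x : GC (Crossed Γ X)) :
    Finsupp.linearCombination ℂ torusFun (coefGC γ x) = cosetChar γ x :=
  torusFun_linearIndependent.linearCombination_repr _

theorem coefGC_eq_of {γ : Γ} {x : GC (Crossed Γ X)} {l : Torus X →₀ ℂ}
    (h : Finsupp.linearCombination ℂ torusFun l = cosetChar γ x) : coefGC γ x = l := by
  refine torusFun_linearIndependent ?_
  rw [linearCombination_coefGC, h]

theorem charGC_eq_sum (γ : Γ) (x : GC (Crossed Γ X)) (y : Multiplicative X) :
    charGC _ x ⟨y, γ⟩ = (coefGC γ x).sum fun t c => c * t y := by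
  rw [← cosetChar_apply, ← linearCombination_coefGC, Finsupp.linearCombination_apply,
    Finsupp.sum, Finsupp.sum, Finset.sum_apply]
  rfl

theorem coefGC_ext {x y : GC (Crossed Γ X)} (h : ∀ γ, coefGC γ x = coefGC γ y) : x = y := by
  refine charGC_injective (funext fun w => ?_)
  obtain ⟨a, γ⟩ := w
  rw [charGC_eq_sum, charGC_eq_sum, h]

theorem coefGC_cls {V : FinRep (Crossed Γ X)} {ι : Type*} [Fintype ι] (b : Module.Basis ι ℂ V.1)
    {σ : ι → Torus X} (hb : ∀ i, b i ∈ weightSpace V.1 (σ i)) (γ : Γ) :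
    coefGC γ (cls V) = ∑ i, Finsupp.single (σ i) (b.coord i (V.1.ρ (inr γ) (b i))) := by
  refine coefGC_eq_of (funext fun y => ?_)
  rw [cosetChar_apply, charGC_cls, character_eq_sum b hb, map_sum, Finset.sum_apply]
  simp [torusFun, mul_comm]

/-- This gives the coefficients their representation theoretic meaning. Irreducibility enters only
through the existence of a weight basis. -/
theorem coefGC_cls_irreducible {V : FinRep (Crossed Γ X)} (hV : V.1.ρ.IsIrreducible) {t : Torus X}
    (γ : stab Γ t) : coefGC (γ : Γ) (cls V) t = (weightRep V.1 t).character γ := by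
  classical
  have := V.2
  obtain ⟨b, σ, hb⟩ := exists_weight_basis (V := V.1) hV
  rw [coefGC_cls b hb, character_weightRep b hb, Finsupp.finsetSum_apply]
  refine Finset.sum_congr rfl fun i _ => ?_
  rw [Finsupp.single_apply]

/-- Conjugation by `δ` leaves characters unchanged and carries the coset `Xγ` to `Xδγδ⁻¹`, acting on
`X` by `δ`; compare the two expansions. -/
theorem mapDomain_coefGC (x : GC (Crossed Γ X)) (γ δ : Γ) :
    Finsupp.mapDomain (moveT δ) (coefGC γ x) = coefGC (δ * γ * δ⁻¹) x := by
  symm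
  refine coefGC_eq_of (funext fun y => ?_)
  rw [Finsupp.linearCombination_mapDomain, cosetChar_apply]
  have e : (⟨y, δ * γ * δ⁻¹⟩ : Crossed Γ X)
      = inr δ * ⟨latticeAut Γ X δ⁻¹ y, γ⟩ * (inr δ)⁻¹ := by
    ext <;> simp
  rw [e, charGC_conj, charGC_eq_sum, Finsupp.linearCombination_apply, Finsupp.sum, Finsupp.sum,
    Finset.sum_apply]
  rfl

theorem coefGC_moveT (x : GC (Crossed Γ X)) (γ δ : Γ) (t : Torus X) :
    coefGC (δ * γ * δ⁻¹) x (moveT δ t) = coefGC γ x t := by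
  rw [← mapDomain_coefGC, Finsupp.mapDomain_apply (moveT_injective δ)]

/-- Conjugating `yγ` by `z ∈ X` gives `(y + z - γz)γ`, so uniqueness of the expansion yields
`a_{γ,t} = t(z - γz) a_{γ,t}` for all `z`. A nonzero coefficient thus forces `t ∘ γ = t`. -/
theorem coefGC_eq_zero (x : GC (Crossed Γ X)) {γ : Γ} {t : Torus X} (h : γ ∉ stab Γ t) :
    coefGC γ x t = 0 := by
  have key : ∀ z : Multiplicative X, (((t z : ℂˣ) : ℂ) - t (latticeAut Γ X γ z)) * coefGC γ x t
      = 0 := by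
    intro z
    have h1 : (coefGC γ x).sum (fun s c => Finsupp.single s (((s z / s (latticeAut Γ X γ z) : ℂˣ) :
        ℂ) * c)) = coefGC γ x := by
      symm
      refine coefGC_eq_of (funext fun y => ?_)
      have e : (⟨y * (z / latticeAut Γ X γ z), γ⟩ : Crossed Γ X) = inl z * ⟨y, γ⟩ * (inl z)⁻¹ := by
        ext
        · simp only [mul_left, left_inl, right_inl, mul_right, ← map_inv, map_one,
            MulAut.one_apply, one_mul]
          rw [mul_comm z y, mul_assoc, div_eq_mul_inv, map_inv]
        · simp
      rw [cosetChar_apply, ← charGC_conj x ⟨y, γ⟩ (inl z), ← e, charGC_eq_sum, map_finsuppSum,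
        Finsupp.sum, Finsupp.sum, Finset.sum_apply]
      refine Finset.sum_congr rfl fun s _ => ?_
      simp only [Finsupp.linearCombination_single, Pi.smul_apply, torusFun, map_mul, map_div,
        Units.val_mul, smul_eq_mul]
      ring
    have h2 := DFunLike.congr_fun h1 t
    rw [Finsupp.sum, Finsupp.finsetSum_apply, Finset.sum_eq_single t] at h2
    · rw [Finsupp.single_eq_same, Units.val_div_eq_div_val, div_mul_eq_mul_div,
        div_eq_iff (Units.ne_zero _)] at h2
      rw [sub_mul, h2, mul_comm, sub_self]
    · intro s _ hs
      exact Finsupp.single_eq_of_ne (Ne.symm hs)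
    · intro ht
      rw [Finsupp.notMem_support_iff.1 ht, mul_zero, Finsupp.single_zero, Finsupp.zero_apply]
  by_contra h0
  refine h (MonoidHom.ext fun z => Units.ext ?_)
  exact (sub_eq_zero.1 ((mul_eq_zero.1 (key z)).resolve_right h0)).symm

/-- Dévissage reduces to irreducibles, where the coefficient is a character value of the finite
group `Γ_t`. The identity concerns classes of actual representations only, not their complex
combinations; it is what makes `EP` conjugate-linear in the first variable. -/
theorem star_coefGC_cls [Finite Γ] (V : FinRep (Crossed Γ X)) (γ : Γ) (t : Torus X) :
    starRingEnd ℂ (coefGC γ (cls V) t) = coefGC γ⁻¹ (cls V) t := by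
  by_cases h : γ ∈ stab Γ t
  · refine FinRep.devissage (P := fun V => starRingEnd ℂ (coefGC γ (cls V) t)
      = coefGC γ⁻¹ (cls V) t) ?_ ?_ ?_ V
    · intro V hV
      simp [cls_eq_zero V hV]
    · intro V hV
      have := V.2
      rw [coefGC_cls_irreducible hV (⟨γ, h⟩ : stab Γ t), star_character]
      exact (coefGC_cls_irreducible hV (⟨γ, h⟩ : stab Γ t)⁻¹).symm
    · intro S h₁ h₂ h₃ hS H₁ H₃
      simp only [cls_eq_add hS h₁ h₂ h₃, map_add, Finsupp.add_apply, H₁, H₃]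
  · rw [coefGC_eq_zero _ h, coefGC_eq_zero _ (mt inv_mem_iff.1 h), map_zero]

end Coefficients

/-! ### Orthogonality of characters of finite abelian groups -/

section Characters

/-- Translating the sum by a character `φ` with `φ a ≠ 1` multiplies it by `φ a`. -/
theorem sum_char_eq_zero {A : Type*} [CommGroup A] [Finite A] [Fintype (A →* ℂˣ)] {a : A}
    (ha : a ≠ 1) : ∑ χ : A →* ℂˣ, (χ a : ℂ) = 0 := by
  obtain ⟨φ, hφ⟩ := CommGroup.exists_apply_ne_one_of_hasEnoughRootsOfUnity A ℂ ha
  have h : ∑ χ : A →* ℂˣ, (χ a : ℂ) = (φ a : ℂ) * ∑ χ : A →* ℂˣ, (χ a : ℂ) := by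
    rw [Finset.mul_sum]
    refine Fintype.sum_equiv (Equiv.mulLeft φ⁻¹) _ _ fun χ => ?_
    simp
  have h' : ((φ a : ℂ) - 1) * ∑ χ : A →* ℂˣ, (χ a : ℂ) = 0 := by
    rw [sub_mul, ← h, one_mul, sub_self]
  refine (mul_eq_zero.1 h').resolve_left fun h0 => hφ (Units.ext (sub_eq_zero.1 h0))

instance finite_charGroup (A : Type*) [Group A] [Finite A] [IsMulCommutative A] : Finite (A →* ℂˣ) := by
  open scoped IsMulCommutative in
  have := CommGroup.card_monoidHom_of_hasEnoughRootsOfUnity A ℂ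
  exact Nat.finite_of_card_ne_zero (by rw [this]; exact Nat.card_pos.ne')

instance fintype_charGroup (A : Type*) [Group A] [Finite A] [IsMulCommutative A] :
    Fintype (A →* ℂˣ) := Fintype.ofFinite _

/-- The generator of a cyclic group of powers. -/
abbrev zgen {Γ : Type*} [Group Γ] (γ : Γ) : Subgroup.zpowers γ := ⟨γ, Subgroup.mem_zpowers γ⟩

open scoped Classical in
theorem sum_char {Γ : Type*} [Group Γ] [Finite Γ] (γ : Γ) (c : Subgroup.zpowers γ) :
    ∑ χ : Subgroup.zpowers γ →* ℂˣ, (χ (zgen γ) : ℂ)⁻¹ * χ c =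
      if (c : Γ) = γ then (Nat.card (Subgroup.zpowers γ) : ℂ) else 0 := by
  open scoped IsMulCommutative in
  have h : ∀ χ : Subgroup.zpowers γ →* ℂˣ, (χ (zgen γ) : ℂ)⁻¹ * χ c
      = χ ((zgen γ)⁻¹ * c) := fun χ => by simp
  simp only [h]
  split_ifs with hc
  · have : c = zgen γ := Subtype.ext hc
    subst this
    simp only [inv_mul_cancel, map_one, Units.val_one, Finset.sum_const, nsmul_eq_mul, mul_one,
      Finset.card_univ]
    rw [← Nat.card_eq_fintype_card, CommGroup.card_monoidHom_of_hasEnoughRootsOfUnity]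
  · refine sum_char_eq_zero fun h1 => hc ?_
    rw [inv_mul_eq_one] at h1
    rw [← h1]

open scoped Classical in
/-- Extension by zero of a character of a subgroup. -/
def extChar {Γ : Type*} [Group Γ] {H : Subgroup Γ} (χ : H →* ℂˣ) (δ : Γ) : ℂ :=
  if h : δ ∈ H then χ ⟨δ, h⟩ else 0

theorem extChar_coe {Γ : Type*} [Group Γ] {H : Subgroup Γ} (χ : H →* ℂˣ) (δ : H) :
    extChar χ δ = χ δ := dif_pos δ.2

theorem extChar_of_notMem {Γ : Type*} [Group Γ] {H : Subgroup Γ} (χ : H →* ℂˣ) {δ : Γ}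
    (h : δ ∉ H) : extChar χ δ = 0 := dif_neg h

open scoped Classical in
theorem sum_extChar {Γ : Type*} [Group Γ] [Finite Γ] (γ δ : Γ) :
    ∑ χ : Subgroup.zpowers γ →* ℂˣ, (χ (zgen γ) : ℂ)⁻¹ * extChar χ δ =
      if δ = γ then (Nat.card (Subgroup.zpowers γ) : ℂ) else 0 := by
  by_cases h : δ ∈ Subgroup.zpowers γ
  · rw [← sum_char γ ⟨δ, h⟩]
    exact Finset.sum_congr rfl fun χ _ => by rw [← extChar_coe χ ⟨δ, h⟩]
  · rw [if_neg (by rintro rfl; exact h (Subgroup.mem_zpowers _))]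
    exact Finset.sum_eq_zero fun χ _ => by rw [extChar_of_notMem χ h, mul_zero]

variable {K : Type} [Group K]

/-- A character, as a representation on `ℂ`. -/
def charHom (ψ : K →* ℂˣ) : Representation ℂ K ℂ where
  toFun k := (ψ k : ℂ) • LinearMap.id
  map_one' := by ext; simp
  map_mul' k l := by ext; simp [mul_comm]

/-- A character, as a one dimensional representation. -/
abbrev charRep (ψ : K →* ℂˣ) : Rep.{0} ℂ K := Rep.of (charHom ψ)

theorem charRep_finite (ψ : K →* ℂˣ) : Module.Finite ℂ (charRep ψ) :=
  inferInstanceAs (Module.Finite ℂ ℂ)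

theorem character_charHom (ψ : K →* ℂˣ) (k : K) : (charHom ψ).character k = ψ k := by
  rw [Representation.character, charHom]
  simp

/-- The class of a character. -/
def clsChar (ψ : K →* ℂˣ) : GC K := cls ⟨charRep ψ, charRep_finite ψ⟩

end Characters

/-! ### Induced classes and elements without fixpoints -/

section InducedClasses

variable {G : Type} [Group G]

theorem indGC_cls (S : Subgroup G) [S.FiniteIndex] (V : FinRep S) :
    indGC S (cls V) = cls ⟨(indF S).obj V.1, indF_finite S V.1 V.2⟩ := mapGC_cls ..

theorem card_mul_charGC_indGC (S : Subgroup G) [S.FiniteIndex] {R : Type} [Group R] [Fintype R]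
    (j : R →* G) (hj : ∀ g : G, ∃ (s : S) (r : R), g = s * j r) (V : FinRep S) {φ : G → ℂ}
    (hφ : ∀ s : S, V.1.ρ.character s = φ s) (hφ' : ∀ g ∉ S, φ g = 0) (g : G) :
    (Nat.card (S.comap j) : ℂ) * charGC G (indGC S (cls V)) g = ∑ r, φ (j r * g * (j r)⁻¹) := by
  have := V.2
  rw [indGC_cls, charGC_cls, card_mul_character_indF S j hj]
  refine Finset.sum_congr rfl fun r _ => ?_
  unfold indTerm
  split_ifs with h
  · exact hφ ⟨_, h⟩
  · exact (hφ' _ h).symm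

theorem charGC_indGC_eq_zero (S : Subgroup G) [S.FiniteIndex] {R : Type} [Group R] [Finite R]
    (j : R →* G) (hj : ∀ g : G, ∃ (s : S) (r : R), g = s * j r) {g : G}
    (h : ∀ r, j r * g * (j r)⁻¹ ∉ S) (x : GC S) : charGC G (indGC S x) g = 0 := by
  have : ⊤ ≤ LinearMap.ker (LinearMap.proj g ∘ₗ charGC G ∘ₗ indGC S) := by
    rw [← span_cls, Submodule.span_le]
    rintro _ ⟨V, rfl⟩
    have := V.2
    have := Fintype.ofFinite R
    have h0 : (Nat.card (S.comap j) : ℂ) ≠ 0 := by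
      exact_mod_cast Nat.card_pos.ne'
    refine (mul_eq_zero.1 ?_).resolve_left h0
    change _ * charGC G (indGC S (cls V)) g = 0
    rw [indGC_cls, charGC_cls, card_mul_character_indF S j hj]
    exact Finset.sum_eq_zero fun r _ => dif_neg (h r)
  exact this (Submodule.mem_top (x := x))

/-- `γ` has no nonzero fixpoint in the representation `ρ`. -/
def FixesOnlyZero {k E : Type*} [CommSemiring k] [AddCommMonoid E] [Module k E]
    (ρ : Representation k G E) (γ : G) : Prop := ∀ e, ρ γ e = e → e = 0

/-- A conjugate of `γ` in `H` would fix the nonzero vectors of `E^H`. Hence characters induced from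
such `H` vanish at `γ`. -/
theorem FixesOnlyZero.conj_notMem {k E : Type*} [CommRing k] [AddCommGroup E] [Module k E]
    {ρ : Representation k G E} {γ : G} (hγ : FixesOnlyZero ρ γ) {H : Subgroup G}
    (hH : Representation.invariants (ρ.comp H.subtype) ≠ ⊥) (r : G) : r * γ * r⁻¹ ∉ H := by
  intro h
  obtain ⟨e, he, h0⟩ := Submodule.exists_mem_ne_zero_of_ne_bot hH
  have h1 : ρ (r * γ * r⁻¹) e = e := he ⟨_, h⟩
  have h2 : ρ γ (ρ r⁻¹ e) = ρ r⁻¹ e := by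
    conv_rhs => rw [← h1]
    rw [← Module.End.mul_apply, ← Module.End.mul_apply, ← map_mul, ← map_mul]
    congr 2
    group
  have h3 := congrArg (ρ r) (hγ _ h2)
  rw [← Module.End.mul_apply, ← map_mul, mul_inv_cancel, map_one, map_zero] at h3
  exact h0 h3

/-- Whatever `γ` fixes is fixed by all its powers. So the cyclic group of any `γ` with a nonzero
fixpoint occurs among the subgroups which define `Ell`. -/
theorem invariants_zpowers_ne_bot {k E : Type*} [CommRing k] [AddCommGroup E] [Module k E]
    {ρ : Representation k G E} {γ : G} (hγ : ¬ FixesOnlyZero ρ γ) :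
    Representation.invariants (ρ.comp (Subgroup.zpowers γ).subtype) ≠ ⊥ := by
  intro h
  refine hγ fun e he => ?_
  have : e ∈ Representation.invariants (ρ.comp (Subgroup.zpowers γ).subtype) := by
    rintro ⟨_, n, rfl⟩
    change ρ (γ ^ n) e = e
    have hst : γ ∈ ({ carrier := {g | ρ g e = e}
                      one_mem' := by simp
                      mul_mem' := fun {a b} ha hb => by
                        rw [Set.mem_ofPred_eq, map_mul, Module.End.mul_apply, hb, ha]
                      inv_mem' := fun {a} ha => by
                        rw [Set.mem_ofPred_eq]
                        conv_lhs => rw [← (show ρ a e = e from ha)]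
                        rw [← Module.End.mul_apply, ← map_mul]; simp } : Subgroup G) := he
    exact Subgroup.zpow_mem _ hst n
  rw [h] at this
  exact this

end InducedClasses

/-! ### Relations in `Ell(G)` for a finite group `G` -/

section FiniteGroup

variable {G : Type} [Group G] [Finite G]

/-- The combination `∑_χ χ(γ)⁻¹ Ind χ` over the characters of the group generated by `γ`. -/
def classElem (γ : G) : GC G :=
  ∑ χ : Subgroup.zpowers γ →* ℂˣ, (χ (zgen γ) : ℂ)⁻¹ • indGC (Subgroup.zpowers γ) (clsChar χ)

theorem classElem_mem (γ : G) :
    classElem γ ∈ LinearMap.range (indGC (Subgroup.zpowers γ)) :=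
  Submodule.sum_mem _ fun _ _ => Submodule.smul_mem _ _ ⟨_, rfl⟩

-- Orthogonality of the characters of `⟨γ⟩` replaces each induced character by the indicator
-- function of `γ`, summed over conjugations.
open scoped Classical in
theorem charGC_classElem [Fintype G] (γ δ : G) :
    charGC G (classElem γ) δ = ∑ r : G, if r * δ * r⁻¹ = γ then 1 else 0 := by
  have h0 : (Nat.card (Subgroup.zpowers γ) : ℂ) ≠ 0 := by exact_mod_cast Nat.card_pos.ne'
  refine mul_left_cancel₀ h0 ?_
  have h : ∀ χ : Subgroup.zpowers γ →* ℂˣ, (Nat.card (Subgroup.zpowers γ) : ℂ) *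
      charGC G (indGC (Subgroup.zpowers γ) (clsChar χ)) δ = ∑ r : G, extChar χ (r * δ * r⁻¹) :=
    fun χ => card_mul_charGC_indGC (Subgroup.zpowers γ) (MonoidHom.id G)
      (fun g => ⟨1, g, by simp⟩) ⟨charRep χ, charRep_finite χ⟩
      (fun s => (character_charHom χ s).trans (extChar_coe χ s).symm)
      (fun _ hg => extChar_of_notMem χ hg) δ
  rw [classElem, map_sum, Finset.sum_apply, Finset.mul_sum]
  simp_rw [map_smul, Pi.smul_apply, smul_eq_mul, mul_left_comm _ (_⁻¹ : ℂ), h, Finset.mul_sum]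
  rw [Finset.sum_comm]
  refine Finset.sum_congr rfl fun r _ => ?_
  rw [sum_extChar, mul_ite, mul_one, mul_zero]

theorem sum_smul_classElem [Fintype G] (φ : G → ℂ) (hφ : ∀ g h, φ (h * g * h⁻¹) = φ g) :
    charGC G (∑ γ, φ γ • classElem γ) = (Nat.card G : ℂ) • φ := by
  classical
  funext δ
  rw [map_sum, Finset.sum_apply]
  simp_rw [map_smul, Pi.smul_apply, charGC_classElem, smul_eq_mul, Finset.mul_sum]
  rw [Finset.sum_comm]
  simp [hφ]

/-- A form of Artin's theorem with complex coefficients: every class is an explicit combination of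
classes induced from cyclic subgroups, the subgroup `⟨γ⟩` entering with the character value at `γ`.
-/
theorem card_smul_eq_sum_classElem [Fintype G] (x : GC G) :
    (Nat.card G : ℂ) • x = ∑ γ, charGC G x γ • classElem γ := by
  refine charGC_injective ?_
  rw [sum_smul_classElem _ (charGC_conj x), map_smul]

/-- One direction is the vanishing of induced characters at `γ`. For the other, only the `γ` with a
nonzero fixpoint survive in the cyclic expansion of `x`, and each of their terms is a relation. -/
theorem mem_ellRel {E : Type} [AddCommGroup E] [Module ℂ E] {ρ : Representation ℂ G E} {x : GC G} :
    x ∈ ellRel ρ ↔ ∀ γ, FixesOnlyZero ρ γ → charGC G x γ = 0 := by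
  constructor
  · intro hx γ hγ
    have : ellRel ρ ≤ LinearMap.ker (LinearMap.proj γ ∘ₗ charGC G) := by
      refine iSup₂_le fun H hH => ?_
      rintro _ ⟨y, rfl⟩
      exact charGC_indGC_eq_zero H (MonoidHom.id G) (fun g => ⟨1, g, by simp⟩)
        (hγ.conj_notMem hH) y
    exact this hx
  · intro hx
    have := Fintype.ofFinite G
    have h0 : (Nat.card G : ℂ) ≠ 0 := by exact_mod_cast Nat.card_pos.ne'
    rw [← Submodule.smul_mem_iff _ h0, card_smul_eq_sum_classElem]
    refine Submodule.sum_mem _ fun γ _ => ?_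
    by_cases h : FixesOnlyZero ρ γ
    · rw [hx γ h, zero_smul]
      exact zero_mem _
    · refine Submodule.smul_mem _ _ (Submodule.mem_iSup_of_mem (Subgroup.zpowers γ)
        (Submodule.mem_iSup_of_mem (invariants_zpowers_ne_bot h) (classElem_mem γ)))

end FiniteGroup

/-! ### Relations in `Ell(Γ ⋉ X)` -/

section LatticeClasses

variable {Γ X : Type} [Group Γ] [AddCommGroup X] [DistribMulAction Γ X]

open SemidirectProduct

theorem mem_crossedSub {H : Subgroup Γ} {w : Crossed Γ X} : w ∈ crossedSub X H ↔ w.right ∈ H :=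
  Iff.rfl

theorem crossed_decomp (H : Subgroup Γ) (g : Crossed Γ X) :
    ∃ (w : crossedSub X H) (r : Γ), g = (w : Crossed Γ X) * inr r :=
  ⟨⟨inl g.left, by simp [H.one_mem]⟩, g.right, (inl_left_mul_inr_right g).symm⟩

theorem card_comap_inr (H : Subgroup Γ) :
    Nat.card ((crossedSub X H).comap (inr : Γ →* Crossed Γ X)) = Nat.card H := rfl

/-- The character `x γ ↦ s(x) χ(γ)` of `H ⋉ X`, for `H ⊆ Γ_s`. -/
def twistChar {H : Subgroup Γ} {s : Torus X} (hH : H ≤ stab Γ s) (χ : H →* ℂˣ) :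
    crossedSub X H →* ℂˣ where
  toFun w := s w.1.left * χ ⟨w.1.right, w.2⟩
  map_one' := by
    have : (⟨(1 : crossedSub X H).1.right, (1 : crossedSub X H).2⟩ : H) = 1 := rfl
    rw [this]
    simp
  map_mul' w z := by
    have h : (⟨(w * z).1.right, (w * z).2⟩ : H)
        = ⟨w.1.right, w.2⟩ * ⟨z.1.right, z.2⟩ := rfl
    have h' : s (latticeAut Γ X w.1.right z.1.left) = s z.1.left :=
      stab_apply (⟨w.1.right, hH w.2⟩ : stab Γ s) z.1.left
    rw [h, map_mul]
    simp only [Subgroup.coe_mul, mul_left, map_mul, h']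
    rw [mul_mul_mul_comm]

theorem twistChar_apply {H : Subgroup Γ} {s : Torus X} (hH : H ≤ stab Γ s) (χ : H →* ℂˣ)
    (w : crossedSub X H) : twistChar hH χ w = s w.1.left * χ ⟨w.1.right, w.2⟩ := rfl

open scoped Classical in
/-- The value at `γ` of the class function on `Γ_t` of an element of `G_ℂ(Γ_t)`, extended
by zero. -/
def extValue (t : Torus X) (x : GC (stab Γ t)) (γ : Γ) : ℂ :=
  if h : γ ∈ stab Γ t then charGC _ x ⟨γ, h⟩ else 0

theorem extValue_coe (t : Torus X) (x : GC (stab Γ t)) (γ : stab Γ t) :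
    extValue t x γ = charGC _ x γ := dif_pos γ.2

theorem character_twist (t : Torus X) (V : Rep.{0} ℂ (stab Γ t)) (w : crossedSub X (stab Γ t)) :
    ((twistF Γ t).obj V).ρ.character w = t w.1.left * V.ρ.character ⟨w.1.right, mem_crossedSub.1 w.2⟩ := by
  have : ((twistF Γ t).obj V).ρ w = (t w.1.left : ℂ) • V.ρ ⟨w.1.right, mem_crossedSub.1 w.2⟩ := rfl
  rw [Representation.character, this]
  exact map_smul (LinearMap.trace ℂ V) _ _

variable [Finite Γ]

/-- The induced character formula with `R = Γ`, which represents the cosets of `H ⋉ X`; conjugation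
by `r` turns the weight `t` into its translate by `r⁻¹`. -/
theorem coefGC_indGC [Fintype Γ] (H : Subgroup Γ) (V : FinRep (crossedSub X H)) (t : Torus X)
    {φ : Γ → ℂ} (hφ : ∀ w : crossedSub X H, V.1.ρ.character w = t w.1.left * φ w.1.right)
    (hφ' : ∀ γ ∉ H, φ γ = 0) (δ : Γ) :
    (Nat.card H : ℂ) • coefGC δ (indGC (crossedSub X H) (cls V)) =
      ∑ r : Γ, Finsupp.single (moveT r⁻¹ t) (φ (r * δ * r⁻¹)) := by
  rw [← map_smul]
  refine coefGC_eq_of (funext fun y => ?_)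
  have h := card_mul_charGC_indGC (crossedSub X H) (inr : Γ →* Crossed Γ X) (crossed_decomp H) V
    (φ := fun g => t g.left * φ g.right) hφ (fun g hg => by rw [hφ' _ (mt mem_crossedSub.2 hg), mul_zero]) ⟨y, δ⟩
  rw [map_smul, Pi.smul_apply, cosetChar_apply, smul_eq_mul, ← card_comap_inr (X := X), h, map_sum,
    Finset.sum_apply]
  refine Finset.sum_congr rfl fun r _ => ?_
  simp [torusFun, moveT_apply, mul_comm]

theorem coefGC_indGC_eq_zero (H : Subgroup Γ) {δ : Γ} (h : ∀ r, r * δ * r⁻¹ ∉ H)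
    (x : GC (crossedSub X H)) : coefGC δ (indGC (crossedSub X H) x) = 0 := by
  refine coefGC_eq_of (funext fun y => ?_)
  rw [map_zero, cosetChar_apply, charGC_indGC_eq_zero (crossedSub X H) (inr : Γ →* Crossed Γ X)
    (crossed_decomp H)]
  · rfl
  · intro r
    simpa [mem_crossedSub] using h r

open scoped Classical in
/-- The combination `∑_χ χ(γ)⁻¹ Ind (s χ)` over the characters `χ` of the group generated
by `γ`, for `γ ∈ Γ_s`. -/
def latElem (γ : Γ) (s : Torus X) : GC (Crossed Γ X) :=
  if h : γ ∈ stab Γ s then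
    ∑ χ : Subgroup.zpowers γ →* ℂˣ, (χ (zgen γ) : ℂ)⁻¹ •
      indGC (crossedSub X (Subgroup.zpowers γ))
        (clsChar (twistChar ((Subgroup.zpowers_le).2 h) χ))
  else 0

theorem latElem_mem (γ : Γ) (s : Torus X) :
    latElem γ s ∈ LinearMap.range (indGC (crossedSub X (Subgroup.zpowers γ))) := by
  unfold latElem
  split_ifs
  · exact Submodule.sum_mem _ fun _ _ => Submodule.smul_mem _ _ ⟨_, rfl⟩
  · exact zero_mem _

-- As for finite groups, orthogonality on `⟨γ⟩` isolates `γ`. What is left is the sum over `Γ` of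
-- the translates of the point mass at `(γ,s)`.
open scoped Classical in
theorem coefGC_latElem [Fintype Γ] {γ : Γ} {s : Torus X} (h : γ ∈ stab Γ s) (δ : Γ) :
    coefGC δ (latElem γ s) = ∑ r : Γ, if r * δ * r⁻¹ = γ then
      Finsupp.single (moveT r⁻¹ s) 1 else 0 := by
  have h0 : (Nat.card (Subgroup.zpowers γ) : ℂ) ≠ 0 := by exact_mod_cast Nat.card_pos.ne'
  have hle := (Subgroup.zpowers_le).2 h
  have key : ∀ χ : Subgroup.zpowers γ →* ℂˣ, (Nat.card (Subgroup.zpowers γ) : ℂ) •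
      coefGC δ (indGC (crossedSub X (Subgroup.zpowers γ)) (clsChar (twistChar hle χ))) =
        ∑ r : Γ, Finsupp.single (moveT r⁻¹ s) (extChar χ (r * δ * r⁻¹)) :=
    fun χ => coefGC_indGC (Subgroup.zpowers γ) ⟨charRep _, charRep_finite _⟩ s
      (fun w => (character_charHom _ w).trans (by
        rw [twistChar_apply, Units.val_mul, ← extChar_coe χ]))
      (fun _ hg => extChar_of_notMem χ hg) δ
  refine smul_right_injective _ h0 ?_
  change _ • _ = _ • _
  rw [latElem, dif_pos h, map_sum, Finset.smul_sum, Finset.smul_sum]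
  simp_rw [map_smul, smul_comm (Nat.card (Subgroup.zpowers γ) : ℂ) (_⁻¹ : ℂ), key, Finset.smul_sum,
    Finsupp.smul_single, smul_eq_mul]
  rw [Finset.sum_comm]
  refine Finset.sum_congr rfl fun r _ => ?_
  rw [← Finsupp.single_finsetSum, sum_extChar]
  split_ifs
  · rw [Finsupp.smul_single, smul_eq_mul, mul_one]
  · simp

/-- It suffices to compare coefficients. The right hand side symmetrises the coefficients of `x`
over `Γ`, and these are already equivariant, so this multiplies them by `|Γ|`. -/
theorem card_smul_eq_sum_latElem [Fintype Γ] (x : GC (Crossed Γ X)) :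
    (Nat.card Γ : ℂ) • x = ∑ γ : Γ, (coefGC γ x).sum fun s c => c • latElem γ s := by
  classical
  refine coefGC_ext fun δ => ?_
  have h1 : ∀ γ : Γ, coefGC δ ((coefGC γ x).sum fun s c => c • latElem γ s) =
      ∑ r : Γ, if r * δ * r⁻¹ = γ then Finsupp.mapDomain (moveT r⁻¹) (coefGC γ x) else 0 := by
    intro γ
    have h2 : ∀ s ∈ (coefGC γ x).support, coefGC δ (coefGC γ x s • latElem γ s) = ∑ r : Γ,
        if r * δ * r⁻¹ = γ then Finsupp.single (moveT r⁻¹ s) (coefGC γ x s) else 0 := by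
      intro s hs
      rw [map_smul, coefGC_latElem (by_contra fun h =>
        Finsupp.mem_support_iff.1 hs (coefGC_eq_zero x h)), Finset.smul_sum]
      simp_rw [smul_ite, smul_zero, Finsupp.smul_single, smul_eq_mul, mul_one]
    rw [map_finsuppSum, Finsupp.sum, Finset.sum_congr rfl h2, Finset.sum_comm]
    refine Finset.sum_congr rfl fun r _ => ?_
    split_ifs
    · rfl
    · simp
  rw [map_sum]
  simp_rw [h1]
  rw [Finset.sum_comm]
  simp only [Finset.sum_ite_eq, Finset.mem_univ, if_true, mapDomain_coefGC]
  rw [map_smul, Nat.card_eq_fintype_card, Finset.sum_congr rfl (g := fun _ => coefGC δ x)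
    (fun r _ => by congr 1; group), Finset.sum_const, Finset.card_univ, Nat.cast_smul_eq_nsmul]

theorem mem_ellLatticeRel {x : GC (Crossed Γ X)} :
    x ∈ ellLatticeRel Γ X ↔ ∀ γ, FixesOnlyZero (realRep Γ X) γ → coefGC γ x = 0 := by
  constructor
  · intro hx γ hγ
    have : ellLatticeRel Γ X ≤ LinearMap.ker (coefGC γ) := by
      refine iSup₂_le fun H hH => ?_
      rintro _ ⟨y, rfl⟩
      exact coefGC_indGC_eq_zero H (hγ.conj_notMem hH) y
    exact this hx
  · intro hx
    have := Fintype.ofFinite Γ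
    have h0 : (Nat.card Γ : ℂ) ≠ 0 := by exact_mod_cast Nat.card_pos.ne'
    rw [← Submodule.smul_mem_iff _ h0, card_smul_eq_sum_latElem]
    refine Submodule.sum_mem _ fun γ _ => ?_
    by_cases h : FixesOnlyZero (realRep Γ X) γ
    · rw [hx γ h, Finsupp.sum_zero_index]
      exact zero_mem _
    · refine Submodule.sum_mem _ fun s _ => Submodule.smul_mem _ _
        (Submodule.mem_iSup_of_mem (Subgroup.zpowers γ)
          (Submodule.mem_iSup_of_mem (invariants_zpowers_ne_bot h) (latElem_mem γ s)))

theorem coefGC_indT [Fintype Γ] (t : Torus X) (x : GC (stab Γ t)) (δ : Γ) :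
    (Nat.card (stab Γ t) : ℂ) • coefGC δ (indT Γ t x) =
      ∑ r : Γ, Finsupp.single (moveT r⁻¹ t) (extValue t x (r * δ * r⁻¹)) := by
  classical
  -- `extValue` in a form that is linear in the class, so that only classes of representations need
  -- to be checked.
  let L : Γ → GC (stab Γ t) →ₗ[ℂ] ℂ := fun γ =>
    if h : γ ∈ stab Γ t then LinearMap.proj ⟨γ, h⟩ ∘ₗ charGC _ else 0
  have hL : ∀ γ y, L γ y = extValue t y γ := by
    intro γ y
    simp only [L, extValue]
    split_ifs <;> rfl
  have : (Nat.card (stab Γ t) : ℂ) • (coefGC δ ∘ₗ indT Γ t) =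
      ∑ r : Γ, Finsupp.lsingle (moveT r⁻¹ t) ∘ₗ L (r * δ * r⁻¹) := by
    refine GC_hom_ext fun V => ?_
    simp only [LinearMap.smul_apply, LinearMap.sum_apply, LinearMap.comp_apply, hL]
    rw [indT, LinearMap.comp_apply, mapGC_cls]
    refine coefGC_indGC (stab Γ t) ⟨_, twistF_finite t V.1 V.2⟩ t (fun w => ?_) (fun γ h => ?_) δ
    · rw [character_twist, extValue, dif_pos (mem_crossedSub.1 w.2), charGC_cls]
    · rw [extValue, dif_neg h]
  simpa only [LinearMap.smul_apply, LinearMap.sum_apply, LinearMap.comp_apply, hL, Finsupp.lsingle_apply]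
    using DFunLike.congr_fun this x

end LatticeClasses

/-! ### Elliptic conjugacy classes and the dimension of `Ell(Γ ⋉ X)` -/

section Elliptic

variable {Γ X : Type} [Group Γ] [AddCommGroup X] [DistribMulAction Γ X]

open SemidirectProduct

/-- The action of `γ` on `X`, as a linear map. -/
def latLin (γ : Γ) : X →ₗ[ℤ] X := AddMonoidHom.toIntLinearMap (DistribSMul.toAddMonoidHom X γ)

theorem latLin_apply (γ : Γ) (x : X) : latLin γ x = γ • x := rfl

theorem realRep_apply (γ : Γ) : realRep Γ X γ = (latLin γ).baseChange ℝ := rfl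

variable (X) in
/-- The integer `det (1 - ρ(γ))`. -/
def ellDet (γ : Γ) : ℤ := LinearMap.det (1 - latLin γ : X →ₗ[ℤ] X)

/-- The subgroup `(1 - ρ(γ)) X` of `X`. -/
def coboundary (γ : Γ) : Subgroup (Multiplicative X) :=
  MonoidHom.range (MonoidHom.id (Multiplicative X) / (latticeAut Γ X γ).toMonoidHom)

/-- Conjugation by `r ∈ Γ` moves the finite parts, and conjugation by `z ∈ X` then changes the
translation part exactly by `(1-γ)z`. -/
theorem isConj_iff_div_mem {γ δ : Γ} {x y : Multiplicative X} :
    IsConj (⟨x, γ⟩ : Crossed Γ X) ⟨y, δ⟩ ↔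
      ∃ r, r * δ * r⁻¹ = γ ∧ latticeAut Γ X r y / x ∈ coboundary γ := by
  have key : ∀ z r, (⟨z, r⟩ * ⟨y, δ⟩ * ⟨z, r⟩⁻¹ : Crossed Γ X) =
      ⟨z * latticeAut Γ X r y * (latticeAut Γ X (r * δ * r⁻¹) z)⁻¹, r * δ * r⁻¹⟩ := by
    intro z r
    ext <;> simp [mul_assoc]
  rw [isConj_comm, isConj_iff]
  constructor
  · rintro ⟨⟨z, r⟩, h⟩
    rw [key] at h
    obtain ⟨h1, h2⟩ := SemidirectProduct.ext_iff.1 h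
    simp only at h1 h2
    refine ⟨r, h2, z⁻¹, ?_⟩
    rw [← h1, h2]
    simp [div_eq_mul_inv, mul_comm, mul_left_comm]
  · rintro ⟨r, h, z, hz⟩
    refine ⟨⟨z⁻¹, r⟩, ?_⟩
    rw [key, h]
    refine SemidirectProduct.ext ?_ rfl
    simp only
    rw [eq_div_iff_mul_eq'] at hz
    rw [← hz, map_inv, inv_inv]
    simp [div_eq_mul_inv, mul_comm, mul_left_comm]

theorem charGC_eq_of_isConj {G : Type} [Group G] (x : GC G) {g h : G} (hgh : IsConj g h) :
    charGC G x g = charGC G x h := by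
  obtain ⟨c, rfl⟩ := isConj_iff.1 hgh
  rw [charGC_conj]

theorem charGC_latElem [Finite Γ] [Fintype Γ] [DecidableEq Γ] {γ : Γ} {s : Torus X} (h : γ ∈ stab Γ s)
    (y : Multiplicative X) (δ : Γ) : charGC _ (latElem γ s) ⟨y, δ⟩ =
      ∑ r : Γ, if r * δ * r⁻¹ = γ then (s (latticeAut Γ X r y) : ℂ) else 0 := by
  rw [← cosetChar_apply, ← linearCombination_coefGC, coefGC_latElem h, map_sum, Finset.sum_apply]
  refine Finset.sum_congr rfl fun r _ => ?_
  split_ifs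
  · simp [torusFun, moveT_apply]
  · simp

/-- Characters of `X/(1-γ)X` are fixed by `γ` as points of `T`, so `latElem γ` may be evaluated on
them. -/
theorem mem_stab_of_coboundary {γ : Γ} (φ : Multiplicative X ⧸ coboundary (X := X) γ →* ℂˣ) :
    γ ∈ stab Γ (φ.comp (QuotientGroup.mk' (coboundary γ))) := by
  refine MonoidHom.ext fun x => ?_
  refine congrArg φ (Eq.symm ?_)
  exact QuotientGroup.eq_iff_div_mem.2 ⟨x, rfl⟩

/-- An element whose character is supported on the conjugacy class of `x γ`. -/
def classBump (γ : Γ) [Finite Γ] [Finite (Multiplicative X ⧸ coboundary (X := X) γ)]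
    (x : Multiplicative X) : GC (Crossed Γ X) :=
  ∑ φ : Multiplicative X ⧸ coboundary (X := X) γ →* ℂˣ, (φ x : ℂ)⁻¹ •
    latElem γ (φ.comp (QuotientGroup.mk' (coboundary γ)))

-- Fourier inversion on `X/(1-γ)X` concentrates the character on the conjugates of `xγ`. The value
-- counts the `r ∈ Γ` which bring `yδ` into the `X`-conjugacy class of `xγ`.
open scoped Classical in
theorem charGC_classBump [Finite Γ] [Fintype Γ] (γ : Γ)
    [Finite (Multiplicative X ⧸ coboundary (X := X) γ)] (x y : Multiplicative X) (δ : Γ) :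
    charGC _ (classBump γ x) ⟨y, δ⟩ = Nat.card (Multiplicative X ⧸ coboundary (X := X) γ) *
      (Finset.univ.filter fun r : Γ => r * δ * r⁻¹ = γ ∧
        latticeAut Γ X r y / x ∈ coboundary γ).card := by
  rw [classBump, map_sum, Finset.sum_apply]
  simp_rw [map_smul, Pi.smul_apply, charGC_latElem (mem_stab_of_coboundary _), smul_eq_mul,
    Finset.mul_sum]
  rw [Finset.sum_comm, Finset.card_filter, Nat.cast_sum, Finset.mul_sum]
  refine Finset.sum_congr rfl fun r _ => ?_
  by_cases h : r * δ * r⁻¹ = γ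
  · simp only [h, if_true, true_and]
    have h1 : ∀ φ : Multiplicative X ⧸ coboundary (X := X) γ →* ℂˣ, (φ x : ℂ)⁻¹ *
        (φ.comp (QuotientGroup.mk' (coboundary γ)) (latticeAut Γ X r y) : ℂ) =
        (φ ((latticeAut Γ X r y / x : Multiplicative X) : Multiplicative X ⧸ coboundary (X := X) γ)) := by
      intro φ
      rw [QuotientGroup.mk_div, map_div, Units.val_div_eq_div_val, div_eq_inv_mul]
      rfl
    simp_rw [h1]
    split_ifs with h2
    · rw [(QuotientGroup.eq_one_iff _).2 h2]
      simp only [map_one, Units.val_one, Finset.sum_const, nsmul_eq_mul, mul_one, Finset.card_univ,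
        Nat.cast_one]
      rw [← Nat.card_eq_fintype_card, CommGroup.card_monoidHom_of_hasEnoughRootsOfUnity]
    · rw [sum_char_eq_zero (mt (QuotientGroup.eq_one_iff _).1 h2), Nat.cast_zero, mul_zero]
  · simp [h]

/-- A vector fixed by the linear part can be added, scaled arbitrarily small, to a fixpoint. If
there is none but zero, `1 - ρ(γ)` is bijective by finite dimensionality and there is exactly one
fixpoint, so all of `E` serves as neighbourhood. -/
theorem isElliptic_iff [Module.Finite ℤ X] (w : Crossed Γ X) : IsElliptic w ↔ FixesOnlyZero (realRep Γ X) w.right := by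
  constructor
  · rintro ⟨e, he, N, hN, heN, h⟩ v hv
    let _ : TopologicalSpace (RealSpace X) := moduleTopology ℝ (RealSpace X)
    have : IsModuleTopology ℝ (RealSpace X) := ⟨rfl⟩
    have := IsModuleTopology.toContinuousAdd ℝ (RealSpace X)
    have hc : Continuous fun c : ℝ => e + c • v := by fun_prop
    have hN' : (fun c : ℝ => e + c • v) ⁻¹' N ∈ nhds (0 : ℝ) :=
      hc.continuousAt.preimage_mem_nhds (by simpa using IsOpen.mem_nhds hN heN)
    have hne : ∃ c : ℝ, c ≠ 0 ∧ e + c • v ∈ N := by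
      have := (nhdsWithin_le_nhds (s := {0}ᶜ)) hN'
      obtain ⟨c, h1, h2⟩ := (Filter.inter_mem this self_mem_nhdsWithin |> Filter.nonempty_of_mem)
      exact ⟨c, h2, h1⟩
    obtain ⟨c, hc0, hcN⟩ := hne
    have := h _ hcN (by
      unfold affineAct at he ⊢
      rw [map_add, map_smul, hv, ← add_assoc, he])
    simpa [hc0] using this
  · intro h
    have hinj : Function.Injective (1 - realRep Γ X w.right : RealSpace X →ₗ[ℝ] RealSpace X) := by
      rw [← LinearMap.ker_eq_bot, LinearMap.ker_eq_bot']
      intro e he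
      rw [LinearMap.sub_apply, sub_eq_zero, Module.End.one_apply] at he
      exact h e he.symm
    have key : ∀ e, affineAct w e = e ↔ (1 - realRep Γ X w.right : RealSpace X →ₗ[ℝ] RealSpace X) e
        = (1 : ℝ) ⊗ₜ[ℤ] (Multiplicative.toAdd w.left) := by
      intro e
      rw [LinearMap.sub_apply, sub_eq_iff_eq_add, Module.End.one_apply, eq_comm]
      rfl
    obtain ⟨e, he⟩ := LinearMap.injective_iff_surjective.1 hinj
      ((1 : ℝ) ⊗ₜ[ℤ] (Multiplicative.toAdd w.left))
    refine ⟨e, (key e).2 he, Set.univ, @isOpen_univ _ (moduleTopology ℝ (RealSpace X)),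
      Set.mem_univ _, fun e' _ he' => hinj ?_⟩
    rw [(key e').1 he', he]

variable (Γ X) in
/-- The values of a character on the elliptic conjugacy classes. -/
def ellipticChar : GC (Crossed Γ X) →ₗ[ℂ] (ellipticClasses Γ X → ℂ) :=
  LinearMap.funLeft ℂ ℂ (fun c : ellipticClasses Γ X => Quotient.out c.1) ∘ₗ charGC (Crossed Γ X)

/-- The class of an elliptic element. -/
def ellipticClass (w : Crossed Γ X) (hw : IsElliptic w) : ellipticClasses Γ X :=
  ⟨ConjClasses.mk w, w, hw, rfl⟩

theorem exists_eq_ellipticClass (c : ellipticClasses Γ X) : ∃ w hw, c = ellipticClass w hw := by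
  obtain ⟨c, w, hw, hc⟩ := c
  exact ⟨w, hw, Subtype.ext hc.symm⟩

theorem ellipticClass_eq_iff {w z : Crossed Γ X} {hw : IsElliptic w} {hz : IsElliptic z} :
    ellipticClass w hw = ellipticClass z hz ↔ IsConj w z :=
  Subtype.ext_iff.trans ConjClasses.mk_eq_mk_iff_isConj

theorem ellipticChar_apply (x : GC (Crossed Γ X)) (w : Crossed Γ X) (hw : IsElliptic w) :
    ellipticChar Γ X x (ellipticClass w hw) = charGC _ x w :=
  charGC_eq_of_isConj x (ConjClasses.mk_eq_mk_iff_isConj.1 (Quotient.out_eq (ConjClasses.mk w)))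

variable [Module.Finite ℤ X]

theorem ker_ellipticChar [Finite Γ] : LinearMap.ker (ellipticChar Γ X) = ellLatticeRel Γ X := by
  ext x
  rw [LinearMap.mem_ker, mem_ellLatticeRel]
  constructor
  · intro h γ hγ
    refine coefGC_eq_of ?_
    rw [map_zero]
    funext y
    have hy := ellipticChar_apply x ⟨y, γ⟩ ((isElliptic_iff _).2 hγ)
    rw [h] at hy
    exact hy
  · intro h
    funext c
    obtain ⟨⟨y, γ⟩, hw, rfl⟩ := exists_eq_ellipticClass c
    rw [ellipticChar_apply, charGC_eq_sum, h _ ((isElliptic_iff _).1 hw), Finsupp.sum_zero_index]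
    rfl

variable [Module.Free ℤ X]

theorem fixesOnlyZero_iff {γ : Γ} : FixesOnlyZero (realRep Γ X) γ ↔ ellDet X γ ≠ 0 := by
  have h1 : (1 - realRep Γ X γ : RealSpace X →ₗ[ℝ] RealSpace X) = (1 - latLin γ : X →ₗ[ℤ] X).baseChange ℝ := by
    rw [LinearMap.baseChange_sub, realRep_apply]
    congr 1
    exact LinearMap.baseChange_id.symm
  have h2 : ((ellDet X γ : ℤ) : ℝ) = LinearMap.det (1 - realRep Γ X γ) := by
    rw [h1, LinearMap.det_baseChange]
    rfl
  have h3 : FixesOnlyZero (realRep Γ X) γ ↔ LinearMap.ker (1 - realRep Γ X γ) = ⊥ := by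
    rw [LinearMap.ker_eq_bot']
    refine forall_congr' fun e => ?_
    rw [LinearMap.sub_apply, sub_eq_zero, Module.End.one_apply, eq_comm]
  rw [h3, ← Int.cast_ne_zero (α := ℝ), h2, ← not_iff_not, not_not]
  constructor
  · intro h
    by_contra h0
    exact h (LinearEquiv.ker (LinearMap.equivOfDetNeZero _ h0))
  · intro h
    exact (LinearMap.bot_lt_ker_of_det_eq_zero h).ne'

/-- `1 - γ` is injective, hence its image is a sublattice of full rank. -/
theorem finite_quotient_coboundary {γ : Γ} (h : ellDet X γ ≠ 0) :
    Finite (Multiplicative X ⧸ coboundary (X := X) γ) := by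
  have hinj : Function.Injective (1 - latLin γ : X →ₗ[ℤ] X) :=
    LinearMap.ker_eq_bot.1 (by_contra fun h0 => h (LinearMap.det_eq_zero_iff_ker_ne_bot.2 h0))
  have := Submodule.finiteQuotientOfFreeOfRankEq (LinearMap.range (1 - latLin γ : X →ₗ[ℤ] X))
    (LinearMap.finrank_range_of_inj hinj)
  exact this

theorem ellipticClasses_finite [Finite Γ] : (ellipticClasses Γ X).Finite := by
  have key : ∀ γ : Γ, ellDet X γ ≠ 0 →
      (Set.range fun y : Multiplicative X => ConjClasses.mk (⟨y, γ⟩ : Crossed Γ X)).Finite := by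
    intro γ hγ
    have := finite_quotient_coboundary hγ
    refine (Set.finite_range fun q : Multiplicative X ⧸ coboundary (X := X) γ =>
      ConjClasses.mk (⟨q.out, γ⟩ : Crossed Γ X)).subset ?_
    rintro _ ⟨y, rfl⟩
    refine ⟨(y : Multiplicative X ⧸ coboundary (X := X) γ),
      ConjClasses.mk_eq_mk_iff_isConj.2 (isConj_iff_div_mem.2 ⟨1, by simp, ?_⟩)⟩
    rw [map_one, MulAut.one_apply]
    exact QuotientGroup.eq_iff_div_mem.1 (QuotientGroup.out_eq' _).symm
  refine (Set.Finite.biUnion (Set.toFinite {γ : Γ | ellDet X γ ≠ 0}) key).subset ?_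
  rintro _ ⟨⟨y, γ⟩, hw, rfl⟩
  exact Set.mem_biUnion (fixesOnlyZero_iff.1 ((isElliptic_iff _).1 hw)) ⟨y, rfl⟩

theorem ellipticChar_surjective [Finite Γ] : Function.Surjective (ellipticChar Γ X) := by
  classical
  have := Fintype.ofFinite Γ
  have := (ellipticClasses_finite (Γ := Γ) (X := X)).fintype
  rw [← LinearMap.range_eq_top, ← top_le_iff, ← (Pi.basisFun ℂ (ellipticClasses Γ X)).span_eq,
    Submodule.span_le]
  rintro _ ⟨c, rfl⟩
  obtain ⟨⟨x, γ⟩, hw, rfl⟩ := exists_eq_ellipticClass c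
  have := finite_quotient_coboundary (fixesOnlyZero_iff.1 ((isElliptic_iff _).1 hw))
  have hM := charGC_classBump γ x x γ
  set M := charGC (Crossed Γ X) (classBump γ x) ⟨x, γ⟩
  have hM0 : M ≠ 0 := by
    rw [hM]
    refine mul_ne_zero (Nat.cast_ne_zero.2 Nat.card_pos.ne') (Nat.cast_ne_zero.2 ?_)
    -- The count at `xγ` itself is positive, because the identity of `Γ` contributes.
    refine (Finset.card_pos.2 ⟨1, ?_⟩).ne'
    simp
  refine ⟨M⁻¹ • classBump γ x, ?_⟩
  funext c'
  obtain ⟨⟨y, δ⟩, hw', rfl⟩ := exists_eq_ellipticClass c'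
  rw [map_smul, Pi.smul_apply, ellipticChar_apply, Pi.basisFun_apply, smul_eq_mul]
  by_cases h : IsConj (⟨x, γ⟩ : Crossed Γ X) ⟨y, δ⟩
  · rw [← charGC_eq_of_isConj _ h, inv_mul_cancel₀ hM0, ellipticClass_eq_iff (hz := hw').2 h, Pi.single_eq_same]
  · rw [Pi.single_eq_of_ne fun h' => h (ellipticClass_eq_iff.1 h'.symm), charGC_classBump,
      Finset.filter_false_of_mem]
    · simp
    · exact fun r _ hr => h (isConj_iff_div_mem.2 ⟨r, hr⟩)

theorem ellLattice_dimension [Finite Γ] :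
    Module.Finite ℂ (EllLattice Γ X) ∧ (ellipticClasses Γ X).Finite ∧
      Module.finrank ℂ (EllLattice Γ X) = (ellipticClasses Γ X).ncard := by
  have hfin := ellipticClasses_finite (Γ := Γ) (X := X)
  have := hfin.fintype
  let e : EllLattice Γ X ≃ₗ[ℂ] (ellipticClasses Γ X → ℂ) :=
    Submodule.quotEquivOfEq _ _ ker_ellipticChar.symm ≪≫ₗ
      (ellipticChar Γ X).quotKerEquivOfSurjective ellipticChar_surjective
  refine ⟨Module.Finite.equiv e.symm, hfin, ?_⟩
  rw [e.finrank_eq, Module.finrank_fintype_fun_eq_card, ← Nat.card_eq_fintype_card]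
  rfl

end Elliptic

/-! ### The cotangent spaces of `T` -/

section Cotangent

variable {Γ X : Type} [Group Γ] [AddCommGroup X] [DistribMulAction Γ X]

theorem evalAt_single (t : Torus X) (x : Multiplicative X) (c : ℂ) :
    evalAt t (MonoidAlgebra.single x c) = c * t x := by
  simp [evalAt, MonoidAlgebra.lift_single]

/-- The element `t(x)⁻¹ x - 1` of `I_t`. -/
def cotElem (t : Torus X) (x : X) : vanishingIdeal t :=
  ⟨MonoidAlgebra.single (Multiplicative.ofAdd x) ((t (Multiplicative.ofAdd x) : ℂ)⁻¹) - 1, by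
    rw [RingHom.mem_ker, map_sub, map_one, evalAt_single, inv_mul_cancel₀ (Units.ne_zero _),
      sub_self]⟩

/-- With `u` and `v` the normalised group elements, `(uv-1) - (u-1) - (v-1) = (u-1)(v-1)` lies in
`I_t²`. -/
theorem cotElem_add (t : Torus X) (x y : X) :
    (vanishingIdeal t).toCotangent (cotElem t (x + y)) =
      (vanishingIdeal t).toCotangent (cotElem t x) + (vanishingIdeal t).toCotangent (cotElem t y) := by
  rw [← map_add, Ideal.toCotangent_eq, pow_two]
  have : ((cotElem t (x + y) : MonoidAlgebra ℂ (Multiplicative X)) -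
      ((cotElem t x + cotElem t y : vanishingIdeal t) : MonoidAlgebra ℂ (Multiplicative X))) =
      (cotElem t x : MonoidAlgebra ℂ (Multiplicative X)) * cotElem t y := by
    simp only [cotElem, Submodule.coe_add, sub_mul, mul_sub, MonoidAlgebra.single_mul_single, ofAdd_add, map_mul, Units.val_mul, mul_inv, mul_one, one_mul]
    abel
  rw [this]
  exact Ideal.mul_mem_mul (cotElem t x).2 (cotElem t y).2

/-- The identification of `ℂ ⊗ X` with the cotangent space `I_t / I_t²`. -/
def cotMap (t : Torus X) : ℂ ⊗[ℤ] X →ₗ[ℂ] (vanishingIdeal t).Cotangent :=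
  LinearMap.liftBaseChange ℂ (AddMonoidHom.toIntLinearMap
    (AddMonoidHom.mk' (fun x => (vanishingIdeal t).toCotangent (cotElem t x)) (cotElem_add t)))

theorem cotMap_tmul (t : Torus X) (c : ℂ) (x : X) :
    cotMap t (c ⊗ₜ x) = c • (vanishingIdeal t).toCotangent (cotElem t x) := by
  simp [cotMap]

/-- The derivation `x ↦ t(x) ⊗ x` at `t`. -/
def cotDer (t : Torus X) : MonoidAlgebra ℂ (Multiplicative X) →ₗ[ℂ] ℂ ⊗[ℤ] X :=
  Finsupp.lsum ℂ (fun x : Multiplicative X =>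
    LinearMap.toSpanSingleton ℂ (ℂ ⊗[ℤ] X) ((t x : ℂ) ⊗ₜ (Multiplicative.toAdd x))) ∘ₗ
    (MonoidAlgebra.coeffLinearEquiv ℂ).toLinearMap

theorem cotDer_single (t : Torus X) (x : Multiplicative X) (c : ℂ) :
    cotDer t (MonoidAlgebra.single x c) = (c * t x) ⊗ₜ (Multiplicative.toAdd x) := by
  simp [cotDer, TensorProduct.smul_tmul']

theorem cotDer_mul (t : Torus X) (f g : MonoidAlgebra ℂ (Multiplicative X)) :
    cotDer t (f * g) = evalAt t f • cotDer t g + evalAt t g • cotDer t f := by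
  induction f using MonoidAlgebra.induction_linear with
  | zero => simp
  | add f f' h h' => rw [add_mul, map_add, h, h', map_add, map_add, add_smul, smul_add]; abel
  | single x c =>
    induction g using MonoidAlgebra.induction_linear with
    | zero => simp
    | add f f' h h' => rw [mul_add, map_add, h, h', map_add, map_add, add_smul, smul_add]; abel
    | single y d =>
      rw [MonoidAlgebra.single_mul_single]
      simp only [cotDer_single, evalAt_single, TensorProduct.smul_tmul', smul_eq_mul, map_mul,
        Units.val_mul, toAdd_mul, TensorProduct.tmul_add]
      rw [add_comm]
      congr 2 <;> ring

/-- `cotDer` is a derivation at `t`, so it kills `I_t²`, and it recovers `z` from a suitable lift of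
`cotMap t z` to `I_t`: this gives injectivity. For surjectivity, `f - f(t)` has class `cotMap t
(cotDer t f)`, as can be tested on monomials. -/
theorem cotMap_bijective (t : Torus X) : Function.Bijective (cotMap t) := by
  constructor
  · have key : ∀ z, ∃ a : vanishingIdeal t, (vanishingIdeal t).toCotangent a = cotMap t z ∧
        cotDer t a = z := by
      intro z
      induction z with
      | zero => exact ⟨0, by simp⟩
      | add z w hz hw =>
        obtain ⟨a, ha, ha'⟩ := hz
        obtain ⟨b, hb, hb'⟩ := hw
        refine ⟨a + b, by rw [map_add, ha, hb, map_add], ?_⟩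
        rw [Submodule.coe_add, map_add, ha', hb']
      | tmul c x =>
        refine ⟨c • cotElem t x, ?_, ?_⟩
        · rw [cotMap_tmul]
          rfl
        · change cotDer t (c • (cotElem t x).1) = _
          rw [map_smul, cotElem, map_sub, cotDer_single, MonoidAlgebra.one_def, cotDer_single]
          simp [TensorProduct.smul_tmul']
    rw [injective_iff_map_eq_zero]
    intro z hz
    obtain ⟨a, ha, rfl⟩ := key z
    rw [hz, Ideal.toCotangent_eq_zero, pow_two] at ha
    refine Submodule.mul_induction_on ha (fun f hf g hg => ?_) fun f g hf hg => ?_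
    · rw [cotDer_mul, RingHom.mem_ker.1 hf, RingHom.mem_ker.1 hg, zero_smul, zero_smul, add_zero]
    · rw [map_add, hf, hg, add_zero]
  · have key : ∀ f : MonoidAlgebra ℂ (Multiplicative X), ∃ a : vanishingIdeal t,
        (a : MonoidAlgebra ℂ (Multiplicative X)) = f - algebraMap ℂ _ (evalAt t f) ∧
        (vanishingIdeal t).toCotangent a = cotMap t (cotDer t f) := by
      intro f
      induction f using MonoidAlgebra.induction_linear with
      | zero => exact ⟨0, by simp⟩
      | add f g hf hg =>
        obtain ⟨a, ha, ha'⟩ := hf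
        obtain ⟨b, hb, hb'⟩ := hg
        refine ⟨a + b, ?_, by rw [map_add, ha', hb', map_add, map_add]⟩
        rw [Submodule.coe_add, ha, hb, map_add, map_add]
        abel
      | single x c =>
        refine ⟨(c * t x) • cotElem t (Multiplicative.toAdd x), ?_, ?_⟩
        · change (c * t x : ℂ) • (cotElem t (Multiplicative.toAdd x)).1 = _
          rw [cotElem, evalAt_single, smul_sub, Algebra.algebraMap_eq_smul_one]
          simp
        · rw [cotDer_single, cotMap_tmul]
          rfl
    intro y
    obtain ⟨f, rfl⟩ := Ideal.toCotangent_surjective _ y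
    obtain ⟨a, ha, ha'⟩ := key f
    rw [RingHom.mem_ker.1 f.2, map_zero, sub_zero] at ha
    rw [← Subtype.ext ha, ha']
    exact ⟨_, rfl⟩

theorem cotangentRep_toCotangent (t : Torus X) (γ : stab Γ t) (f : vanishingIdeal t) :
    cotangentRep Γ t γ ((vanishingIdeal t).toCotangent f) =
      (vanishingIdeal t).toCotangent ⟨actAlg (γ : Γ) f, vanishingIdeal_le γ f.2⟩ :=
  Ideal.mapCotangent_toCotangent _ _ _ (vanishingIdeal_le γ) f

-- The normalising factor `t(x)⁻¹` is not affected by `γ`, precisely because `γ` stabilises `t`.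
variable (Γ) in
theorem cotMap_equivariant (t : Torus X) (γ : stab Γ t) (z : ℂ ⊗[ℤ] X) :
    cotMap t ((latLin (γ : Γ)).baseChange ℂ z) = cotangentRep Γ t γ (cotMap t z) := by
  induction z with
  | zero => rw [LinearMap.map_zero, LinearMap.map_zero, LinearMap.map_zero]
  | add z w hz hw =>
    rw [LinearMap.map_add, LinearMap.map_add (cotMap t), hz, hw, LinearMap.map_add (cotMap t),
      LinearMap.map_add]
  | tmul c x =>
    rw [LinearMap.baseChange_tmul, cotMap_tmul, cotMap_tmul]
    refine Eq.trans ?_ ((cotangentRep Γ t γ).map_smul c _).symm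
    refine congrArg (c • ·) ?_
    rw [cotangentRep_toCotangent]
    refine congrArg _ (Subtype.ext ?_)
    have h := stab_apply γ (Multiplicative.ofAdd x)
    have h' : latticeAut Γ X (γ : Γ) (Multiplicative.ofAdd x) =
      Multiplicative.ofAdd (latLin (γ : Γ) x) := rfl
    change (cotElem t (latLin (γ : Γ) x)).1 = actAlg (γ : Γ) (cotElem t x).1
    simp only [cotElem]
    rw [← h', h, map_sub, map_one]
    simp [actAlg]

/-- `I_t / I_t²` is identified with `ℂ ⊗ X`. -/
def cotEquiv (t : Torus X) : ℂ ⊗[ℤ] X ≃ₗ[ℂ] (vanishingIdeal t).Cotangent :=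
  LinearEquiv.ofBijective (cotMap t) (cotMap_bijective t)

theorem cotangentRep_eq (t : Torus X) (γ : stab Γ t) :
    cotangentRep Γ t γ = (cotEquiv t).conj ((latLin (γ : Γ)).baseChange ℂ) := by
  refine LinearMap.ext fun y => ?_
  obtain ⟨z, rfl⟩ := (cotEquiv t).surjective y
  rw [LinearEquiv.conj_apply_apply, LinearEquiv.symm_apply_apply]
  exact (cotMap_equivariant Γ t γ z).symm

variable [Module.Free ℤ X] [Module.Finite ℤ X]

/-- The determinant is an integer and commutes with base change. So absence of fixpoints means the
same in `X ⊗ ℝ`, used for `Γ ⋉ X`, and in `X ⊗ ℂ`, used for `Γ_t`. -/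
theorem baseChange_eq_imp_iff {k : Type*} [Field k] [CharZero k] {γ : Γ} :
    (∀ e : k ⊗[ℤ] X, (latLin γ).baseChange k e = e → e = 0) ↔ ellDet X γ ≠ 0 := by
  have h1 : (1 - (latLin γ).baseChange k : k ⊗[ℤ] X →ₗ[k] k ⊗[ℤ] X) =
      (1 - latLin γ : X →ₗ[ℤ] X).baseChange k := by
    rw [LinearMap.baseChange_sub]
    congr 1
    exact LinearMap.baseChange_id.symm
  have h2 : ((ellDet X γ : ℤ) : k) = LinearMap.det (1 - (latLin γ : X →ₗ[ℤ] X).baseChange k) := by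
    rw [h1, LinearMap.det_baseChange]
    rfl
  rw [← Int.cast_ne_zero (α := k), h2, Ne, LinearMap.det_eq_zero_iff_ker_ne_bot, not_not,
    LinearMap.ker_eq_bot']
  refine forall_congr' fun e => ?_
  rw [LinearMap.sub_apply, sub_eq_zero, Module.End.one_apply, eq_comm]

theorem fixesOnlyZero_cotangentRep {t : Torus X} {γ : stab Γ t} :
    FixesOnlyZero (cotangentRep Γ t) γ ↔ ellDet X (γ : Γ) ≠ 0 := by
  rw [← baseChange_eq_imp_iff (k := ℂ)]
  refine ⟨fun h e he => (cotEquiv t).map_eq_zero_iff.1 (h _ ?_), fun h y hy => ?_⟩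
  · rw [cotangentRep_eq, LinearEquiv.conj_apply_apply, LinearEquiv.symm_apply_apply, he]
  · obtain ⟨z, rfl⟩ := (cotEquiv t).surjective y
    rw [cotangentRep_eq, LinearEquiv.conj_apply_apply, LinearEquiv.symm_apply_apply] at hy
    rw [h z ((cotEquiv t).injective hy), map_zero]

end Cotangent

/-! ### The Hermitian form on `Ell(Γ ⋉ X)` -/

section Form

variable {Γ X : Type} [Group Γ] [AddCommGroup X] [DistribMulAction Γ X]

theorem latLin_pow (γ : Γ) (n : ℕ) : (latLin γ : X →ₗ[ℤ] X) ^ n = latLin (γ ^ n) := by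
  induction n with
  | zero => ext x; simp [latLin_apply]
  | succ n ih =>
    rw [pow_succ, ih]
    ext x
    simp [latLin_apply, pow_succ, mul_smul]

/-- The function `c ↦ det(1 - cγ)` is `1` at `c = 0` and has no zero in `(0,1)`: a zero would give a
vector fixed by `cγ`, hence multiplied by `cⁿ < 1` and yet fixed when `γⁿ = 1`. By the intermediate
value theorem it cannot be negative at `c = 1`. -/
theorem ellDet_nonneg [Finite Γ] [Module.Free ℤ X] [Module.Finite ℤ X] (γ : Γ) :
    0 ≤ ellDet X γ := by
  let T : RealSpace X →ₗ[ℝ] RealSpace X := (latLin γ).baseChange ℝ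
  let b := Module.Free.chooseBasis ℝ (RealSpace X)
  let f : ℝ → ℝ := fun c => LinearMap.det (1 - c • T)
  have hf : ∀ c, f c = (1 - c • LinearMap.toMatrix b b T).det := by
    intro c
    rw [← LinearMap.toMatrix_one b, ← map_smul, ← map_sub, LinearMap.det_toMatrix]
  have hc : Continuous f := by
    rw [funext hf]
    exact Continuous.matrix_det (by fun_prop)
  have h0 : f 0 = 1 := by simp [f]
  have h1 : f 1 = ellDet X γ := by
    have : (1 - T) = (1 - latLin γ : X →ₗ[ℤ] X).baseChange ℝ := by
      rw [LinearMap.baseChange_sub]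
      congr 1
      exact LinearMap.baseChange_id.symm
    simp only [f, one_smul]
    rw [this, LinearMap.det_baseChange]
    rfl
  obtain ⟨n, hn, hγ⟩ := isOfFinOrder_iff_pow_eq_one.1 (isOfFinOrder_of_finite γ)
  have hT : T ^ n = 1 := by
    rw [← LinearMap.baseChange_pow, latLin_pow, hγ]
    ext x
    simp [latLin_apply]
  have hne : ∀ c ∈ Set.Ioo (0 : ℝ) 1, f c ≠ 0 := by
    rintro c ⟨hc0, hc1⟩ h
    obtain ⟨v, hv, hv0⟩ := Submodule.exists_mem_ne_zero_of_ne_bot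
      (LinearMap.det_eq_zero_iff_ker_ne_bot.1 h)
    rw [LinearMap.mem_ker, LinearMap.sub_apply, sub_eq_zero] at hv
    have hpow : ∀ m : ℕ, ((c • T) ^ m) v = v := by
      intro m
      induction m with
      | zero => simp
      | succ m ih => rw [pow_succ, Module.End.mul_apply, ← hv, Module.End.one_apply, ih]
    have h2 := hpow n
    rw [smul_pow, hT, LinearMap.smul_apply, Module.End.one_apply] at h2
    have h3 : (c ^ n - 1) • v = 0 := by rw [sub_smul, h2, one_smul, sub_self]
    have h4 := (smul_eq_zero.1 h3).resolve_right hv0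
    have := pow_lt_one₀ hc0.le hc1 hn.ne'
    linarith
  by_contra hneg
  have hneg' : f 1 < 0 := by
    rw [h1]
    exact_mod_cast not_le.1 hneg
  obtain ⟨c, hcm, hc'⟩ := intermediate_value_Ioo' (zero_le_one) hc.continuousOn
    (show (0 : ℝ) ∈ Set.Ioo (f 1) (f 0) from ⟨hneg', by rw [h0]; norm_num⟩)
  exact hne c hcm hc'

variable (Γ X) in
open scoped Classical in
/-- The coefficients at `γ`, on `Ell(Γ ⋉ X)`, for `γ` without nonzero fixpoints (and zero
otherwise). -/
def ellCoef [Finite Γ] (γ : Γ) : EllLattice Γ X →ₗ[ℂ] (Torus X →₀ ℂ) :=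
  if h : FixesOnlyZero (realRep Γ X) γ then
    (ellLatticeRel Γ X).liftQ (coefGC γ) fun _ hx => mem_ellLatticeRel.1 hx γ h
  else 0

theorem ellCoef_mk [Finite Γ] {γ : Γ} (h : FixesOnlyZero (realRep Γ X) γ) (x : GC (Crossed Γ X)) :
    ellCoef Γ X γ ((ellLatticeRel Γ X).mkQ x) = coefGC γ x := by
  rw [ellCoef, dif_pos h]
  rfl

/-- The pairing `∑ conj(a_s) b_s` of finitely supported functions. -/
def suppPairing {S : Type*} : (S →₀ ℂ) →ₗ⋆[ℂ] (S →₀ ℂ) →ₗ[ℂ] ℂ :=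
  LinearMap.mk₂'ₛₗ (starRingEnd ℂ) (RingHom.id ℂ)
    (fun a b => b.sum fun s c => starRingEnd ℂ (a s) * c)
    (fun a a' b => by simp [Finsupp.sum, add_mul, Finset.sum_add_distrib])
    (fun c a b => by simp [Finsupp.sum, Finset.mul_sum, mul_assoc])
    (fun a b b' => Finsupp.sum_add_index' (by simp) (by simp [mul_add]))
    (fun c a b => by
      rw [Finsupp.sum_smul_index (by simp)]
      simp [Finsupp.sum, Finset.mul_sum, mul_left_comm])

theorem suppPairing_apply {S : Type*} (a b : S →₀ ℂ) :
    suppPairing a b = b.sum fun s c => starRingEnd ℂ (a s) * c := rfl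

theorem suppPairing_single {S : Type*} (a : S →₀ ℂ) (s : S) (c : ℂ) :
    suppPairing a (Finsupp.single s c) = starRingEnd ℂ (a s) * c := by
  rw [suppPairing_apply, Finsupp.sum_single_index (by simp)]

theorem star_suppPairing {S : Type*} (a b : S →₀ ℂ) :
    starRingEnd ℂ (suppPairing a b) = suppPairing b a := by
  classical
  rw [suppPairing_apply, suppPairing_apply,
    Finsupp.sum_of_support_subset b (Finset.subset_union_right (s₁ := a.support)) _ (by simp),
    Finsupp.sum_of_support_subset a (Finset.subset_union_left (s₂ := b.support)) _ (by simp),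
    map_sum]
  refine Finset.sum_congr rfl fun s _ => ?_
  rw [map_mul, Complex.conj_conj, mul_comm]

theorem suppPairing_self {S : Type*} (a : S →₀ ℂ) :
    suppPairing a a = ((∑ s ∈ a.support, ‖a s‖ ^ 2 : ℝ) : ℂ) := by
  rw [suppPairing_apply, Finsupp.sum, Complex.ofReal_sum]
  refine Finset.sum_congr rfl fun s _ => ?_
  rw [Complex.conj_mul', Complex.ofReal_pow]

theorem suppPairing_self_pos {S : Type*} {a : S →₀ ℂ} (ha : a ≠ 0) :
    0 < ∑ s ∈ a.support, ‖a s‖ ^ 2 :=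
  Finset.sum_pos (fun _ hs => pow_pos (norm_pos_iff.2 (Finsupp.mem_support_iff.1 hs)) 2)
    (Finsupp.support_nonempty_iff.2 ha)

variable (Γ X) in
/-- The Hermitian form `(1/|Γ|) ∑_γ det(1-γ⁻¹) ∑_s conj(a_{γ,s}(x)) a_{γ,s}(y)`. -/
def ellForm [Finite Γ] [Fintype Γ] : EllLattice Γ X →ₗ⋆[ℂ] EllLattice Γ X →ₗ[ℂ] ℂ :=
  ((Nat.card Γ : ℂ)⁻¹) • ∑ γ : Γ, (ellDet X γ⁻¹ : ℂ) •
    (suppPairing.comp (ellCoef Γ X γ)).compl₂ (ellCoef Γ X γ)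

theorem ellForm_apply [Finite Γ] [Fintype Γ] (x y : EllLattice Γ X) :
    ellForm Γ X x y = (Nat.card Γ : ℂ)⁻¹ * ∑ γ : Γ, (ellDet X γ⁻¹ : ℂ) *
      suppPairing (ellCoef Γ X γ x) (ellCoef Γ X γ y) := by
  simp [ellForm, LinearMap.sum_apply]

theorem fixesOnlyZero_inv {k E : Type*} [CommRing k] [AddCommGroup E] [Module k E]
    {ρ : Representation k Γ E} {γ : Γ} : FixesOnlyZero ρ γ⁻¹ ↔ FixesOnlyZero ρ γ := by
  refine forall_congr' fun e => imp_congr_left ⟨fun h => ?_, fun h => ?_⟩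
  · conv_lhs => rw [← h]
    simp
  · conv_lhs => rw [← h]
    simp

variable [Finite Γ] [Fintype Γ]

theorem star_ellForm (x y : EllLattice Γ X) :
    starRingEnd ℂ (ellForm Γ X x y) = ellForm Γ X y x := by
  simp [ellForm_apply, star_suppPairing]

variable [Module.Free ℤ X] [Module.Finite ℤ X]

/-- The coefficients at `γ` with nonzero fixpoints do not descend to `Ell`, but their weight
`det(1-γ⁻¹)` vanishes, so the sum may run over all `γ`. -/
theorem ellForm_mk (x y : GC (Crossed Γ X)) :
    ellForm Γ X ((ellLatticeRel Γ X).mkQ x) ((ellLatticeRel Γ X).mkQ y) =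
      (Nat.card Γ : ℂ)⁻¹ * ∑ γ : Γ, (ellDet X γ⁻¹ : ℂ) * suppPairing (coefGC γ x) (coefGC γ y) := by
  rw [ellForm_apply]
  congr 1
  refine Finset.sum_congr rfl fun γ _ => ?_
  by_cases h : FixesOnlyZero (realRep Γ X) γ
  · rw [ellCoef_mk h, ellCoef_mk h]
  · have : ellDet X γ⁻¹ = 0 := by
      rwa [← fixesOnlyZero_inv, fixesOnlyZero_iff, not_not] at h
    simp [this]

/-- All terms are nonnegative. A nonzero element of `Ell` has a nonzero coefficient at some `γ`
without fixpoints, and there the determinant is strictly positive. -/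
theorem ellForm_self_pos {x : EllLattice Γ X} (hx : x ≠ 0) : 0 < (ellForm Γ X x x).re := by
  have h : ellForm Γ X x x = (((Nat.card Γ : ℝ)⁻¹ * ∑ γ : Γ, (ellDet X γ⁻¹ : ℝ) *
      ∑ s ∈ (ellCoef Γ X γ x).support, ‖ellCoef Γ X γ x s‖ ^ 2 : ℝ) : ℂ) := by
    rw [ellForm_apply]
    push_cast
    congr 1
    refine Finset.sum_congr rfl fun γ _ => ?_
    rw [suppPairing_self]
    push_cast
    rfl
  rw [h, Complex.ofReal_re]
  obtain ⟨x, rfl⟩ := (ellLatticeRel Γ X).mkQ_surjective x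
  have hex : ∃ γ, FixesOnlyZero (realRep Γ X) γ ∧ coefGC γ x ≠ 0 := by
    by_contra! hno
    exact hx ((Submodule.Quotient.mk_eq_zero _).2 (mem_ellLatticeRel.2 hno))
  obtain ⟨γ, hγ, hne⟩ := hex
  refine mul_pos (inv_pos.2 (Nat.cast_pos.2 Nat.card_pos)) (Finset.sum_pos' (fun δ _ => ?_)
    ⟨γ, Finset.mem_univ _, ?_⟩)
  · exact mul_nonneg (Int.cast_nonneg (ellDet_nonneg _))
      (Finset.sum_nonneg fun _ _ => sq_nonneg _)
  · refine mul_pos (Int.cast_pos.2 (lt_of_le_of_ne (ellDet_nonneg _)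
      (fixesOnlyZero_iff.1 (fixesOnlyZero_inv.2 hγ)).symm)) ?_
    rw [ellCoef_mk hγ]
    exact suppPairing_self_pos hne

end Form

/-! ### The maps `Ind_t` and the decomposition over `T/Γ` -/

section InductionFromStabilizers

variable {Γ X : Type} [Group Γ] [AddCommGroup X] [DistribMulAction Γ X]

theorem extValue_conj (t : Torus X) (x : GC (stab Γ t)) {r : Γ} (hr : r ∈ stab Γ t) (γ : Γ) :
    extValue t x (r * γ * r⁻¹) = extValue t x γ := by
  have hiff : r * γ * r⁻¹ ∈ stab Γ t ↔ γ ∈ stab Γ t := by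
    rw [Subgroup.mul_mem_cancel_right _ (inv_mem hr), Subgroup.mul_mem_cancel_left _ hr]
  by_cases h : γ ∈ stab Γ t
  · exact (extValue_coe t x ⟨_, hiff.2 h⟩).trans
      ((charGC_conj x ⟨γ, h⟩ ⟨r, hr⟩).trans (extValue_coe t x ⟨γ, h⟩).symm)
  · rw [extValue, extValue, dif_neg h, dif_neg (mt hiff.1 h)]

theorem isOrbitTransversal_moveT {R : Set (Torus X)} (hR : IsOrbitTransversal Γ R) (t : Torus X) :
    ∃ r ∈ R, (∃ γ : Γ, moveT γ r = t) ∧ ∀ r' ∈ R, (∃ γ : Γ, moveT γ r' = t) → r' = r := by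
  have key : ∀ r : Torus X, (∃ γ : Γ, moveT γ r = t) ↔
      ∃ γ : Γ, r.comp (latticeAut Γ X γ).toMonoidHom = t := fun r =>
    ⟨fun ⟨γ, h⟩ => ⟨γ⁻¹, h⟩, fun ⟨γ, h⟩ => ⟨γ⁻¹, by rw [moveT, inv_inv, h]⟩⟩
  obtain ⟨r, ⟨hr, h⟩, hu⟩ := hR t
  exact ⟨r, hr, (key r).2 h, fun r' hr' h' => hu r' ⟨hr', (key r').1 h'⟩⟩

theorem ellDet_conj (γ r : Γ) : ellDet X (r * γ * r⁻¹) = ellDet X γ := by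
  have hmul : ∀ a b : Γ, (latLin (a * b) : X →ₗ[ℤ] X) = latLin a * latLin b := by
    intro a b
    ext x
    simp [latLin_apply, mul_smul]
  have h1 : (latLin r * latLin r⁻¹ : X →ₗ[ℤ] X) = 1 := by
    ext x
    simp [latLin_apply]
  have h : (1 - latLin (r * γ * r⁻¹) : X →ₗ[ℤ] X) = latLin r * (1 - latLin γ) * latLin r⁻¹ := by
    rw [mul_sub, sub_mul, mul_one, h1, hmul, hmul]
  rw [ellDet, ellDet, h, map_mul, map_mul, mul_right_comm, ← map_mul, h1, map_one, one_mul]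

variable [Finite Γ]

/-- In the orbit sum only the `r ∈ Γ_t` hit the point `t`, and they all contribute the same class
function value. -/
theorem coefGC_indT_self (t : Torus X) (x : GC (stab Γ t)) (γ : Γ) :
    coefGC γ (indT Γ t x) t = extValue t x γ := by
  classical
  have := Fintype.ofFinite Γ
  have h0 : (Nat.card (stab Γ t) : ℂ) ≠ 0 := by exact_mod_cast Nat.card_pos.ne'
  refine mul_left_cancel₀ h0 ?_
  have h := DFunLike.congr_fun (coefGC_indT t x γ) t
  rw [Finsupp.smul_apply, smul_eq_mul, Finsupp.finsetSum_apply] at h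
  rw [h, ← Finset.sum_filter_add_sum_filter_not Finset.univ (fun r => r ∈ stab Γ t)]
  rw [Finset.sum_congr rfl (g := fun _ => extValue t x γ), Finset.sum_const, nsmul_eq_mul,
    Finset.sum_eq_zero, add_zero]
  · congr 2
    rw [Nat.card_eq_fintype_card, Fintype.card_subtype]
  · intro r hr
    exact Finsupp.single_eq_of_ne fun h' => (Finset.mem_filter.1 hr).2
      (inv_mem_iff.1 (mem_stab_iff.2 h'.symm))
  · intro r hr
    have hr := (Finset.mem_filter.1 hr).2
    rw [mem_stab_iff.1 (inv_mem hr), Finsupp.single_eq_same, extValue_conj t x hr]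

theorem coefGC_indT_eq_zero (t : Torus X) (x : GC (stab Γ t)) (γ : Γ) {s : Torus X}
    (hs : ∀ r : Γ, moveT r t ≠ s) : coefGC γ (indT Γ t x) s = 0 := by
  have := Fintype.ofFinite Γ
  have h0 : (Nat.card (stab Γ t) : ℂ) ≠ 0 := by exact_mod_cast Nat.card_pos.ne'
  refine (mul_eq_zero.1 ?_).resolve_left h0
  have h := DFunLike.congr_fun (coefGC_indT t x γ) s
  rw [Finsupp.smul_apply, smul_eq_mul, Finsupp.finsetSum_apply] at h
  rw [h]
  exact Finset.sum_eq_zero fun r _ => Finsupp.single_eq_of_ne (hs _).symm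

theorem exists_charGC_eq {G : Type} [Group G] [Finite G] (φ : G → ℂ)
    (hφ : ∀ g h, φ (h * g * h⁻¹) = φ g) : ∃ x, charGC G x = φ := by
  have := Fintype.ofFinite G
  have h0 : (Nat.card G : ℂ) ≠ 0 := by exact_mod_cast Nat.card_pos.ne'
  refine ⟨(Nat.card G : ℂ)⁻¹ • ∑ γ, φ γ • classElem γ, ?_⟩
  rw [map_smul, sum_smul_classElem φ hφ, inv_smul_smul₀ h0]

/-- For fixed `t` the coefficients form a class function on `Γ_t`, and on a finite group every class
function comes from an element of `G_ℂ`. -/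
theorem exists_extValue_eq (x : GC (Crossed Γ X)) (t : Torus X) :
    ∃ y : GC (stab Γ t), ∀ γ, extValue t y γ = coefGC γ x t := by
  obtain ⟨y, hy⟩ := exists_charGC_eq (fun γ : stab Γ t => coefGC (γ : Γ) x t) (by
    intro g h
    have := coefGC_moveT x (g : Γ) (h : Γ) t
    rwa [mem_stab_iff.1 h.2] at this)
  refine ⟨y, fun γ => ?_⟩
  unfold extValue
  split_ifs with h
  · rw [hy]
  · rw [coefGC_eq_zero x h]

/-- Take on each `Γ_t` the class function given by the coefficients of `x` at `t`. By equivariance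
coefficients need only be compared at points of the transversal, where exactly one summand
contributes. Finite supports make the sum finite. -/
theorem exists_sum_indT {R : Set (Torus X)} (hR : IsOrbitTransversal Γ R) (x : GC (Crossed Γ X)) :
    ∃ (F : Finset R) (y : ∀ t : R, GC (stab Γ t.1)), x = ∑ t ∈ F, indT Γ t.1 (y t) := by
  classical
  have := Fintype.ofFinite Γ
  choose y hy using fun t : R => exists_extValue_eq x t.1
  have hfin : {t : R | ∃ γ : Γ, coefGC γ x t.1 ≠ 0}.Finite := by
    refine Set.Finite.preimage (f := ((↑) : R → Torus X)) Subtype.val_injective.injOn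
      (s := {t | ∃ γ : Γ, coefGC γ x t ≠ 0}) ?_
    refine ((Finset.univ.biUnion fun γ : Γ => (coefGC γ x).support).finite_toSet).subset ?_
    rintro t ⟨γ, h⟩
    simpa using ⟨γ, h⟩
  refine ⟨hfin.toFinset, y, coefGC_ext fun γ => Finsupp.ext fun s => ?_⟩
  rw [map_sum, Finsupp.finsetSum_apply]
  obtain ⟨t, ht, ⟨r, rfl⟩, hu⟩ := isOrbitTransversal_moveT hR s
  have hterm : ∀ z : GC (Crossed Γ X), coefGC γ z (moveT r t) = coefGC (r⁻¹ * γ * r) z t := by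
    intro z
    rw [← coefGC_moveT z (r⁻¹ * γ * r) r t]
    congr 3
    group
  rw [Finset.sum_eq_single ⟨t, ht⟩]
  · rw [hterm, hterm, coefGC_indT_self, hy]
  · intro t' _ hne
    exact coefGC_indT_eq_zero _ _ _ fun q hq => hne (Subtype.ext (hu t' t'.2 ⟨q, hq⟩))
  · intro hnot
    rw [hterm, coefGC_indT_self, hy]
    by_contra h
    exact hnot (hfin.mem_toFinset.2 ⟨_, h⟩)

variable [Module.Free ℤ X] [Module.Finite ℤ X]

theorem extValue_eq_zero {t : Torus X} {x : GC (stab Γ t)} (hx : x ∈ ellRel (cotangentRep Γ t))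
    {γ : Γ} (hγ : ellDet X γ ≠ 0) : extValue t x γ = 0 := by
  unfold extValue
  split_ifs with h
  · exact mem_ellRel.1 hx _ (fixesOnlyZero_cotangentRep.2 hγ)
  · rfl

variable (Γ) in
theorem ellRel_le_comap_indT (t : Torus X) :
    ellRel (cotangentRep Γ t) ≤ (ellLatticeRel Γ X).comap (indT Γ t) := by
  have := Fintype.ofFinite Γ
  intro x hx
  rw [Submodule.mem_comap, mem_ellLatticeRel]
  intro γ hγ
  have h0 : (Nat.card (stab Γ t) : ℂ) ≠ 0 := by exact_mod_cast Nat.card_pos.ne'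
  refine (smul_eq_zero.1 ?_).resolve_left h0
  rw [coefGC_indT]
  refine Finset.sum_eq_zero fun r _ => ?_
  rw [extValue_eq_zero hx (by rw [ellDet_conj]; exact fixesOnlyZero_iff.1 hγ), Finsupp.single_zero]

/-- Frobenius reciprocity for the form. The coefficients of `Ind_t y` are a sum over `r ∈ Γ`; by
conjugation invariance of determinants and coefficients, every `r` contributes the same total, which
cancels `|Γ|` against `|Γ_t|`. -/
theorem ellForm_indT [Fintype Γ] (t : Torus X) [Fintype (stab Γ t)] (x : GC (Crossed Γ X))
    (y : GC (stab Γ t)) :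
    ellForm Γ X ((ellLatticeRel Γ X).mkQ x) ((ellLatticeRel Γ X).mkQ (indT Γ t y)) =
      (Nat.card (stab Γ t) : ℂ)⁻¹ * ∑ γ : stab Γ t, (ellDet X (γ : Γ)⁻¹ : ℂ) *
        (starRingEnd ℂ (coefGC (γ : Γ) x t) * charGC _ y γ) := by
  classical
  have h0 : (Nat.card (stab Γ t) : ℂ) ≠ 0 := by exact_mod_cast Nat.card_pos.ne'
  have h1 : (Nat.card Γ : ℂ) ≠ 0 := by exact_mod_cast Nat.card_pos.ne'
  let f : Γ → ℂ := fun γ =>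
    (ellDet X γ⁻¹ : ℂ) * (starRingEnd ℂ (coefGC γ x t) * extValue t y γ)
  have hpair : ∀ γ : Γ, (Nat.card (stab Γ t) : ℂ) * ((ellDet X γ⁻¹ : ℂ) *
      suppPairing (coefGC γ x) (coefGC γ (indT Γ t y))) = ∑ r : Γ, f (r * γ * r⁻¹) := by
    intro γ
    rw [mul_left_comm, ← smul_eq_mul (Nat.card (stab Γ t) : ℂ), ← map_smul, coefGC_indT, map_sum,
      Finset.mul_sum]
    refine Finset.sum_congr rfl fun r _ => ?_
    have hr : coefGC γ x (moveT r⁻¹ t) = coefGC (r * γ * r⁻¹) x t := by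
      rw [← coefGC_moveT x (r * γ * r⁻¹) r⁻¹ t]
      congr 3
      group
    have hd : ellDet X (r * γ * r⁻¹)⁻¹ = ellDet X γ⁻¹ := by
      rw [← ellDet_conj γ⁻¹ r]
      congr 1
      group
    rw [suppPairing_single, hr]
    simp only [f, hd]
  have hsum : (Nat.card (stab Γ t) : ℂ) * ∑ γ : Γ, (ellDet X γ⁻¹ : ℂ) *
      suppPairing (coefGC γ x) (coefGC γ (indT Γ t y)) = Nat.card Γ * ∑ γ : Γ, f γ := by
    rw [Finset.mul_sum]
    simp_rw [hpair]
    have hr : ∀ r : Γ, ∑ γ : Γ, f (r * γ * r⁻¹) = ∑ γ : Γ, f γ := fun r =>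
      Fintype.sum_equiv (MulAut.conj r).toEquiv _ _ fun γ => rfl
    rw [Finset.sum_comm]
    simp_rw [hr]
    rw [Finset.sum_const, Finset.card_univ, nsmul_eq_mul, Nat.card_eq_fintype_card]
  have hstab : ∑ γ : Γ, f γ = ∑ γ : stab Γ t, (ellDet X (γ : Γ)⁻¹ : ℂ) *
      (starRingEnd ℂ (coefGC (γ : Γ) x t) * charGC _ y γ) := by
    rw [← Finset.sum_filter_add_sum_filter_not Finset.univ (fun r => r ∈ stab Γ t),
      Finset.sum_eq_zero (s := Finset.univ.filter fun r => r ∉ stab Γ t), add_zero,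
      Finset.sum_subtype (p := fun r => r ∈ stab Γ t) _ (by simp)]
    · refine Finset.sum_congr (by congr) fun γ _ => ?_
      simp only [f, extValue_coe]
    · intro γ hγ
      simp only [f]
      rw [extValue, dif_neg (Finset.mem_filter.1 hγ).2, mul_zero, mul_zero]
  rw [ellForm_mk, ← hstab, inv_mul_eq_div, inv_mul_eq_div, div_eq_div_iff h1 h0, mul_comm, hsum,
    mul_comm]

-- Injectivity: the coefficients at `t` of a sum of inductions see only the component at `t`, since
-- other representatives lie in other orbits; and the relations on both sides are tested at the same
-- `γ`. Surjectivity holds already before passing to the quotients.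
open scoped Classical in
theorem indT_bijective {R : Set (Torus X)} (hR : IsOrbitTransversal Γ R)
    (hInd : ∀ t : Torus X, ellRel (cotangentRep Γ t) ≤ (ellLatticeRel Γ X).comap (indT Γ t)) :
    Function.Bijective (DirectSum.toModule ℂ R (EllLattice Γ X)
      (fun t : R => Submodule.mapQ _ _ (indT Γ t.1) (hInd t.1)) :
        (DirectSum R fun t => Ell (cotangentRep Γ t.1)) →ₗ[ℂ] EllLattice Γ X) := by
  set Φ := DirectSum.toModule ℂ R (EllLattice Γ X)
      (fun t : R => Submodule.mapQ _ _ (indT Γ t.1) (hInd t.1))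
  have hΦ : ∀ (t : R) (y : GC (stab Γ t.1)), Φ (DirectSum.lof ℂ R
      (fun t : R => Ell (cotangentRep Γ t.1)) t (Submodule.Quotient.mk y)) =
      (ellLatticeRel Γ X).mkQ (indT Γ t.1 y) := by
    intro t y
    rw [DirectSum.toModule_lof, Submodule.mapQ_apply]
    rfl
  constructor
  · rw [injective_iff_map_eq_zero]
    intro z hz
    choose y hy using fun t : R => Submodule.Quotient.mk_surjective _ (z t)
    have hz' : z = ∑ t ∈ DFinsupp.support z, DirectSum.lof ℂ R
        (fun t : R => Ell (cotangentRep Γ t.1)) t (Submodule.Quotient.mk (y t)) := by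
      conv_lhs => rw [← DirectSum.sum_support_of z]
      refine Finset.sum_congr rfl fun t _ => ?_
      rw [hy]
      rfl
    have hmem : ∑ t ∈ DFinsupp.support z, indT Γ t.1 (y t) ∈ ellLatticeRel Γ X := by
      rw [← Submodule.Quotient.mk_eq_zero, ← hz]
      conv_rhs => rw [hz']
      rw [map_sum]
      simp_rw [hΦ]
      rw [← map_sum]
      rfl
    rw [mem_ellLatticeRel] at hmem
    refine DFinsupp.ext fun t => ?_
    change z t = 0
    by_contra hne
    have ht : t ∈ DFinsupp.support z := DFinsupp.mem_support_iff.2 hne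
    refine hne ?_
    rw [← hy, Submodule.Quotient.mk_eq_zero, mem_ellRel]
    intro γ hγ
    have h := DFunLike.congr_fun (hmem (γ : Γ)
      (fixesOnlyZero_iff.2 (fixesOnlyZero_cotangentRep.1 hγ))) t.1
    rw [map_sum, Finsupp.finsetSum_apply, Finset.sum_eq_single_of_mem t ht, coefGC_indT_self,
      extValue_coe] at h
    · exact h
    · intro t' _ hne'
      refine coefGC_indT_eq_zero _ _ _ fun q hq => hne' (Subtype.ext ?_)
      obtain ⟨r, _, _, hu⟩ := isOrbitTransversal_moveT hR t.1
      rw [hu t' t'.2 ⟨q, hq⟩, hu t t.2 ⟨1, moveT_one _⟩]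
  · intro x
    obtain ⟨x, rfl⟩ := (ellLatticeRel Γ X).mkQ_surjective x
    obtain ⟨F, y, rfl⟩ := exists_sum_indT hR x
    refine ⟨∑ t ∈ F, DirectSum.lof ℂ R
        (fun t : R => Ell (cotangentRep Γ t.1)) t (Submodule.Quotient.mk (y t)), ?_⟩
    rw [map_sum, map_sum]
    exact Finset.sum_congr rfl fun t _ => hΦ t (y t)

end InductionFromStabilizers

/-! ### Traces on exterior powers -/

section ExteriorTrace

variable {E : Type*} [AddCommGroup E] [Module ℂ E] {r : ℕ} (b : Module.Basis (Fin r) ℂ E)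
  {ω : Fin r → ℂ} {T : E →ₗ[ℂ] E} (hT : ∀ i, T (b i) = ω i • b i)

include hT

theorem exteriorPower_map_basis (n : ℕ) (s : Set.powersetCard (Fin r) n) :
    exteriorPower.map n T (b.exteriorPower n s) =
      (∏ i ∈ (s : Finset (Fin r)), ω i) • b.exteriorPower n s := by
  rw [exteriorPower.basis_apply, exteriorPower.map_apply_ιMulti_family,
    exteriorPower.ιMulti_family, exteriorPower.ιMulti_family]
  have : (T ∘ b) ∘ (Set.powersetCard.ofFinEmbEquiv.symm s) =
      fun k => ω (Set.powersetCard.ofFinEmbEquiv.symm s k) •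
        (b ∘ (Set.powersetCard.ofFinEmbEquiv.symm s)) k := by
    funext k
    exact hT _
  rw [this, AlternatingMap.map_smul_univ]
  congr 1
  exact (Fintype.prod_equiv (Set.powersetCard.orderIsoOfFin s).toEquiv _
    (fun i : (s : Finset (Fin r)) => ω i) fun _ => rfl).trans
    (Finset.prod_coe_sort (s : Finset (Fin r)) ω)

theorem trace_exteriorPower_map (n : ℕ) : LinearMap.trace ℂ _ (exteriorPower.map n T) =
    ∑ s ∈ Finset.univ.filter (fun s : Finset (Fin r) => s.card = n), ∏ i ∈ s, ω i := by
  rw [trace_eq_sum_of_eigenbasis (b.exteriorPower n) (exteriorPower_map_basis b hT n)]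
  symm
  exact Finset.sum_subtype (p := fun s : Finset (Fin r) => s.card = n) _ (by simp) _

theorem det_one_sub_of_eigenbasis : LinearMap.det (1 - T) = ∏ i, (1 - ω i) := by
  rw [← LinearMap.det_toMatrix b]
  have : LinearMap.toMatrix b b (1 - T) = Matrix.diagonal fun i => 1 - ω i := by
    ext i j
    rw [LinearMap.toMatrix_apply, LinearMap.sub_apply, hT, Module.End.one_apply, map_sub, map_smul,
      b.repr_self, Matrix.diagonal_apply, Finsupp.sub_apply, Finsupp.smul_apply, Finsupp.single_apply]
    split_ifs <;> simp_all
  rw [this, Matrix.det_diagonal]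

/-- The traces are the elementary symmetric functions of the eigenvalues; expand `∏ (1 - ω i)` and
sort by the size of the subsets. -/
theorem sum_trace_exteriorPower_map : ∑ n ∈ Finset.range (r + 1), (-1) ^ n *
    LinearMap.trace ℂ _ (exteriorPower.map n T) = LinearMap.det (1 - T) := by
  rw [det_one_sub_of_eigenbasis b hT]
  simp_rw [trace_exteriorPower_map b hT, Finset.mul_sum]
  have h : ∏ i, (1 - ω i) = ∑ s : Finset (Fin r), (-1) ^ s.card * ∏ i ∈ s, ω i := by
    simp_rw [sub_eq_add_neg]
    rw [Finset.prod_one_add, Finset.powerset_univ]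
    refine Finset.sum_congr rfl fun s _ => ?_
    rw [Finset.prod_neg]
  rw [h, ← Finset.sum_fiberwise_of_maps_to (s := Finset.univ) (t := Finset.range (r + 1))
    (g := fun s : Finset (Fin r) => s.card)]
  · refine Finset.sum_congr rfl fun n _ => Finset.sum_congr rfl fun s hs => ?_
    rw [(Finset.mem_filter.1 hs).2]
  · intro s _
    rw [Finset.mem_range, Nat.lt_succ_iff]
    simpa using Finset.card_le_univ s

end ExteriorTrace

/-! ### The elliptic pairing of a finite group in terms of characters -/

section EllipticPairing

variable {G : Type} [Group G] [Fintype G] {E : Type} [AddCommGroup E] [Module ℂ E]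
  [Module.Finite ℂ E]

theorem ellPairing_eq (ρ : Representation ℂ G E) (U V : FinRep G) :
    (ellPairing ρ U.1 V.1 : ℂ) = (Nat.card G : ℂ)⁻¹ * ∑ g : G, LinearMap.det (1 - ρ g⁻¹) *
      (U.1.ρ.character g⁻¹ * V.1.ρ.character g) := by
  have := U.2
  have := V.2
  have hG : (Nat.card G : ℂ) ≠ 0 := by exact_mod_cast Nat.card_pos.ne'
  have : Invertible (Nat.card G : ℂ) := invertibleOfNonzero hG
  let r := Module.finrank ℂ E
  have hdim : ∀ n, (Module.finrank ℂ (Representation.IntertwiningMap (U.1.ρ.tprod (extPow ρ n)) V.1.ρ) : ℂ)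
      = (Nat.card G : ℂ)⁻¹ * ∑ g : G, LinearMap.trace ℂ _ (exteriorPower.map n (ρ g⁻¹)) *
        (U.1.ρ.character g⁻¹ * V.1.ρ.character g) := by
    intro n
    rw [← Representation.card_inv_mul_sum_char_mul_char_eq_finrank]
    congr 1
    refine Finset.sum_congr rfl fun g _ => ?_
    rw [Representation.char_tensor, Pi.mul_apply, mul_comm, mul_right_comm, mul_comm (_ * _)]
    rfl
  have hpow : ∀ g : G, ∃ (b : Module.Basis (Fin r) ℂ E) (ω : Fin r → ℂ), ∀ i, ρ g (b i) = ω i • b i := by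
    intro g
    obtain ⟨n, hn, hγ⟩ := isOfFinOrder_iff_pow_eq_one.1 (isOfFinOrder_of_finite g)
    exact exists_eigenbasis (ρ g) hn (by rw [← map_pow, hγ, map_one])
  -- Needed for the `finsum` to be a genuine finite sum: an `r`-element set has no larger subsets,
  -- so the traces vanish.
  have hzero : ∀ n, r < n → Module.finrank ℂ
      (Representation.IntertwiningMap (U.1.ρ.tprod (extPow ρ n)) V.1.ρ) = 0 := by
    intro n hn
    rw [← Nat.cast_eq_zero (R := ℂ), hdim]
    refine mul_eq_zero_of_right _ (Finset.sum_eq_zero fun g _ => ?_)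
    obtain ⟨b, ω, hb⟩ := hpow g⁻¹
    rw [trace_exteriorPower_map b hb, Finset.filter_false_of_mem, Finset.sum_empty, zero_mul]
    intro s _ hs
    have := Finset.card_le_univ s
    simp only [Fintype.card_fin] at this
    omega
  rw [ellPairing, finsum_eq_sum_of_support_subset (s := Finset.range (r + 1))]
  · push_cast
    simp_rw [hdim, mul_left_comm _ (Nat.card G : ℂ)⁻¹, ← Finset.mul_sum]
    congr 1
    simp_rw [Finset.mul_sum]
    rw [Finset.sum_comm]
    refine Finset.sum_congr rfl fun g _ => ?_
    obtain ⟨b, ω, hb⟩ := hpow g⁻¹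
    simp_rw [← mul_assoc, ← Finset.sum_mul, sum_trace_exteriorPower_map b hb]
  · intro n hn
    by_contra h
    refine hn ?_
    have : r < n := by simpa [Nat.lt_succ_iff] using h
    simp [hzero n this]

end EllipticPairing

section

variable {Γ X : Type} [Group Γ] [AddCommGroup X] [DistribMulAction Γ X] [Module.Free ℤ X]
  [Module.Finite ℤ X]

theorem det_cotangentRep (t : Torus X) (γ : stab Γ t) :
    LinearMap.det (1 - cotangentRep Γ t γ : Module.End ℂ _) = ellDet X (γ : Γ) := by
  have h1 : (1 - cotangentRep Γ t γ : Module.End ℂ _) =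
      (cotEquiv t).conj ((1 - latLin (γ : Γ) : X →ₗ[ℤ] X).baseChange ℂ) := by
    rw [LinearMap.baseChange_sub, map_sub, cotangentRep_eq]
    congr 1
    rw [show (1 : X →ₗ[ℤ] X) = LinearMap.id from rfl, LinearMap.baseChange_id, LinearEquiv.conj_id]
    rfl
  rw [h1, LinearEquiv.conj_apply, LinearMap.comp_assoc, LinearMap.det_conj, LinearMap.det_baseChange]
  rfl

variable [Finite Γ] [Fintype Γ]

/-- Both sides are the same average over `Γ_t`, as `det(1-γ⁻¹)` agrees on `I_t/I_t²` and on `X`, and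
conjugation of the character of `U` inverts its argument. -/
theorem ellPairing_cotangentRep (t : Torus X) (U V : FinRep (stab Γ t)) :
    (ellPairing (cotangentRep Γ t) U.1 V.1 : ℂ) =
      ellForm Γ X ((ellLatticeRel Γ X).mkQ (indT Γ t (cls U)))
        ((ellLatticeRel Γ X).mkQ (indT Γ t (cls V))) := by
  have := Fintype.ofFinite (stab Γ t)
  have : Module.Finite ℂ (vanishingIdeal t).Cotangent := Module.Finite.equiv (cotEquiv t)
  rw [ellForm_indT, ellPairing_eq]
  congr 1
  refine Finset.sum_congr rfl fun γ _ => ?_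
  rw [det_cotangentRep, coefGC_indT_self, extValue_coe, charGC_cls, charGC_cls]
  have := U.2
  rw [star_character, InvMemClass.coe_inv]

end

/-! ### Euler characteristics in long exact sequences -/

section LongExact

theorem finite_of_exact {A B C : Type*} [AddCommGroup A] [AddCommGroup B] [AddCommGroup C]
    [Module ℂ A] [Module ℂ B] [Module ℂ C] {f : A →ₗ[ℂ] B} {g : B →ₗ[ℂ] C}
    (h : Function.Exact f g) [Module.Finite ℂ A] [Module.Finite ℂ C] : Module.Finite ℂ B := by
  have := isNoetherian_of_range_eq_ker f g h.linearMap_ker_eq.symm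
  infer_instance

theorem finrank_eq_of_exact {A B C : Type*} [AddCommGroup A] [AddCommGroup B] [AddCommGroup C]
    [Module ℂ A] [Module ℂ B] [Module ℂ C] {f : A →ₗ[ℂ] B} {g : B →ₗ[ℂ] C}
    (h : Function.Exact f g) [Module.Finite ℂ B] :
    Module.finrank ℂ B = Module.finrank ℂ (LinearMap.range f) +
      Module.finrank ℂ (LinearMap.range g) := by
  rw [← LinearMap.finrank_range_add_finrank_ker g, h.linearMap_ker_eq, add_comm]

theorem subsingleton_of_exact {A B C : Type*} [AddCommGroup A] [AddCommGroup B] [AddCommGroup C]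
    [Module ℂ A] [Module ℂ B] [Module ℂ C] {f : A →ₗ[ℂ] B} {g : B →ₗ[ℂ] C}
    (h : Function.Exact f g) [Subsingleton A] [Subsingleton C] : Subsingleton B := by
  refine subsingleton_of_forall_eq 0 fun b => ?_
  obtain ⟨a, rfl⟩ := (h b).1 (Subsingleton.elim _ _)
  rw [Subsingleton.elim a 0, map_zero]

/-- Truncating the long exact sequence after `C n` leaves the rank of the connecting map `δ n` as
only defect; it is zero when `C N` vanishes. -/
theorem euler_add_of_exact {A B C : ℕ → Type*} [∀ n, AddCommGroup (A n)] [∀ n, AddCommGroup (B n)]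
    [∀ n, AddCommGroup (C n)] [∀ n, Module ℂ (A n)] [∀ n, Module ℂ (B n)] [∀ n, Module ℂ (C n)]
    [∀ n, Module.Finite ℂ (A n)] [∀ n, Module.Finite ℂ (B n)] [∀ n, Module.Finite ℂ (C n)]
    (f : ∀ n, A n →ₗ[ℂ] B n) (g : ∀ n, B n →ₗ[ℂ] C n) (δ : ∀ n, C n →ₗ[ℂ] A (n + 1))
    (hf : Function.Injective (f 0)) (hfg : ∀ n, Function.Exact (f n) (g n))
    (hgδ : ∀ n, Function.Exact (g n) (δ n)) (hδf : ∀ n, Function.Exact (δ n) (f (n + 1)))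
    {N : ℕ} (hN : Subsingleton (C N)) :
    ∑ n ∈ Finset.range (N + 1), (-1 : ℤ) ^ n * Module.finrank ℂ (B n) =
      ∑ n ∈ Finset.range (N + 1), (-1 : ℤ) ^ n * Module.finrank ℂ (A n) +
      ∑ n ∈ Finset.range (N + 1), (-1 : ℤ) ^ n * Module.finrank ℂ (C n) := by
  have key : ∀ n, ∑ k ∈ Finset.range (n + 1), (-1 : ℤ) ^ k * Module.finrank ℂ (A k) +
      ∑ k ∈ Finset.range (n + 1), (-1 : ℤ) ^ k * Module.finrank ℂ (C k) =
      ∑ k ∈ Finset.range (n + 1), (-1 : ℤ) ^ k * Module.finrank ℂ (B k) +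
        (-1) ^ n * Module.finrank ℂ (LinearMap.range (δ n)) := by
    intro n
    induction n with
    | zero =>
      simp only [zero_add, Finset.sum_range_one, pow_zero, one_mul]
      rw [finrank_eq_of_exact (hfg 0), finrank_eq_of_exact (hgδ 0), LinearMap.finrank_range_of_inj hf]
      push_cast
      ring
    | succ n ih =>
      rw [Finset.sum_range_succ, Finset.sum_range_succ _ (n + 1), Finset.sum_range_succ _ (n + 1),
        finrank_eq_of_exact (hfg (n + 1)), finrank_eq_of_exact (hgδ (n + 1)),
        finrank_eq_of_exact (hδf n)]
      push_cast
      rw [pow_succ]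
      linear_combination ih
  have h0 : Module.finrank ℂ (LinearMap.range (δ N)) = 0 := by
    have : LinearMap.range (δ N) = ⊥ := by
      rw [LinearMap.range_eq_bot]
      exact LinearMap.ext fun c => by rw [Subsingleton.elim c 0, map_zero, map_zero]
    rw [this, finrank_bot]
  have := key N
  rw [h0] at this
  rw [this]
  simp

end LongExact

/-! ### Finiteness of `Ext` and additivity of `EP` -/

section ExtPerfect

variable {G : Type} [Group G]

open Abelian

/-- The groups `Extⁿ(U,V)` are finite dimensional, and almost all of them vanish. -/
def ExtPerfect (U V : Rep.{0} ℂ G) : Prop :=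
  (∀ n : ℕ, Module.Finite ℂ (Ext U V n)) ∧ ∃ N : ℕ, ∀ n ≥ N, Subsingleton (Ext U V n)

theorem EP_eq_sum {U V : Rep.{0} ℂ G} {N : ℕ} (h : ∀ n ≥ N, Subsingleton (Ext U V n)) :
    EP U V = ∑ n ∈ Finset.range N, (-1 : ℤ) ^ n * Module.finrank ℂ (Ext U V n) := by
  refine finsum_eq_sum_of_support_subset _ fun n hn => ?_
  by_contra h'
  have := h n (by simpa using h')
  exact hn (by simp [Module.finrank_zero_of_subsingleton])

variable {U : Rep.{0} ℂ G} {S : ShortComplex (Rep.{0} ℂ G)} (hS : S.ShortExact)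

variable (U S) in
/-- The map `Extⁿ(U,V') → Extⁿ(U,V)`. -/
abbrev extMapF (n : ℕ) : Ext U S.X₁ n →ₗ[ℂ] Ext U S.X₂ n :=
  (Ext.mk₀ S.f).postcompOfLinear ℂ U (add_zero n)

variable (U S) in
/-- The map `Extⁿ(U,V) → Extⁿ(U,V'')`. -/
abbrev extMapG (n : ℕ) : Ext U S.X₂ n →ₗ[ℂ] Ext U S.X₃ n :=
  (Ext.mk₀ S.g).postcompOfLinear ℂ U (add_zero n)

variable (U) in
/-- The connecting map `Extⁿ(U,V'') → Extⁿ⁺¹(U,V')`. -/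
abbrev extConn (n : ℕ) : Ext U S.X₃ n →ₗ[ℂ] Ext U S.X₁ (n + 1) :=
  hS.extClass.postcompOfLinear ℂ U rfl

include hS

theorem extMap_exact (n : ℕ) : Function.Exact (extMapF U S n) (extMapG U S n) := by
  intro x
  constructor
  · exact fun h => Ext.covariant_sequence_exact₂ U hS x h
  · rintro ⟨y, rfl⟩
    change (y.comp (Ext.mk₀ S.f) (add_zero n)).comp (Ext.mk₀ S.g) (add_zero n) = 0
    rw [Ext.comp_assoc_of_third_deg_zero, Ext.mk₀_comp_mk₀, S.zero, Ext.mk₀_zero, Ext.comp_zero]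

theorem extMapG_exact (n : ℕ) : Function.Exact (extMapG U S n) (extConn U hS n) := by
  intro x
  constructor
  · exact fun h => Ext.covariant_sequence_exact₃ U hS x rfl h
  · rintro ⟨y, rfl⟩
    change (y.comp (Ext.mk₀ S.g) (add_zero n)).comp hS.extClass rfl = 0
    rw [Ext.comp_assoc_of_second_deg_zero, ShortComplex.ShortExact.comp_extClass, Ext.comp_zero]

theorem extConn_exact (n : ℕ) : Function.Exact (extConn U hS n) (extMapF U S (n + 1)) := by
  intro x
  constructor
  · exact fun h => Ext.covariant_sequence_exact₁ U hS x h rfl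
  · rintro ⟨y, rfl⟩
    change (y.comp hS.extClass rfl).comp (Ext.mk₀ S.f) (add_zero _) = 0
    rw [Ext.comp_assoc_of_third_deg_zero, ShortComplex.ShortExact.extClass_comp, Ext.comp_zero]

theorem extMapF_zero_injective : Function.Injective (extMapF U S 0) := by
  have := hS.mono_f
  exact Ext.postcomp_mk₀_injective_of_mono U S.f

theorem ExtPerfect.of_left_right (h₁ : ExtPerfect U S.X₁) (h₃ : ExtPerfect U S.X₃) :
    ExtPerfect U S.X₂ := by
  obtain ⟨N₁, hN₁⟩ := h₁.2
  obtain ⟨N₃, hN₃⟩ := h₃.2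
  refine ⟨fun n => ?_, max N₁ N₃, fun n hn => ?_⟩
  · have := h₁.1 n
    have := h₃.1 n
    exact finite_of_exact (extMap_exact hS n)
  · have := hN₁ n (le_of_max_le_left hn)
    have := hN₃ n (le_of_max_le_right hn)
    exact subsingleton_of_exact (extMap_exact hS n)

theorem ExtPerfect.left (h₂ : ExtPerfect U S.X₂) (h₃ : ExtPerfect U S.X₃) :
    ExtPerfect U S.X₁ := by
  obtain ⟨N₂, hN₂⟩ := h₂.2
  obtain ⟨N₃, hN₃⟩ := h₃.2
  -- `Extⁿ⁺¹(U,V')` sits between `Extⁿ(U,V'')` and `Extⁿ⁺¹(U,V)`, hence the bound grows by one.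
  refine ⟨fun n => ?_, max N₂ N₃ + 1, fun n hn => ?_⟩
  · cases n with
    | zero =>
      have := h₂.1 0
      exact Module.Finite.of_injective _ (extMapF_zero_injective hS)
    | succ n =>
      have := h₃.1 n
      have := h₂.1 (n + 1)
      exact finite_of_exact (extConn_exact hS n)
  · obtain ⟨n, rfl⟩ : ∃ m, n = m + 1 := ⟨n - 1, by omega⟩
    have := hN₂ (n + 1) (by omega)
    have := hN₃ n (by omega)
    exact subsingleton_of_exact (extConn_exact hS n)

theorem EP_add (h₁ : ExtPerfect U S.X₁) (h₃ : ExtPerfect U S.X₃) :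
    EP U S.X₂ = EP U S.X₁ + EP U S.X₃ := by
  have h₂ := h₁.of_left_right hS h₃
  obtain ⟨N₁, hN₁⟩ := h₁.2
  obtain ⟨N₂, hN₂⟩ := h₂.2
  obtain ⟨N₃, hN₃⟩ := h₃.2
  let N := max N₁ (max N₂ N₃)
  -- The sums include degree `N`, where `Ext(U,V'')` already vanishes, so that no connecting map is
  -- left over.
  rw [EP_eq_sum (N := N + 1) fun n hn => hN₁ n (by omega),
    EP_eq_sum (N := N + 1) fun n hn => hN₂ n (by omega),
    EP_eq_sum (N := N + 1) fun n hn => hN₃ n (by omega)]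
  have := h₁.1
  have := h₂.1
  have := h₃.1
  exact euler_add_of_exact (extMapF U S) (extMapG U S) (extConn U hS) (extMapF_zero_injective hS)
    (extMap_exact hS) (extMapG_exact hS) (extConn_exact hS) (hN₃ N (by omega))

end ExtPerfect

/-! ### Retracts and injective representations -/

section ExtInjective

variable {G : Type} [Group G] {U : Rep.{0} ℂ G}

open Abelian

theorem ExtPerfect.of_retract {V W : Rep.{0} ℂ G} (i : V ⟶ W) (p : W ⟶ V) (hip : i ≫ p = 𝟙 V)
    (h : ExtPerfect U W) : ExtPerfect U V := by
  have hinj : ∀ n, Function.Injective ((Ext.mk₀ i).postcompOfLinear ℂ U (add_zero n)) := by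
    intro n
    refine Function.LeftInverse.injective
      (g := (Ext.mk₀ p).postcompOfLinear ℂ U (add_zero n)) fun x => ?_
    change (x.comp (Ext.mk₀ i) (add_zero n)).comp (Ext.mk₀ p) (add_zero n) = x
    rw [Ext.comp_assoc_of_third_deg_zero, Ext.mk₀_comp_mk₀, hip, Ext.comp_mk₀_id]
  obtain ⟨N, hN⟩ := h.2
  refine ⟨fun n => ?_, N, fun n hn => ?_⟩
  · have := h.1 n
    exact Module.Finite.of_injective _ (hinj n)
  · have := hN n hn
    exact (hinj n).subsingleton

theorem subsingleton_ext_of_injective (V : Rep.{0} ℂ G) [Injective V] {n : ℕ} (hn : 1 ≤ n) :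
    Subsingleton (Ext U V n) := by
  obtain ⟨n, rfl⟩ : ∃ m, n = m + 1 := ⟨n - 1, by omega⟩
  exact Ext.subsingleton_of_injective U V n

theorem ExtPerfect.of_injective {V : Rep.{0} ℂ G} [Injective V] (h : Module.Finite ℂ (U ⟶ V)) :
    ExtPerfect U V := by
  refine ⟨fun n => ?_, 1, fun n hn => subsingleton_ext_of_injective V hn⟩
  cases n with
  | zero => exact Module.Finite.equiv (Ext.linearEquiv₀ (R := ℂ)).symm
  | succ n =>
    have := subsingleton_ext_of_injective (U := U) V (Nat.le_add_left 1 n)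
    infer_instance

theorem EP_of_injective (U : Rep.{0} ℂ G) (V : Rep.{0} ℂ G) [Injective V] :
    EP U V = Module.finrank ℂ (U ⟶ V) := by
  rw [EP_eq_sum (N := 1) fun n hn => subsingleton_ext_of_injective V hn]
  simp [(Ext.linearEquiv₀ (R := ℂ) (X := U) (Y := V)).finrank_eq]

end ExtInjective

/-! ### Integration of polynomials -/

section AntiDerivative

open MvPolynomial

variable {r : ℕ}

/-- The antiderivative with respect to the `j`-th variable. -/
def antideriv (j : Fin r) : MvPolynomial (Fin r) ℂ →ₗ[ℂ] MvPolynomial (Fin r) ℂ :=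
  (basisMonomials (Fin r) ℂ).constr ℂ fun s =>
    monomial (s + Finsupp.single j 1) ((s j + 1 : ℂ)⁻¹)

theorem antideriv_monomial (j : Fin r) (s : Fin r →₀ ℕ) :
    antideriv j (monomial s 1) = monomial (s + Finsupp.single j 1) ((s j + 1 : ℂ)⁻¹) := by
  have := (basisMonomials (Fin r) ℂ).constr_basis ℂ (fun s =>
    monomial (s + Finsupp.single j 1) ((s j + 1 : ℂ)⁻¹)) s
  rwa [coe_basisMonomials] at this

/-- Characteristic zero allows the division by `s j + 1`. This makes the last map of the tower
sequences surjective. -/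
theorem pderiv_antideriv (j : Fin r) (p : MvPolynomial (Fin r) ℂ) :
    pderiv j (antideriv j p) = p := by
  have : (pderiv j).toLinearMap ∘ₗ antideriv j = LinearMap.id := by
    refine (basisMonomials (Fin r) ℂ).ext fun s => ?_
    rw [coe_basisMonomials, LinearMap.comp_apply, antideriv_monomial]
    change pderiv j (monomial (s + Finsupp.single j 1) ((s j + 1 : ℂ)⁻¹)) = _
    rw [pderiv_monomial, add_tsub_cancel_right]
    simp only [Finsupp.add_apply, Finsupp.single_eq_same, Nat.cast_add, Nat.cast_one]
    rw [inv_mul_cancel₀ (Nat.cast_add_one_ne_zero (s j))]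
    rfl
  exact DFunLike.congr_fun this p

theorem pderiv_antideriv_of_ne {i j : Fin r} (h : i ≠ j) (p : MvPolynomial (Fin r) ℂ) :
    pderiv i (antideriv j p) = antideriv j (pderiv i p) := by
  have : (pderiv i).toLinearMap ∘ₗ antideriv j = antideriv j ∘ₗ (pderiv i).toLinearMap := by
    refine (basisMonomials (Fin r) ℂ).ext fun s => ?_
    rw [coe_basisMonomials, LinearMap.comp_apply, LinearMap.comp_apply, antideriv_monomial]
    change pderiv i (monomial (s + Finsupp.single j 1) ((s j + 1 : ℂ)⁻¹)) =
      antideriv j (pderiv i (monomial s 1))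
    rw [pderiv_monomial, pderiv_monomial, ← mul_one (1 * (s i : ℂ)), ← smul_eq_mul (1 * (s i : ℂ)),
      ← smul_monomial, map_smul, antideriv_monomial, smul_monomial]
    rcases Nat.eq_zero_or_pos (s i) with h0 | h0
    · simp [h0, Finsupp.single_eq_of_ne h]
    · congr 1
      · congr 1
        ext k
        simp only [Finsupp.add_apply, Finsupp.tsub_apply, Finsupp.single_apply]
        split_ifs <;> omega
      · simp [Finsupp.single_eq_of_ne h, Finsupp.single_eq_of_ne h.symm, mul_comm]
  exact DFunLike.congr_fun this p

theorem eq_C_of_pderiv_eq_zero {p : MvPolynomial (Fin r) ℂ} (h : ∀ i, pderiv i p = 0) :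
    p = C (coeff 0 p) := by
  ext s
  rw [coeff_C]
  split_ifs with hs
  · rw [hs]
  · obtain ⟨i, hi⟩ := Finsupp.ne_iff.1 hs
    have hp := congrArg (coeff (s - Finsupp.single i 1)) (h i)
    have hs' : s - Finsupp.single i 1 + Finsupp.single i 1 = s :=
      tsub_add_cancel_of_le (Finsupp.single_le_iff.2 (Nat.one_le_iff_ne_zero.2 (Ne.symm hi)))
    rw [coeff_pderiv, hs', coeff_zero] at hp
    exact (mul_eq_zero.1 hp).resolve_right (Nat.cast_add_one_ne_zero _)

theorem pderiv_pderiv_comm (i j : Fin r) (p : MvPolynomial (Fin r) ℂ) :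
    pderiv i (pderiv j p) = pderiv j (pderiv i p) := by
  ext m
  rw [coeff_pderiv, coeff_pderiv, coeff_pderiv, coeff_pderiv, add_right_comm]
  rcases eq_or_ne i j with rfl | h
  · rfl
  · simp only [Finsupp.add_apply, Finsupp.single_eq_of_ne h, Finsupp.single_eq_of_ne h.symm,
      add_zero]
    ring

end AntiDerivative

/-- A homomorphism from `K` to the group of affine transformations of `ℂʳ` whose linear parts
are diagonal. -/
structure AffineAction (K : Type) [Group K] (r : ℕ) where
  lin : Fin r → K →* ℂˣ
  shift : Fin r → K → ℂ
  shift_mul : ∀ i h k, shift i (h * k) = lin i k * shift i h + shift i k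

/-! ### The tower of twisted polynomial representations -/

namespace AffineAction

open MvPolynomial

variable {K : Type} [Group K] {r : ℕ} (a : AffineAction K r)

theorem shift_one (i : Fin r) : a.shift i 1 = 0 := by
  have := a.shift_mul i 1 1
  simpa using this

/-- The action on polynomials. -/
def sub (h : K) : MvPolynomial (Fin r) ℂ →ₐ[ℂ] MvPolynomial (Fin r) ℂ :=
  aeval fun i => C (a.lin i h : ℂ) * X i + C (a.shift i h)

theorem sub_X (h : K) (i : Fin r) : a.sub h (X i) = C (a.lin i h : ℂ) * X i + C (a.shift i h) :=
  aeval_X _ _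

theorem sub_C (h : K) (c : ℂ) : a.sub h (C c) = C c := (a.sub h).commutes c

theorem sub_one : a.sub 1 = AlgHom.id ℂ _ := by
  refine MvPolynomial.algHom_ext fun i => ?_
  rw [sub_X, shift_one]
  simp

theorem sub_mul (h k : K) : a.sub (h * k) = (a.sub h).comp (a.sub k) := by
  refine MvPolynomial.algHom_ext fun i => ?_
  rw [AlgHom.comp_apply, sub_X, sub_X, map_add, map_mul (a.sub h), sub_C, sub_C, sub_X,
    a.shift_mul, map_mul (a.lin i), Units.val_mul]
  simp only [map_mul, map_add]
  ring

theorem eval_sub (h : K) (e : Fin r → ℂ) (p : MvPolynomial (Fin r) ℂ) :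
    eval e (a.sub h p) = eval (fun i => a.lin i h * e i + a.shift i h) p := by
  have : (aeval e).comp (a.sub h) = aeval (fun i => a.lin i h * e i + a.shift i h) :=
    MvPolynomial.algHom_ext fun i => by
      rw [AlgHom.comp_apply, sub_X]
      simp
  exact DFunLike.congr_fun this p

/-- The chain rule: translations disappear, and the diagonal linear part turns `∂_j` into an
intertwiner up to the character `lin j`. Diagonality is what keeps the partial derivatives from
mixing. -/
theorem pderiv_sub (h : K) (j : Fin r) (p : MvPolynomial (Fin r) ℂ) :
    pderiv j (a.sub h p) = (a.lin j h : ℂ) • a.sub h (pderiv j p) := by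
  induction p using MvPolynomial.induction_on with
  | C c => simp
  | add p q hp hq => simp [hp, hq]
  | mul_X p i hp =>
    rw [map_mul, Derivation.leibniz, hp, sub_X, Derivation.leibniz, map_add, map_add,
      Derivation.leibniz, pderiv_C, pderiv_C]
    simp only [pderiv_X, smul_eq_mul, map_mul, sub_X, Pi.single_apply]
    split_ifs with hij
    · subst hij
      simp only [smul_eq_C_mul, map_one]
      ring
    · simp only [smul_eq_C_mul, map_zero]
      ring

variable (ψ : K →* ℂˣ)

/-- The representation of `K` on polynomials, twisted by a character. -/
def polyRep : Representation ℂ K (MvPolynomial (Fin r) ℂ) where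
  toFun h := (ψ h : ℂ) • (a.sub h).toLinearMap
  map_one' := by
    rw [sub_one]
    ext
    simp
  map_mul' h k := by
    refine LinearMap.ext fun p => ?_
    rw [sub_mul]
    simp [smul_smul, mul_comm]

theorem polyRep_apply (h : K) (p : MvPolynomial (Fin r) ℂ) :
    a.polyRep ψ h p = (ψ h : ℂ) • a.sub h p := rfl

/-- The polynomials in the variables outside `T`. -/
def polyKer (T : Finset (Fin r)) : Submodule ℂ (MvPolynomial (Fin r) ℂ) where
  carrier := {p | ∀ i ∈ T, pderiv i p = 0}
  add_mem' hp hq i hi := by rw [map_add, hp i hi, hq i hi, add_zero]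
  zero_mem' i _ := map_zero _
  smul_mem' c p hp i hi := by rw [Derivation.map_smul, hp i hi, smul_zero]

theorem mem_polyKer {T : Finset (Fin r)} {p : MvPolynomial (Fin r) ℂ} :
    p ∈ polyKer T ↔ ∀ i ∈ T, pderiv i p = 0 := Iff.rfl

/-- The representation of `K` on the polynomials in the variables outside `T`. -/
def towerRep (T : Finset (Fin r)) : Representation ℂ K (polyKer T) where
  toFun h := (a.polyRep ψ h).restrict fun p hp => by
    rw [mem_polyKer] at hp ⊢
    intro i hi
    rw [polyRep_apply, Derivation.map_smul, pderiv_sub, hp i hi, map_zero, smul_zero, smul_zero]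
  map_one' := by ext; simp
  map_mul' h k := by ext; simp

theorem towerRep_coe {T : Finset (Fin r)} (h : K) (p : polyKer T) :
    (a.towerRep ψ T h p : MvPolynomial (Fin r) ℂ) = (ψ h : ℂ) • a.sub h p := rfl

/-- The tower representations, as objects of the category of representations. -/
abbrev tower (T : Finset (Fin r)) : Rep.{0} ℂ K := Rep.of (a.towerRep ψ T)

theorem polyKer_mono {S T : Finset (Fin r)} (h : S ⊆ T) : polyKer T ≤ polyKer S :=
  fun _ hp => mem_polyKer.2 fun _ hi => mem_polyKer.1 hp _ (h hi)

theorem pderiv_mem_polyKer {T : Finset (Fin r)} (j : Fin r) {p : MvPolynomial (Fin r) ℂ}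
    (hp : p ∈ polyKer T) : pderiv j p ∈ polyKer T := by
  rw [mem_polyKer] at hp ⊢
  intro i hi
  rw [pderiv_pderiv_comm, hp i hi, map_zero]

theorem inclusion_towerRep {S T : Finset (Fin r)} (hST : S ⊆ T) (h : K) :
    Submodule.inclusion (polyKer_mono hST) ∘ₗ a.towerRep ψ T h =
      a.towerRep ψ S h ∘ₗ Submodule.inclusion (polyKer_mono hST) := by
  refine LinearMap.ext fun p => Subtype.ext ?_
  rw [LinearMap.comp_apply, LinearMap.comp_apply, Submodule.coe_inclusion, towerRep_coe,
    towerRep_coe, Submodule.coe_inclusion]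

/-- The inclusion `N_T ⊆ N_S` for `S ⊆ T`. -/
def towerIncl {S T : Finset (Fin r)} (hST : S ⊆ T) : a.tower ψ T ⟶ a.tower ψ S :=
  Rep.ofHom ⟨Submodule.inclusion (polyKer_mono hST), a.inclusion_towerRep ψ hST⟩

/-- The partial derivative `N_T → N_T ⊗ ω_j`. -/
def towerDeriv (T : Finset (Fin r)) (j : Fin r) : a.tower ψ T ⟶ a.tower (ψ * a.lin j) T :=
  Rep.ofHom ⟨(pderiv j).toLinearMap.restrict fun _ hp => pderiv_mem_polyKer j hp, fun h => by
    refine LinearMap.ext fun p => Subtype.ext ?_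
    change pderiv j ((ψ h : ℂ) • a.sub h p.1) = ((ψ * a.lin j) h : ℂ) • a.sub h (pderiv j p.1)
    rw [Derivation.map_smul, pderiv_sub, smul_smul]
    rfl⟩

theorem towerIncl_towerDeriv {S T : Finset (Fin r)} (hST : S ⊆ T) {j : Fin r} (hj : j ∈ T) :
    a.towerIncl ψ hST ≫ a.towerDeriv ψ S j = 0 := by
  refine Rep.hom_ext (Representation.IntertwiningMap.ext (LinearMap.ext fun p => Subtype.ext ?_))
  exact mem_polyKer.1 p.2 j hj

/-- The exact sequence `0 → N_{T ∪ {j}} → N_T → N_T ⊗ ω_j → 0` given by the partial derivative. -/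
def towerSeq {S T : Finset (Fin r)} (hST : S ⊆ T) {j : Fin r} (hj : j ∈ T) :
    ShortComplex (Rep.{0} ℂ K) :=
  ShortComplex.mk (a.towerIncl ψ hST) (a.towerDeriv ψ S j) (a.towerIncl_towerDeriv ψ hST hj)

theorem towerSeq_shortExact {S T : Finset (Fin r)} (hST : S ⊆ T) {j : Fin r} (hj : j ∈ T)
    (hjS : j ∉ S) (hT : ∀ i ∈ T, i = j ∨ i ∈ S) : (a.towerSeq ψ hST hj).ShortExact := by
  refine shortExact_of ?_ ?_ ?_
  · exact Submodule.inclusion_injective (polyKer_mono hST)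
  · intro p
    constructor
    · intro h
      have h' : pderiv j (p : polyKer S).1 = 0 := congrArg Subtype.val h
      refine ⟨(⟨(p : polyKer S).1, mem_polyKer.2 fun i hi => ?_⟩ : polyKer T), rfl⟩
      rcases hT i hi with rfl | hi
      · exact h'
      · exact mem_polyKer.1 (p : polyKer S).2 i hi
    · rintro ⟨q, rfl⟩
      exact Subtype.ext (mem_polyKer.1 (q : polyKer T).2 j hj)
  · intro p
    -- As `j ∉ S`, integrating in the variable `j` commutes with the derivatives that must stay
    -- zero.
    refine ⟨(⟨antideriv j (p : polyKer S).1, mem_polyKer.2 fun i hi => ?_⟩ : polyKer S),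
      Subtype.ext (pderiv_antideriv j (p : polyKer S).1)⟩
    rw [pderiv_antideriv_of_ne (by rintro rfl; exact hjS hi),
      mem_polyKer.1 (p : polyKer S).2 i hi, map_zero]

theorem polyKer_empty : polyKer (∅ : Finset (Fin r)) = ⊤ :=
  top_le_iff.1 fun _ _ _ hi => absurd hi (Finset.notMem_empty _)

theorem C_mem_polyKer (T : Finset (Fin r)) (c : ℂ) : C c ∈ polyKer T :=
  mem_polyKer.2 fun _ _ => pderiv_C

/-- The last step of the tower is the character `ψ`. -/
def towerUnivIso : charRep ψ ≅ a.tower ψ Finset.univ where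
  hom := Rep.ofHom ⟨
    { toFun := fun c => ⟨C c, C_mem_polyKer _ c⟩
      map_add' := fun c d => Subtype.ext (map_add C c d)
      map_smul' := fun c d => Subtype.ext ((map_mul C c d).trans C_mul') },
    fun h => LinearMap.ext fun c => Subtype.ext (by
      change C ((ψ h : ℂ) * c) = (ψ h : ℂ) • a.sub h (C c)
      rw [sub_C, smul_eq_C_mul, map_mul])⟩
  inv := Rep.ofHom ⟨
    { toFun := fun p => coeff 0 p.1
      map_add' := fun p q => coeff_add _ _ _
      map_smul' := fun c p => coeff_smul _ _ _ },
    fun h => LinearMap.ext fun p => by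
      change coeff 0 ((ψ h : ℂ) • a.sub h p.1) = (ψ h : ℂ) * coeff 0 p.1
      rw [eq_C_of_pderiv_eq_zero fun i => mem_polyKer.1 p.2 i (Finset.mem_univ i), sub_C,
        coeff_smul, smul_eq_mul]⟩
  hom_inv_id := by
    ext
    exact coeff_zero_C _
  inv_hom_id := by
    refine Rep.hom_ext (Representation.IntertwiningMap.ext (LinearMap.ext fun p => Subtype.ext ?_))
    exact (eq_C_of_pderiv_eq_zero fun i =>
      mem_polyKer.1 p.2 i (Finset.mem_univ i)).symm

end AffineAction

/-! ### Matlis duality as a criterion for injectivity -/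

section Baer

variable {A R : Type} [CommRing A] [AddCommGroup R] [Module A R]

theorem exists_pow_le_annihilator (m : Ideal A) (htors : ∀ p : R, ∃ n : ℕ, ∀ f ∈ m ^ n, f • p = 0)
    (N : Submodule A R) (hN : N.FG) : ∃ n : ℕ, ∀ p ∈ N, ∀ f ∈ m ^ n, f • p = 0 := by
  obtain ⟨t, rfl⟩ := hN
  choose n hn using htors
  refine ⟨t.sup n, fun p hp f hf => ?_⟩
  induction hp using Submodule.span_induction with
  | mem p hp => exact hn p f (Ideal.pow_le_pow_right (Finset.le_sup hp) hf)
  | zero => exact smul_zero f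
  | add p q _ _ hp hq => rw [smul_add, hp, hq, add_zero]
  | smul a p _ hp => rw [smul_comm, hp, smul_zero]

/-- A criterion for a torsion module to be injective (Matlis duality). -/
theorem baer_of_torsion [IsNoetherianRing A] [Algebra ℂ A] [Module ℂ R] [IsScalarTower ℂ A R]
    (m : Ideal A) (htors : ∀ p : R, ∃ n : ℕ, ∀ f ∈ m ^ n, f • p = 0)
    (ev : R →ₗ[ℂ] ℂ) (hnd : ∀ p : R, (∀ f : A, ev (f • p) = 0) → p = 0)
    (hrep : ∀ (n : ℕ) (l : A →ₗ[ℂ] ℂ), (∀ f ∈ m ^ n, l f = 0) → ∃ p : R, ∀ f, l f = ev (f • p)) :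
    Module.Baer A R := by
  intro J φ
  obtain ⟨n, hn⟩ := exists_pow_le_annihilator m htors (LinearMap.range φ)
    (Module.Finite.iff_fg.1 (Module.Finite.range φ))
  -- Artin–Rees: `m^(n+k) ∩ J ⊆ mⁿ J`, and `φ` kills the latter because `mⁿ` annihilates its
  -- finitely generated image.
  obtain ⟨k, hk⟩ := Ideal.exists_pow_inf_eq_pow_smul m (M := A) J
  have hker : ∀ j : J, (j : A) ∈ m ^ (n + k) → φ j = 0 := by
    intro j hj
    have h1 : (j : A) ∈ m ^ n • (m ^ k • ⊤ ⊓ J) := by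
      have := hk (n + k) (Nat.le_add_left k n)
      rw [Nat.add_sub_cancel] at this
      rw [← this]
      exact ⟨by simpa using hj, j.2⟩
    have h2 : ∃ h : (j : A) ∈ J, φ ⟨j, h⟩ = 0 := by
      refine Submodule.smul_induction_on (p := fun x => ∃ h : x ∈ J, φ ⟨x, h⟩ = 0) h1 ?_ ?_
      · intro f hf x hx
        refine ⟨J.smul_mem f hx.2, ?_⟩
        have : (⟨f • x, J.smul_mem f hx.2⟩ : J) = f • ⟨x, hx.2⟩ := rfl
        rw [this, map_smul]
        exact hn _ (LinearMap.mem_range_self φ _) f hf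
      · rintro x y ⟨hx, hx'⟩ ⟨hy, hy'⟩
        refine ⟨J.add_mem hx hy, ?_⟩
        have : (⟨x + y, J.add_mem hx hy⟩ : J) = ⟨x, hx⟩ + ⟨y, hy⟩ := rfl
        rw [this, map_add, hx', hy', add_zero]
    exact h2.2
  let π : J →ₗ[ℂ] A ⧸ (m ^ (n + k)).restrictScalars ℂ :=
    ((m ^ (n + k)).restrictScalars ℂ).mkQ ∘ₗ (J.subtype.restrictScalars ℂ)
  let l₀ : J →ₗ[ℂ] ℂ := ev ∘ₗ φ.restrictScalars ℂ
  -- Thus `ev ∘ φ` is a functional on the image of `J` in `A / m^(n+k)` and extends `ℂ`-linearly to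
  -- the whole quotient. By `hrep` the extension is `f ↦ ev (f • p)`, and nondegeneracy identifies
  -- `φ` with multiplication of `p`.
  have hl₀ : l₀ ∈ LinearMap.range π.dualMap := by
    rw [LinearMap.range_dualMap_eq_dualAnnihilator_ker, Submodule.mem_dualAnnihilator]
    intro j hj
    have : φ j = 0 := hker j ((Submodule.Quotient.mk_eq_zero _).1 hj)
    change ev (φ j) = 0
    rw [this, map_zero]
  obtain ⟨l, hl⟩ := hl₀
  obtain ⟨p, hp⟩ := hrep (n + k) (l ∘ₗ ((m ^ (n + k)).restrictScalars ℂ).mkQ) fun f hf => by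
    have : ((m ^ (n + k)).restrictScalars ℂ).mkQ f = 0 := (Submodule.Quotient.mk_eq_zero _).2 hf
    rw [LinearMap.comp_apply, this, map_zero]
  refine ⟨LinearMap.toSpanSingleton A R p, fun x hx => ?_⟩
  rw [LinearMap.toSpanSingleton_apply, ← sub_eq_zero]
  refine hnd _ fun f => ?_
  have h1 : ev (φ (f • ⟨x, hx⟩)) = l (((m ^ (n + k)).restrictScalars ℂ).mkQ (f • x)) :=
    (DFunLike.congr_fun hl (f • ⟨x, hx⟩)).symm
  have h2 := hp (f • x)
  rw [LinearMap.comp_apply, ← h1, map_smul, smul_assoc] at h2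
  rw [smul_sub, map_sub, h2, sub_self]

end Baer

/-! ### Matrix coefficients of unipotent lattice actions are polynomial -/

section Binomial

/-- The polynomial `z ↦ binom(z, j)`. -/
def binomPoly (j : ℕ) : Polynomial ℂ := Polynomial.C ((j.factorial : ℂ)⁻¹) * descPochhammer ℂ j

theorem eval_binomPoly (j : ℕ) (z : ℂ) : (binomPoly j).eval z = Ring.choose z j := by
  rw [Ring.choose_eq_smul, binomPoly, Polynomial.eval_mul, Polynomial.eval_C, smul_eq_mul,
    ← Polynomial.aeval_eq_smeval, Polynomial.aeval_def, ← Polynomial.eval_map, descPochhammer_map]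

theorem eval_binomPoly_succ (j : ℕ) (z : ℂ) :
    (binomPoly (j + 1)).eval (z + 1) = (binomPoly j).eval z + (binomPoly (j + 1)).eval z := by
  simp only [eval_binomPoly]
  exact Ring.choose_succ_succ z j

theorem eval_binomPoly_zero (z : ℂ) : (binomPoly 0).eval z = 1 := by simp [binomPoly]

/-- Newton's series for `(1 + (u-1))^k` terminates. By Pascal's rule the right hand side is
multiplied by `u` when `k` grows by one; since `u` is a unit, the recursion also runs to negative
`k`. -/
theorem zpow_eq_sum_binomPoly {B : Type*} [CommRing B] [Algebra ℂ B] (u : Bˣ) {n : ℕ}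
    (hu : ((u : B) - 1) ^ n = 0) (k : ℤ) : ((u ^ k : Bˣ) : B) =
      ∑ j ∈ Finset.range n, (binomPoly j).eval (k : ℂ) • ((u : B) - 1) ^ j := by
  have step : ∀ k : ℤ, (u : B) * ∑ j ∈ Finset.range n, (binomPoly j).eval (k : ℂ) • ((u : B) - 1) ^ j =
      ∑ j ∈ Finset.range n, (binomPoly j).eval ((k + 1 : ℤ) : ℂ) • ((u : B) - 1) ^ j := by
    intro k
    cases n with
    | zero => simp
    | succ n =>
      have h1 : ∑ j ∈ Finset.range (n + 1), (binomPoly j).eval (k : ℂ) • ((u : B) - 1) ^ (j + 1) =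
          ∑ j ∈ Finset.range n, (binomPoly j).eval (k : ℂ) • ((u : B) - 1) ^ (j + 1) := by
        rw [Finset.sum_range_succ, hu, smul_zero, add_zero]
      have h2 : (u : B) * ∑ j ∈ Finset.range (n + 1),
          (binomPoly j).eval (k : ℂ) • ((u : B) - 1) ^ j =
          ∑ j ∈ Finset.range (n + 1), (binomPoly j).eval (k : ℂ) • ((u : B) - 1) ^ j +
          ∑ j ∈ Finset.range (n + 1), (binomPoly j).eval (k : ℂ) • ((u : B) - 1) ^ (j + 1) := by
        rw [Finset.mul_sum, ← Finset.sum_add_distrib]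
        refine Finset.sum_congr rfl fun j _ => ?_
        rw [← smul_add, pow_succ, mul_smul_comm]
        congr 1
        ring
      rw [h2, h1, Finset.sum_range_succ', Finset.sum_range_succ' _ n, add_right_comm,
        ← Finset.sum_add_distrib, eval_binomPoly_zero, eval_binomPoly_zero]
      congr 1
      refine Finset.sum_congr rfl fun j _ => ?_
      push_cast
      rw [eval_binomPoly_succ, add_smul, add_comm]
  induction k using Int.induction_on with
  | zero =>
    cases n with
    | zero =>
      have : Subsingleton B := subsingleton_of_zero_eq_one (by simpa using hu.symm)
      exact Subsingleton.elim _ _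
    | succ n =>
      rw [Finset.sum_range_succ', Finset.sum_eq_zero]
      · simp [eval_binomPoly_zero]
      · intro j _
        rw [eval_binomPoly, Int.cast_zero, Ring.choose_zero_succ, zero_smul]
  | succ k ih =>
    rw [← step, ← ih, zpow_add_one, mul_comm, Units.val_mul]
  | pred k ih =>
    have h := step (-(k : ℤ) - 1)
    rw [sub_add_cancel, ← ih] at h
    rw [zpow_sub_one, mul_comm, Units.val_mul, ← h, Units.inv_mul_cancel_left]

open MvPolynomial in
theorem exists_polynomial_of_nilpotent {X B : Type} [AddCommGroup X] [CommRing B] [Algebra ℂ B]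
    {r : ℕ} (b : Module.Basis (Fin r) ℤ X) (U : Multiplicative X →* B) {n : ℕ}
    (hU : ∀ x, (U x - 1) ^ n = 0) (l : B →ₗ[ℂ] ℂ) : ∃ P : MvPolynomial (Fin r) ℂ,
      ∀ x, l (U (Multiplicative.ofAdd x)) = eval (fun i => ((b.repr x i : ℤ) : ℂ)) P := by
  let u : Fin r → Bˣ := fun i => U.toHomUnits (Multiplicative.ofAdd (b i))
  refine ⟨∑ α ∈ Fintype.piFinset fun _ : Fin r => Finset.range n,
    C (l (∏ i, ((u i : B) - 1) ^ α i)) * ∏ i, Polynomial.aeval (MvPolynomial.X i) (binomPoly (α i)),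
    fun x => ?_⟩
  have hx : U (Multiplicative.ofAdd x) = ∏ i, ((u i ^ (b.repr x i) : Bˣ) : B) := by
    have h1 : Multiplicative.ofAdd x = ∏ i, Multiplicative.ofAdd (b i) ^ (b.repr x i) := by
      conv_lhs => rw [← b.sum_repr x]
      rw [ofAdd_sum]
      rfl
    rw [← MonoidHom.coe_toHomUnits, h1, map_prod, Units.coe_prod]
    simp only [map_zpow]
    rfl
  rw [hx, Finset.prod_congr rfl fun i _ => zpow_eq_sum_binomPoly (u i) (hU _) _,
    Finset.prod_univ_sum, map_sum, map_sum]
  refine Finset.sum_congr rfl fun α _ => ?_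
  rw [Finset.prod_smul, map_smul, smul_eq_mul, mul_comm, RingHom.map_mul,
    MvPolynomial.eval_C]
  congr 1
  rw [map_prod (MvPolynomial.eval _)]
  refine Finset.prod_congr rfl fun i _ => ?_
  have : (eval fun i => ((b.repr x i : ℤ) : ℂ)) (Polynomial.aeval (MvPolynomial.X i) (binomPoly (α i))) =
      aeval (fun i => ((b.repr x i : ℤ) : ℂ)) (Polynomial.aeval (MvPolynomial.X i) (binomPoly (α i))) := rfl
  rw [this, ← Polynomial.aeval_algHom_apply, aeval_X, Polynomial.coe_aeval_eq_eval]

end Binomial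

/-- Modulo the `n`-th power of the ideal, `s(x)⁻¹ x` is unipotent, so functionals on it depend
polynomially on `x`. This is the half of the duality which shows that polynomials represent all
functionals. -/
theorem exists_polynomial_of_vanishing {X : Type} [AddCommGroup X] {r : ℕ}
    (b : Module.Basis (Fin r) ℤ X) (s : Torus X) {n : ℕ}
    (l : MonoidAlgebra ℂ (Multiplicative X) →ₗ[ℂ] ℂ) (hl : ∀ f ∈ vanishingIdeal s ^ n, l f = 0) :
    ∃ P : MvPolynomial (Fin r) ℂ, ∀ x, l (MonoidAlgebra.single (Multiplicative.ofAdd x) 1) =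
      s (Multiplicative.ofAdd x) *
        MvPolynomial.eval (fun i => ((b.repr x i : ℤ) : ℂ)) P := by
  let U₀ : Multiplicative X →* MonoidAlgebra ℂ (Multiplicative X) :=
    { toFun := fun x => ((s x)⁻¹ : ℂˣ).1 • MonoidAlgebra.single x 1
      map_one' := by
        rw [map_one, inv_one, Units.val_one, one_smul]
        rfl
      map_mul' := fun x y => by
        rw [smul_mul_smul_comm, MonoidAlgebra.single_mul_single, mul_one, map_mul, mul_inv,
          Units.val_mul] }
  let π := Ideal.Quotient.mkₐ ℂ (vanishingIdeal s ^ n)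
  have hU : ∀ x, ((π : _ →* MonoidAlgebra ℂ (Multiplicative X) ⧸ vanishingIdeal s ^ n).comp U₀ x - 1) ^ n = 0 := by
    intro x
    have h1 : (π : _ →* MonoidAlgebra ℂ (Multiplicative X) ⧸ vanishingIdeal s ^ n).comp U₀ x - 1 = π (U₀ x - 1) := by
      rw [map_sub, map_one]
      rfl
    rw [h1, ← map_pow]
    refine Ideal.Quotient.eq_zero_iff_mem.2 (Ideal.pow_mem_pow ?_ n)
    rw [RingHom.mem_ker, map_sub, map_one]
    simp [U₀, evalAt]
  have hker : (vanishingIdeal s ^ n).restrictScalars ℂ ≤ LinearMap.ker l := fun f hf => hl f hf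
  obtain ⟨P, hP⟩ := exists_polynomial_of_nilpotent b _ hU
    (((vanishingIdeal s ^ n).restrictScalars ℂ).liftQ l hker)
  refine ⟨P, fun x => ?_⟩
  rw [← hP]
  change _ = _ * l (U₀ (Multiplicative.ofAdd x))
  change _ = _ * l ((((s (Multiplicative.ofAdd x))⁻¹ : ℂˣ) : ℂ) •
    MonoidAlgebra.single (Multiplicative.ofAdd x) 1)
  rw [map_smul, smul_eq_mul, Units.mul_inv_cancel_left]

/-! ### Polynomials and their values at integral points -/

section LinearSubstitution

open MvPolynomial

variable {r : ℕ}

/-- Substitution of a linear map into a polynomial. -/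
def linSub (M : (Fin r → ℂ) →ₗ[ℂ] (Fin r → ℂ)) (p : MvPolynomial (Fin r) ℂ) :
    MvPolynomial (Fin r) ℂ :=
  aeval (fun i => ∑ j, C (M (Pi.single j 1) i) * X j) p

theorem eval_linSub (M : (Fin r → ℂ) →ₗ[ℂ] (Fin r → ℂ)) (p : MvPolynomial (Fin r) ℂ)
    (v : Fin r → ℂ) : eval v (linSub M p) = eval (M v) p := by
  have : (aeval v).comp (aeval (R := ℂ) (fun i => ∑ j, C (M (Pi.single j 1) i) * X j)) =
      aeval (R := ℂ) (M v) := MvPolynomial.algHom_ext fun i => by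
    rw [AlgHom.comp_apply, aeval_X, aeval_X]
    have hv : M v i = ∑ j, v j * M (Pi.single j 1) i := by
      conv_lhs => rw [pi_eq_sum_univ' v]
      simp
    rw [hv, map_sum]
    exact Finset.sum_congr rfl fun j _ => by simp [mul_comm]
  exact DFunLike.congr_fun this p

theorem eq_zero_of_eval_int {p : MvPolynomial (Fin r) ℂ}
    (h : ∀ k : Fin r → ℤ, eval (fun i => (k i : ℂ)) p = 0) : p = 0 := by
  refine MvPolynomial.funext_set (fun _ => Set.range ((↑) : ℤ → ℂ))
    (fun _ => Set.infinite_range_of_injective Int.cast_injective) fun v hv => ?_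
  choose k hk using fun i => hv i (Set.mem_univ i)
  have : v = fun i => (k i : ℂ) := funext fun i => (hk i).symm
  rw [this, h, map_zero]

end LinearSubstitution

/-! ### Twisted polynomials as a module over `ℂ[X]` -/

namespace AffineAction

open MvPolynomial

variable {Y K : Type} [AddCommGroup Y] [Group K] {r : ℕ} (a : AffineAction K r)
  (ψ : K →* ℂˣ) (ι : Multiplicative Y →* K)

/-- Polynomials which are annihilated by `n` differences along the lattice. -/
def diffKer : ℕ → Submodule ℂ (MvPolynomial (Fin r) ℂ)
  | 0 => ⊥
  | n + 1 => ⨅ x, (diffKer n).comap ((a.sub (ι x)).toLinearMap - LinearMap.id)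

theorem mem_diffKer_succ {n : ℕ} {p : MvPolynomial (Fin r) ℂ} :
    p ∈ a.diffKer ι (n + 1) ↔ ∀ x, a.sub (ι x) p - p ∈ a.diffKer ι n := by
  simp [diffKer]

theorem diffKer_le_succ (n : ℕ) : a.diffKer ι n ≤ a.diffKer ι (n + 1) := by
  induction n with
  | zero => exact bot_le
  | succ n ih =>
    intro p hp
    rw [mem_diffKer_succ] at hp ⊢
    exact fun x => ih (hp x)

theorem diffKer_mono : Monotone (a.diffKer ι) := monotone_nat_of_le_succ (a.diffKer_le_succ ι)

/-- A Leibniz rule for differences: a translation changes `X i` by a constant only. By induction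
every polynomial is killed by sufficiently many differences. -/
theorem mul_X_mem_diffKer (hlin : ∀ i x, a.lin i (ι x) = 1) (i : Fin r) (n : ℕ) :
    ∀ p ∈ a.diffKer ι n, p * X i ∈ a.diffKer ι (n + 1) := by
  induction n with
  | zero =>
    intro p hp
    rw [(Submodule.mem_bot ℂ).1 hp, zero_mul]
    exact Submodule.zero_mem _
  | succ n ih =>
    intro p hp
    rw [mem_diffKer_succ]
    intro x
    have hx := a.mem_diffKer_succ ι |>.1 hp x
    have : a.sub (ι x) (p * X i) - p * X i = (a.sub (ι x) p - p) * X i +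
        a.shift i (ι x) • (p + (a.sub (ι x) p - p)) := by
      rw [map_mul, sub_X, hlin, smul_eq_C_mul]
      simp only [Units.val_one, map_one]
      ring
    rw [this]
    exact Submodule.add_mem _ (ih _ hx) (Submodule.smul_mem _ _ (Submodule.add_mem _ hp
      (a.diffKer_le_succ ι n hx)))

theorem exists_mem_diffKer (hlin : ∀ i x, a.lin i (ι x) = 1) (p : MvPolynomial (Fin r) ℂ) :
    ∃ n, p ∈ a.diffKer ι n := by
  induction p using MvPolynomial.induction_on with
  | C c =>
    refine ⟨1, (a.mem_diffKer_succ ι).2 fun x => ?_⟩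
    rw [sub_C, sub_self]
    exact Submodule.zero_mem _
  | add p q hp hq =>
    obtain ⟨m, hm⟩ := hp
    obtain ⟨n, hn⟩ := hq
    exact ⟨max m n, Submodule.add_mem _ (a.diffKer_mono ι (le_max_left m n) hm)
      (a.diffKer_mono ι (le_max_right m n) hn)⟩
  | mul_X p i hp =>
    obtain ⟨n, hn⟩ := hp
    exact ⟨n + 1, a.mul_X_mem_diffKer ι hlin i n p hn⟩

/-- The restriction of the representation on polynomials to the lattice. -/
abbrev latRep : Representation ℂ (Multiplicative Y) (MvPolynomial (Fin r) ℂ) :=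
  (a.polyRep ψ).comp ι

/-- The polynomials as a module over the group ring of the lattice. -/
abbrev polyMod : Type := Representation.asModule (latRep a ψ ι)

variable {a ψ ι}

theorem single_smul_polyMod (x : Multiplicative Y) (c : ℂ) (p : polyMod a ψ ι) :
    (latRep a ψ ι).asModuleEquiv (MonoidAlgebra.single x c • p) =
      c • (ψ (ι x) : ℂ) • a.sub (ι x) ((latRep a ψ ι).asModuleEquiv p) := by
  rw [Representation.single_smul]
  rfl

/-- For `f = ∑ c_x x` in the ideal, `∑ c_x ψ(x) = 0`; so `p` may be subtracted from each of its
translates, and `f • p` becomes a combination of differences of `p`. -/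
theorem smul_mem_diffKer {n : ℕ} {f : MonoidAlgebra ℂ (Multiplicative Y)}
    (hf : f ∈ vanishingIdeal (ψ.comp ι)) {p : polyMod a ψ ι}
    (hp : (latRep a ψ ι).asModuleEquiv p ∈ a.diffKer ι (n + 1)) :
    (latRep a ψ ι).asModuleEquiv (f • p) ∈ a.diffKer ι n := by
  have hf' : f.coeff.sum (fun x c => c * (ψ (ι x) : ℂ)) = 0 := by
    have h := (RingHom.mem_ker).1 hf
    rw [evalAt, MonoidAlgebra.lift_apply] at h
    exact h
  have h1 : (latRep a ψ ι).asModuleEquiv (f • p) = f.coeff.sum fun x c =>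
      (c * (ψ (ι x) : ℂ)) • (a.sub (ι x) ((latRep a ψ ι).asModuleEquiv p) -
        (latRep a ψ ι).asModuleEquiv p) := by
    have h2 : (latRep a ψ ι).asModuleEquiv (f • p) = f.coeff.sum fun x c =>
        c • (ψ (ι x) : ℂ) • a.sub (ι x) ((latRep a ψ ι).asModuleEquiv p) := by
      rw [Representation.asModuleEquiv_map_smul, Representation.asAlgebraHom_def,
        MonoidAlgebra.lift_apply, Finsupp.sum, LinearMap.sum_apply]
      rfl
    have h3 : f.coeff.sum (fun x c => (c * (ψ (ι x) : ℂ)) • (latRep a ψ ι).asModuleEquiv p) = 0 := by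
      rw [Finsupp.sum, ← Finset.sum_smul]
      exact (congrArg (· • _) hf').trans (zero_smul _ _)
    rw [h2, ← sub_zero (f.coeff.sum _), ← h3]
    simp only [Finsupp.sum, ← Finset.sum_sub_distrib, smul_sub, mul_smul]
  rw [h1]
  exact Submodule.sum_mem _ fun x _ => Submodule.smul_mem _ _ ((a.mem_diffKer_succ ι).1 hp _)

theorem pow_smul_eq_zero {n : ℕ} : ∀ {f : MonoidAlgebra ℂ (Multiplicative Y)}
    (_ : f ∈ vanishingIdeal (ψ.comp ι) ^ n) {p : polyMod a ψ ι}
    (_ : (latRep a ψ ι).asModuleEquiv p ∈ a.diffKer ι n), f • p = 0 := by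
  induction n with
  | zero =>
    intro f _ p hp
    have : p = 0 := (((latRep a ψ ι).asModuleEquiv).map_eq_zero_iff).1
      ((Submodule.mem_bot ℂ).1 hp)
    rw [this, smul_zero]
  | succ n ih =>
    intro f hf p hp
    rw [pow_succ] at hf
    refine Submodule.mul_induction_on hf ?_ ?_
    · intro g hg m hm
      rw [mul_smul]
      exact ih hg (smul_mem_diffKer hm hp)
    · intro g h hg hh
      rw [add_smul, hg, hh, add_zero]

/-- The pairing is `(f,p) ↦ (f • p)(0)`, where `x` returns, up to its character, the value of `p` at
the translation by `x`. It is nondegenerate because lattice points are Zariski dense, and it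
represents the required functionals because these are polynomial in `x`. The map `L` changes to
lattice coordinates. -/
theorem baer_polyMod (b : Module.Basis (Fin r) ℤ Y) (hlin : ∀ i x, a.lin i (ι x) = 1)
    (L : (Fin r → ℂ) ≃ₗ[ℂ] (Fin r → ℂ))
    (hL : ∀ x, L (fun i => a.shift i (ι (Multiplicative.ofAdd x))) =
      fun i => ((b.repr x i : ℤ) : ℂ)) :
    Module.Baer (MonoidAlgebra ℂ (Multiplicative Y)) (polyMod a ψ ι) := by
  have : Module.Finite ℤ Y := Module.Finite.of_basis b
  have : AddGroup.FG Y := Module.Finite.iff_addGroup_fg.1 inferInstance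
  have : IsNoetherianRing (MonoidAlgebra ℂ (Multiplicative Y)) :=
    Algebra.FiniteType.isNoetherianRing ℂ _
  let ev : polyMod a ψ ι →ₗ[ℂ] ℂ :=
    (aeval (0 : Fin r → ℂ)).toLinearMap ∘ₗ ((latRep a ψ ι).asModuleEquiv).toLinearMap
  have hev : ∀ x c p, ev (MonoidAlgebra.single (Multiplicative.ofAdd x) c • p) =
      c * (ψ (ι (Multiplicative.ofAdd x)) *
        eval (L.symm fun i => ((b.repr x i : ℤ) : ℂ)) ((latRep a ψ ι).asModuleEquiv p)) := by
    intro x c p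
    change eval 0 ((latRep a ψ ι).asModuleEquiv (_ • p)) = _
    rw [single_smul_polyMod, smul_eval, smul_eval, eval_sub, ← hL x, L.symm_apply_apply]
    simp
  refine baer_of_torsion (vanishingIdeal (ψ.comp ι)) ?_ ev ?_ ?_
  · intro p
    obtain ⟨n, hn⟩ := a.exists_mem_diffKer ι hlin ((latRep a ψ ι).asModuleEquiv p)
    exact ⟨n, fun f hf => pow_smul_eq_zero hf hn⟩
  · intro p hp
    refine (((latRep a ψ ι).asModuleEquiv).map_eq_zero_iff).1 ?_
    have h0 : linSub (L.symm : (Fin r → ℂ) →ₗ[ℂ] (Fin r → ℂ))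
        ((latRep a ψ ι).asModuleEquiv p) = 0 := by
      refine eq_zero_of_eval_int fun k => ?_
      have h := hp (MonoidAlgebra.single (Multiplicative.ofAdd (b.equivFun.symm k)) 1)
      rw [hev, one_mul] at h
      have hk : ∀ i, b.repr (b.equivFun.symm k) i = k i := fun i =>
        congrFun (b.equivFun.apply_symm_apply k) i
      simp only [hk] at h
      rw [eval_linSub]
      exact (mul_eq_zero.1 h).resolve_left (Units.ne_zero _)
    refine MvPolynomial.funext fun v => ?_
    have h1 := eval_linSub (L.symm : (Fin r → ℂ) →ₗ[ℂ] (Fin r → ℂ))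
      ((latRep a ψ ι).asModuleEquiv p) (L v)
    rw [h0, map_zero, LinearEquiv.coe_coe, L.symm_apply_apply] at h1
    rw [← h1, map_zero]
  · intro n l hl
    obtain ⟨P, hP⟩ := exists_polynomial_of_vanishing b (ψ.comp ι) l hl
    refine ⟨((latRep a ψ ι).asModuleEquiv).symm (linSub L P), fun f => ?_⟩
    induction f using MonoidAlgebra.induction_linear with
    | zero => rw [map_zero, zero_smul, map_zero]
    | add f g hf hg => rw [map_add, hf, hg, add_smul, map_add]
    | single x c =>
      obtain ⟨x, rfl⟩ := Multiplicative.ofAdd.surjective x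
      rw [hev, LinearEquiv.apply_symm_apply, eval_linSub, LinearEquiv.coe_coe,
        L.apply_symm_apply]
      have : MonoidAlgebra.single (Multiplicative.ofAdd x) c =
          c • MonoidAlgebra.single (Multiplicative.ofAdd x) (1 : ℂ) := by simp
      rw [this, map_smul, hP, smul_eq_mul]
      rfl

end AffineAction

/-! ### Injectivity over an extension by a finite group -/

section Averaging

variable {A C K : Type} [CommGroup A] [Group C] [Finite C] [Group K]

/-- A representation of an extension of a finite group by an abelian group is injective if its
restriction to the abelian group is an injective module over the group ring. -/
theorem injective_of_baer (ι : A →* K) (κ : C →* K)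
    (hconj : ∀ c x, ∃ y, κ c * ι x = ι y * κ c) (hgen : ∀ k, ∃ x c, k = ι x * κ c)
    (V : Rep.{0} ℂ K) (hV : Module.Baer (MonoidAlgebra ℂ A)
      (Representation.asModule (V.ρ.comp ι))) : Injective V where
  factors {Y Z} g f _ := by
    have : Fintype C := Fintype.ofFinite C
    have hC : (Fintype.card C : ℂ) ≠ 0 := Nat.cast_ne_zero.2 Fintype.card_ne_zero
    have hf : Function.Injective f.hom.toLinearMap := (Rep.mono_iff_injective f).1 inferInstance
    let restrict {U W : Rep.{0} ℂ K} (u : U ⟶ W) :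
        Representation.IntertwiningMap (U.ρ.comp ι) (W.ρ.comp ι) :=
      ⟨u.hom.toLinearMap, fun x => u.hom.isIntertwining' (ι x)⟩
    obtain ⟨h₀, hh₀⟩ := hV.injective.out
      (Representation.IntertwiningMap.equivLinearMapAsModule _ _ (restrict f)) hf
      (Representation.IntertwiningMap.equivLinearMapAsModule _ _ (restrict g))
    let h : Representation.IntertwiningMap (Z.ρ.comp ι) (V.ρ.comp ι) :=
      (Representation.IntertwiningMap.equivLinearMapAsModule _ _).symm h₀
    have hh : ∀ y, h.toLinearMap (f.hom.toLinearMap y) = g.hom.toLinearMap y := hh₀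
    have hι : ∀ x z, h.toLinearMap (Z.ρ (ι x) z) = V.ρ (ι x) (h.toLinearMap z) :=
      fun x z => DFunLike.congr_fun (h.isIntertwining' x) z
    -- The extension of `g` is so far equivariant for `A` only. Averaging over `C` keeps this, since
    -- `C` normalises the image of `A`, and does not change values on the image of `f`, where
    -- equivariance holds already.
    let avg : Z →ₗ[ℂ] V := (Fintype.card C : ℂ)⁻¹ •
      ∑ c : C, V.ρ (κ c) ∘ₗ h.toLinearMap ∘ₗ Z.ρ (κ c⁻¹)
    have havg : ∀ z, avg z = (Fintype.card C : ℂ)⁻¹ •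
        ∑ c : C, V.ρ (κ c) (h.toLinearMap (Z.ρ (κ c⁻¹) z)) := fun z => by
      simp [avg]
    have h1 : ∀ x z, avg (Z.ρ (ι x) z) = V.ρ (ι x) (avg z) := by
      intro x z
      rw [havg, havg, map_smul, map_sum]
      congr 1
      refine Finset.sum_congr rfl fun c _ => ?_
      obtain ⟨y, hy⟩ := hconj c⁻¹ x
      have hy' : κ c * ι y = ι x * κ c := by
        have := congrArg (fun k => κ c * k * κ c) hy
        simpa [mul_assoc, ← map_mul] using this.symm
      rw [← Module.End.mul_apply (Z.ρ _), ← map_mul, hy, map_mul, Module.End.mul_apply, hι,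
        ← Module.End.mul_apply (V.ρ _) (V.ρ _), ← map_mul, hy', map_mul, Module.End.mul_apply]
    have h2 : ∀ d z, avg (Z.ρ (κ d) z) = V.ρ (κ d) (avg z) := by
      intro d z
      rw [havg, havg, map_smul, map_sum]
      congr 1
      rw [← Equiv.sum_comp (Equiv.mulLeft d)]
      refine Finset.sum_congr rfl fun c _ => ?_
      rw [Equiv.coe_mulLeft, ← Module.End.mul_apply (Z.ρ _), ← map_mul, ← map_mul, mul_inv_rev,
        inv_mul_cancel_right, map_mul κ, map_mul, Module.End.mul_apply]
    refine ⟨Rep.ofHom ⟨avg, fun k => LinearMap.ext fun z => ?_⟩, ?_⟩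
    · obtain ⟨x, c, rfl⟩ := hgen k
      rw [LinearMap.comp_apply, LinearMap.comp_apply, map_mul, map_mul, Module.End.mul_apply,
        Module.End.mul_apply, h1, h2]
    · refine Rep.hom_ext (Representation.IntertwiningMap.ext (LinearMap.ext fun y => ?_))
      change avg (f.hom.toLinearMap y) = g.hom.toLinearMap y
      rw [havg]
      have : ∀ c : C, V.ρ (κ c) (h.toLinearMap (Z.ρ (κ c⁻¹) (f.hom.toLinearMap y))) =
          g.hom.toLinearMap y := by
        intro c
        have e1 : Z.ρ (κ c⁻¹) (f.hom.toLinearMap y) = f.hom.toLinearMap (Y.ρ (κ c⁻¹) y) :=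
          (Rep.hom_comm_apply f (κ c⁻¹) y).symm
        have e2 : g.hom.toLinearMap (Y.ρ (κ c⁻¹) y) = V.ρ (κ c⁻¹) (g.hom.toLinearMap y) :=
          Rep.hom_comm_apply g (κ c⁻¹) y
        rw [e1, hh, e2, ← Module.End.mul_apply, ← map_mul, ← map_mul, mul_inv_cancel, map_one,
          map_one, Module.End.one_apply]
      rw [Finset.sum_congr rfl fun c _ => this c, Finset.sum_const, Finset.card_univ,
        ← Nat.cast_smul_eq_nsmul ℂ, smul_smul, inv_mul_cancel₀ hC, one_smul]

end Averaging

/-! ### Invariants and weight vectors among twisted polynomials -/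

namespace AffineAction

open MvPolynomial

variable {Y K : Type} [AddCommGroup Y] [Group K] {r : ℕ}

/-- The lattice acts by translations along a full lattice. -/
structure IsFull (a : AffineAction K r) (ι : Multiplicative Y →* K) : Prop where
  lin : ∀ i x, a.lin i (ι x) = 1
  coord : ∃ (b : Module.Basis (Fin r) ℤ Y) (L : (Fin r → ℂ) ≃ₗ[ℂ] (Fin r → ℂ)),
    ∀ x, L (fun i => a.shift i (ι (Multiplicative.ofAdd x))) = fun i => ((b.repr x i : ℤ) : ℂ)

variable {a : AffineAction K r} {ι : Multiplicative Y →* K} (h : a.IsFull ι)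

include h

/-- An invariant polynomial takes its value at the origin on a whole lattice, hence everywhere. -/
theorem IsFull.eq_C_of_invariant {p : MvPolynomial (Fin r) ℂ}
    (hp : ∀ x, a.sub (ι x) p = p) : p = C (coeff 0 p) := by
  obtain ⟨b, L, hL⟩ := h.coord
  have h0 : linSub (L.symm : (Fin r → ℂ) →ₗ[ℂ] (Fin r → ℂ)) (p - C (coeff 0 p)) = 0 := by
    refine eq_zero_of_eval_int fun k => ?_
    have hk : ∀ i, b.repr (b.equivFun.symm k) i = k i := fun i =>
      congrFun (b.equivFun.apply_symm_apply k) i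
    have h1 := congrArg (eval 0) (hp (Multiplicative.ofAdd (b.equivFun.symm k)))
    have h2 := hL (b.equivFun.symm k)
    simp only [hk] at h2
    rw [eval_sub] at h1
    simp only [Pi.zero_apply, mul_zero, zero_add] at h1
    rw [eval_linSub, LinearEquiv.coe_coe, ← h2, L.symm_apply_apply, map_sub, h1, eval_C,
      ← constantCoeff_eq, ← eval_zero, sub_self]
  refine sub_eq_zero.1 (MvPolynomial.funext fun v => ?_)
  have h1 := eval_linSub (L.symm : (Fin r → ℂ) →ₗ[ℂ] (Fin r → ℂ)) (p - C (coeff 0 p)) (L v)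
  rw [h0, map_zero, LinearEquiv.coe_coe, L.symm_apply_apply] at h1
  rw [← h1, map_zero]

/-- The weight vectors for the action of the lattice on twisted polynomials are constants. -/
theorem IsFull.eq_zero_or {ψ : K →* ℂˣ} {t : Multiplicative Y →* ℂˣ} {p : MvPolynomial (Fin r) ℂ}
    (hp : ∀ x, a.polyRep ψ (ι x) p = (t x : ℂ) • p) :
    p = 0 ∨ (t = ψ.comp ι ∧ p = C (coeff 0 p)) := by
  have hp' : ∀ x, a.sub (ι x) p = (((t x / ψ (ι x) : ℂˣ)) : ℂ) • p := by
    intro x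
    have := hp x
    rw [polyRep_apply] at this
    rw [Units.val_div_eq_div_val, div_eq_inv_mul, mul_smul, ← this, inv_smul_smul₀ (Units.ne_zero _)]
  by_cases ht : t = ψ.comp ι
  · refine Or.inr ⟨ht, h.eq_C_of_invariant fun x => ?_⟩
    rw [hp', ht]
    simp
  · refine Or.inl ?_
    obtain ⟨x, hx⟩ := DFunLike.ne_iff.1 ht
    have hx' : (((t x / ψ (ι x) : ℂˣ)) : ℂ) - 1 ≠ 0 := by
      rw [sub_ne_zero]
      intro h1
      exact hx (div_eq_one.1 (Units.ext h1))
    -- The difference along `x` scales `p` by a nonzero number, while enough differences kill `p`.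
    obtain ⟨n, hn⟩ := a.exists_mem_diffKer ι h.lin p
    induction n with
    | zero => exact (Submodule.mem_bot ℂ).1 hn
    | succ n ih =>
      have h2 := (a.mem_diffKer_succ ι).1 hn x
      have h3 : ∀ c : ℂ, c • p - p = (c - 1) • p := fun c => by rw [sub_smul, one_smul]
      rw [hp', h3, Submodule.smul_mem_iff _ hx'] at h2
      exact ih h2

end AffineAction

/-! ### The affine action of `⟨γ⟩ ⋉ X` on `ℂ ⊗ X` -/

section CyclicAction

open SemidirectProduct

variable {Γ X : Type} [Group Γ] [AddCommGroup X] [DistribMulAction Γ X]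

/-- The inclusion of the lattice. -/
def latIncl (H : Subgroup Γ) : Multiplicative X →* crossedSub X H :=
  (inl : Multiplicative X →* Crossed Γ X).codRestrict _ fun x => by
    simp [Subgroup.mem_comap]

/-- The projection to the finite group. -/
def finProj (H : Subgroup Γ) : crossedSub X H →* H where
  toFun w := ⟨w.1.right, w.2⟩
  map_one' := rfl
  map_mul' _ _ := rfl

/-- The inclusion of the finite group. -/
def finIncl (H : Subgroup Γ) : H →* crossedSub X H where
  toFun c := ⟨inr (c : Γ), by simp [Subgroup.mem_comap]⟩
  map_one' := Subtype.ext (map_one _)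
  map_mul' _ _ := Subtype.ext (map_mul _ _ _)

theorem finProj_latIncl (H : Subgroup Γ) (x : Multiplicative X) :
    finProj H (latIncl H x) = 1 := Subtype.ext (right_inl (φ := latticeAut Γ X) x)

theorem finProj_finIncl (H : Subgroup Γ) (c : H) : finProj (X := X) H (finIncl H c) = c :=
  Subtype.ext (right_inr (φ := latticeAut Γ X) (c : Γ))

theorem eq_latIncl_mul_finIncl (H : Subgroup Γ) (w : crossedSub X H) :
    w = latIncl H w.1.left * finIncl H (finProj H w) :=
  Subtype.ext (inl_left_mul_inr_right w.1).symm

theorem finIncl_mul_latIncl (H : Subgroup Γ) (c : H) (x : Multiplicative X) :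
    finIncl H c * latIncl H x = latIncl H (latticeAut Γ X c x) * finIncl H c := by
  refine Subtype.ext (SemidirectProduct.ext ?_ ?_)
  · change (inr (c : Γ) * inl x : Crossed Γ X).left = (inl _ * inr (c : Γ) : Crossed Γ X).left
    simp
  · change (inr (c : Γ) * inl x : Crossed Γ X).right = (inl _ * inr (c : Γ) : Crossed Γ X).right
    simp

theorem injective_polyRep [Finite Γ] {H : Subgroup Γ} {r : ℕ}
    {a : AffineAction (crossedSub X H) r} (h : a.IsFull (latIncl H)) (ψ : crossedSub X H →* ℂˣ) :
    Injective (Rep.of (a.polyRep ψ)) := by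
  obtain ⟨b, L, hL⟩ := h.coord
  have hb := AffineAction.baer_polyMod (ψ := ψ) b h.lin L hL
  exact injective_of_baer (A := Multiplicative X) (latIncl H) (finIncl H)
    (fun c x => ⟨_, finIncl_mul_latIncl H c x⟩)
    (fun w => ⟨_, _, eq_latIncl_mul_finIncl H w⟩) _ hb

/-- The generator `γ` is diagonalizable on `ℂ ⊗ X`, and eigenvectors of `γ` are eigenvectors of its
powers. In eigencoordinates the natural action of `⟨γ⟩ ⋉ X` on polynomial functions has diagonal
linear part; composing with inverses explains `c⁻¹` in the determinant. -/
theorem exists_affineAction [Finite Γ] [Module.Free ℤ X] [Module.Finite ℤ X] (γ : Γ) :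
    ∃ (r : ℕ) (a : AffineAction (crossedSub X (Subgroup.zpowers γ)) r)
      (ω : Fin r → Subgroup.zpowers γ →* ℂˣ), a.IsFull (latIncl _) ∧
      (∀ i, a.lin i = (ω i).comp (finProj _)) ∧
      ∀ c : Subgroup.zpowers γ, (ellDet X (c : Γ)⁻¹ : ℂ) = ∏ i, (1 - (ω i c : ℂ)) := by
  obtain ⟨n, hn, hγ⟩ := isOfFinOrder_iff_pow_eq_one.1 (isOfFinOrder_of_finite γ)
  let σ : Representation ℂ Γ (ℂ ⊗[ℤ] X) :=
    { toFun := fun c => (latLin c).baseChange ℂ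
      map_one' := by ext; simp [latLin_apply]
      map_mul' := fun c d => by ext; simp [latLin_apply, mul_smul] }
  obtain ⟨r, hr', v, μ, hv⟩ : ∃ r, Module.finrank ℤ X = r ∧
      ∃ (v : Module.Basis (Fin r) ℂ (ℂ ⊗[ℤ] X)) (μ : Fin r → ℂ), ∀ i, σ γ (v i) = μ i • v i :=
    ⟨_, Module.finrank_baseChange.symm,
      exists_eigenbasis (σ γ) hn (by rw [← map_pow, hγ, map_one])⟩
  let b : Module.Basis (Fin r) ℤ X := (Module.finBasis ℤ X).reindex (finCongr hr')
  have hstab : ∀ i (c : Subgroup.zpowers γ), ∃ m : ℂ, σ c (v i) = m • v i := by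
    rintro i ⟨c, hc⟩
    obtain ⟨k, rfl⟩ := (mem_powers_iff_mem_zpowers.2 hc)
    refine ⟨μ i ^ k, ?_⟩
    change σ (γ ^ k) (v i) = _
    rw [map_pow]
    clear hc
    induction k with
    | zero => simp
    | succ k ih =>
      rw [pow_succ', Module.End.mul_apply, ih, map_smul, hv, smul_smul, pow_succ]
  choose m hm using hstab
  have hm1 : ∀ i, m i 1 = 1 := fun i => by
    have := hm i 1
    rw [Subgroup.coe_one, map_one, Module.End.one_apply] at this
    exact (smul_left_injective ℂ (v.ne_zero i) (by simpa using this)).symm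
  have hmm : ∀ i c d, m i (c * d) = m i c * m i d := fun i c d => by
    have := hm i (c * d)
    rw [Subgroup.coe_mul, map_mul, Module.End.mul_apply, hm i d, map_smul, hm i c, smul_smul] at this
    exact (smul_left_injective ℂ (v.ne_zero i) this).symm.trans (mul_comm _ _)
  let χ : Fin r → Subgroup.zpowers γ →* ℂˣ := fun i =>
    MonoidHom.toHomUnits { toFun := m i, map_one' := hm1 i, map_mul' := hmm i }
  have hχ : ∀ i c, (χ i c : ℂ) = m i c := fun i c => rfl
  have hz : ∀ i (c : Subgroup.zpowers γ) (e : ℂ ⊗[ℤ] X),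
      v.repr (σ c e) i = χ i c * v.repr e i := by
    intro i c e
    have : v.coord i ∘ₗ σ c = (χ i c : ℂ) • v.coord i := by
      refine v.ext fun j => ?_
      rw [LinearMap.comp_apply, hm, map_smul, LinearMap.smul_apply, v.coord_apply, v.repr_self,
        Finsupp.single_apply]
      split_ifs with hij
      · subst hij
        rw [hχ]
      · simp
    exact DFunLike.congr_fun this e
  let z : Fin r → Multiplicative X →  ℂ := fun i y => v.repr ((1 : ℂ) ⊗ₜ[ℤ] y.toAdd) i
  have hz1 : ∀ i x y, z i (x * y) = z i x + z i y := fun i x y => by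
    simp only [z, toAdd_mul, TensorProduct.tmul_add, map_add, Finsupp.add_apply]
  have hz2 : ∀ i (c : Subgroup.zpowers γ) x, z i (latticeAut Γ X c x) = χ i c * z i x :=
    fun i c x => hz i c ((1 : ℂ) ⊗ₜ[ℤ] x.toAdd)
  -- For `w = yc` one has `w⁻¹e = c⁻¹(e - y)`, with `i`-th coordinate `χ_i(c)⁻¹ (e_i - z_i(y))`.
  let a : AffineAction (crossedSub X (Subgroup.zpowers γ)) r :=
    { lin := fun i => (χ i)⁻¹.comp (finProj _)
      shift := fun i w => - ((χ i)⁻¹ (finProj _ w) * z i w.1.left)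
      shift_mul := fun i w w' => by
        have h1 : (w * w').1.left = w.1.left * latticeAut Γ X (finProj _ w) w'.1.left := rfl
        rw [h1, hz1, hz2, map_mul, map_mul, MonoidHom.comp_apply]
        simp only [MonoidHom.inv_apply, Units.val_mul, Units.val_inv_eq_inv_val]
        field_simp
        ring }
  refine ⟨r, a, fun i => (χ i)⁻¹, ⟨fun i x => ?_, b, ?_, fun x => ?_⟩, fun i => rfl, fun c => ?_⟩
  · change (χ i)⁻¹ (finProj _ (latIncl _ x)) = 1
    rw [finProj_latIncl, map_one]
  -- Undoes the sign of the translations and passes from eigencoordinates to coordinates in a basis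
  -- of `X`.
  · exact v.equivFun.symm ≪≫ₗ LinearEquiv.neg ℂ ≪≫ₗ (b.baseChange ℂ).equivFun
  · have h1 : (fun i => a.shift i (latIncl _ (Multiplicative.ofAdd x))) =
        v.equivFun (-((1 : ℂ) ⊗ₜ[ℤ] x)) := by
      funext i
      change - (((χ i)⁻¹ (finProj _ (latIncl _ (Multiplicative.ofAdd x))) : ℂˣ) *
        v.repr ((1 : ℂ) ⊗ₜ[ℤ] x) i) = v.repr (-((1 : ℂ) ⊗ₜ[ℤ] x)) i
      rw [finProj_latIncl, map_one, Units.val_one, one_mul, map_neg, Finsupp.neg_apply]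
    rw [h1]
    simp only [LinearEquiv.trans_apply, LinearEquiv.symm_apply_apply, LinearEquiv.neg_apply, neg_neg]
    funext i
    simp [Module.Basis.baseChange_repr_tmul]
  · have h1 : σ (c⁻¹ : Subgroup.zpowers γ) = (latLin (c : Γ)⁻¹).baseChange ℂ := rfl
    rw [← det_one_sub_of_eigenbasis v (T := σ (c⁻¹ : Subgroup.zpowers γ)) fun i => ?_]
    · rw [ellDet, h1]
      have h2 : (1 - (latLin (c : Γ)⁻¹).baseChange ℂ : ℂ ⊗[ℤ] X →ₗ[ℂ] ℂ ⊗[ℤ] X) =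
          (1 - latLin (c : Γ)⁻¹ : X →ₗ[ℤ] X).baseChange ℂ := by
        rw [LinearMap.baseChange_sub]
        congr 1
        exact (LinearMap.baseChange_id).symm
      rw [h2, LinearMap.det_baseChange]
      simp
    · rw [hm, ← hχ, map_inv]
      rfl

end CyclicAction

/-! ### Homomorphisms into twisted polynomials -/

section HomPoly

open SemidirectProduct MvPolynomial

variable {Γ X : Type} [Group Γ] [AddCommGroup X] [DistribMulAction Γ X]
  {U : Rep.{0} ℂ (Crossed Γ X)} {C : Subgroup Γ} {s : Torus X} (hle : C ≤ stab Γ s) (χ : C →* ℂˣ)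
  {r : ℕ} {a : AffineAction (crossedSub X C) r} (h : a.IsFull (latIncl C))

theorem twistChar_comp_latIncl : (twistChar hle χ).comp (latIncl C) = s := by
  refine MonoidHom.ext fun x => ?_
  have h1 : twistChar hle χ (latIncl C x) = s x * χ (finProj C (latIncl C x)) := rfl
  rw [MonoidHom.comp_apply, h1, finProj_latIncl, map_one, mul_one]

theorem twistChar_finIncl (c : C) : twistChar hle χ (finIncl C c) = χ c := by
  have h1 : twistChar hle χ (finIncl C c) = s 1 * χ (finProj (X := X) C (finIncl C c)) := rfl
  rw [h1, finProj_finIncl, map_one, one_mul]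

variable (U a) in
/-- The intertwining maps to twisted polynomials. -/
abbrev PolyHom : Type :=
  Representation.IntertwiningMap (U.ρ.comp (crossedSub X C).subtype) (a.polyRep (twistChar hle χ))

variable {hle χ}

theorem polyHom_comm (f : PolyHom U hle χ a) (w : crossedSub X C) (v : U) :
    f.toLinearMap (U.ρ w v) = a.polyRep (twistChar hle χ) w (f.toLinearMap v) :=
  DFunLike.congr_fun (f.isIntertwining' w) v

include h

theorem polyHom_weight (f : PolyHom U hle χ a) {t : Torus X} {v : U} (hv : v ∈ weightSpace U t) :
    f.toLinearMap v = 0 ∨ (t = s ∧ f.toLinearMap v = MvPolynomial.C (coeff 0 (f.toLinearMap v))) := by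
  have := h.eq_zero_or (ψ := twistChar hle χ) (t := t) (p := f.toLinearMap v) fun x => by
    rw [← polyHom_comm f (latIncl C x) v, ← map_smul]
    exact congrArg _ (hv x)
  rwa [twistChar_comp_latIncl] at this

theorem polyHom_eq_C (f : PolyHom U hle χ a) {v : U} (hv : v ∈ weightSpace U s) :
    f.toLinearMap v = MvPolynomial.C (coeff 0 (f.toLinearMap v)) := by
  rcases polyHom_weight h f hv with h0 | h0
  · rw [h0, coeff_zero, map_zero]
  · exact h0.2

/-- An equivariant map to twisted polynomials is determined by its constant values on a weight
space. -/
def polyHomRestrict : PolyHom U hle χ a →ₗ[ℂ]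
    Representation.IntertwiningMap ((weightRep U s).comp (Subgroup.inclusion hle)) (charHom χ) where
  toFun f := ⟨lcoeff ℂ 0 ∘ₗ f.toLinearMap ∘ₗ (weightSpace U s).subtype, fun c => by
    refine LinearMap.ext fun v => ?_
    change coeff 0 (f.toLinearMap (U.ρ (finIncl (X := X) C c : crossedSub X C).1 v)) = (χ c : ℂ) * coeff 0 (f.toLinearMap v)
    rw [polyHom_comm, polyHom_eq_C h f v.2, AffineAction.polyRep_apply, twistChar_finIncl,
      AffineAction.sub_C, coeff_smul, smul_eq_mul]⟩
  map_add' f g := Representation.IntertwiningMap.ext rfl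
  map_smul' c f := Representation.IntertwiningMap.ext rfl

theorem polyHomRestrict_apply (f : PolyHom U hle χ a) (v : weightSpace U s) :
    (polyHomRestrict h f).toLinearMap v = coeff 0 (f.toLinearMap v) := rfl

variable {ι : Type*} (b : Module.Basis ι ℂ U) {σ : ι → Torus X}
  (hb : ∀ i, b i ∈ weightSpace U (σ i))

include hb

/-- Weight vectors go to weight vectors, which among twisted polynomials are only the constants, of
weight `s`. So a homomorphism vanishes on the other weights and is constant-valued on the weight
`s`. -/
theorem polyHomRestrict_injective :
    Function.Injective (polyHomRestrict h (hle := hle) (χ := χ) (U := U)) := by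
  rw [← LinearMap.ker_eq_bot, LinearMap.ker_eq_bot']
  intro f hf
  refine Representation.IntertwiningMap.ext (b.ext fun i => ?_)
  rcases polyHom_weight h f (hb i) with h0 | ⟨h1, h2⟩
  · exact h0
  · have h3 : b i ∈ weightSpace U s := h1 ▸ hb i
    rw [h2, ← polyHomRestrict_apply h f ⟨b i, h3⟩, hf]
    exact map_zero MvPolynomial.C

variable [Fintype ι]

/-- Extend a given functional by zero on the other weight spaces and regard its values as constant
polynomials. Since `C` fixes `s`, it permutes the other weights, which gives equivariance. -/
theorem polyHomRestrict_surjective :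
    Function.Surjective (polyHomRestrict h (hle := hle) (χ := χ) (U := U)) := by
  classical
  intro g
  let p : ι → ℂ := fun i => if hi : σ i = s then g.toLinearMap ⟨b i, hi ▸ hb i⟩ else 0
  let l : U →ₗ[ℂ] ℂ := b.constr ℂ p
  have hl : ∀ v : weightSpace U s, l v = g.toLinearMap v := by
    intro v
    have h1 : (v : U) = ∑ i, b.coord i v • b i := (b.sum_repr v).symm
    have h2 : v = ∑ i, b.coord i v • (if hi : σ i = s then (⟨b i, hi ▸ hb i⟩ : weightSpace U s)
        else 0) := by
      refine Subtype.ext ?_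
      rw [Submodule.coe_sum]
      conv_lhs => rw [h1]
      refine Finset.sum_congr rfl fun i _ => ?_
      by_cases hi : σ i = s
      · rw [dif_pos hi]
        rfl
      · rw [coord_eq_zero b hb v.2 hi, zero_smul, zero_smul]
        rfl
    conv_rhs => rw [h2]
    conv_lhs => rw [h1]
    rw [map_sum, map_sum]
    refine Finset.sum_congr rfl fun i _ => ?_
    rw [map_smul, map_smul, b.constr_basis]
    by_cases hi : σ i = s
    · simp only [p, dif_pos hi]
    · simp only [p, dif_neg hi, map_zero]
  have hl0 : ∀ {t} {v : U}, v ∈ weightSpace U t → t ≠ s → l v = 0 := by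
    intro t v hv ht
    rw [← b.sum_repr v, map_sum]
    refine Finset.sum_eq_zero fun i _ => ?_
    rw [map_smul, b.constr_basis]
    by_cases hi : σ i = s
    · have := coord_eq_zero b hb hv (i := i) (by rw [hi]; exact ht.symm)
      rw [b.coord_apply] at this
      rw [this, zero_smul]
    · simp only [p, dif_neg hi, smul_zero]
  have hinl : ∀ x v, l (U.ρ (inl x) v) = (s x : ℂ) * l v := by
    intro x
    have : l ∘ₗ U.ρ (inl x) = (s x : ℂ) • l := by
      refine b.ext fun i => ?_
      rw [LinearMap.comp_apply, hb i x, map_smul, LinearMap.smul_apply]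
      by_cases hi : σ i = s
      · rw [hi]
      · rw [hl0 (hb i) hi, smul_zero, smul_zero]
    exact fun v => DFunLike.congr_fun this v
  have hinr : ∀ (c : C) v, l (U.ρ (inr (c : Γ)) v) = (χ c : ℂ) * l v := by
    intro c
    have : l ∘ₗ U.ρ (inr (c : Γ)) = (χ c : ℂ) • l := by
      refine b.ext fun i => ?_
      rw [LinearMap.comp_apply, LinearMap.smul_apply]
      have h1 := inr_mem_weightSpace (hb i) (c : Γ)
      by_cases hi : σ i = s
      · have h2 : b i ∈ weightSpace U s := hi ▸ hb i
        have h3 := DFunLike.congr_fun (g.isIntertwining' c) ⟨b i, h2⟩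
        rw [hl ⟨b i, h2⟩]
        refine Eq.trans ?_ h3
        exact hl (weightRep U s (Subgroup.inclusion hle c) ⟨b i, h2⟩)
      · have hm : moveT (c : Γ) (σ i) ≠ s := by
          intro hm
          have hs := mem_stab_iff.1 (hle c.2)
          exact hi (moveT_injective (c : Γ) (hm.trans hs.symm))
        rw [hl0 h1 hm, hl0 (hb i) hi, smul_zero]
    exact fun v => DFunLike.congr_fun this v
  refine ⟨⟨(Algebra.linearMap ℂ (MvPolynomial (Fin r) ℂ)) ∘ₗ l, fun w => LinearMap.ext fun v => ?_⟩, ?_⟩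
  · change MvPolynomial.C (l (U.ρ w.1 v)) = a.polyRep _ w (MvPolynomial.C (l v))
    rw [AffineAction.polyRep_apply, AffineAction.sub_C, smul_eq_C_mul, ← map_mul]
    congr 1
    rw [← inl_left_mul_inr_right w.1, map_mul, Module.End.mul_apply, hinl]
    have := hinr (finProj C w) v
    rw [show inr w.1.right = (inr ((finProj C w : C) : Γ) : Crossed Γ X) from rfl, this,
      twistChar_apply, Units.val_mul, mul_assoc]
    rfl
  · refine Representation.IntertwiningMap.ext (LinearMap.ext fun v => ?_)
    rw [polyHomRestrict_apply, ← hl v]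
    exact coeff_zero_C _

end HomPoly

section HomPolyDim

open SemidirectProduct

variable {Γ X : Type} [Group Γ] [Finite Γ] [AddCommGroup X] [DistribMulAction Γ X]
  {C : Subgroup Γ} [Fintype C] {s : Torus X} (hle : C ≤ stab Γ s) (χ : C →* ℂˣ)
  {r : ℕ} {a : AffineAction (crossedSub X C) r} (h : a.IsFull (latIncl C))

include h

/-- The space is `Hom_C(U_s, χ)`, where `U_s` has as character the coefficients of `U` at `s`. -/
theorem finrank_polyHom {U : FinRep (Crossed Γ X)} (hU : U.1.ρ.IsIrreducible) :
    Module.Finite ℂ (PolyHom U.1 hle χ a) ∧ (Module.finrank ℂ (PolyHom U.1 hle χ a) : ℂ) =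
      (Nat.card C : ℂ)⁻¹ * ∑ c : C, coefGC ((c : Γ)⁻¹) (cls U) s * χ c := by
  have := U.2
  obtain ⟨b, σ, hb⟩ := exists_weight_basis (V := U.1) hU
  let e := LinearEquiv.ofBijective (polyHomRestrict h (hle := hle) (χ := χ) (U := U.1))
    ⟨polyHomRestrict_injective h b hb, polyHomRestrict_surjective h b hb⟩
  have hfin : Module.Finite ℂ (Representation.IntertwiningMap
      ((weightRep U.1 s).comp (Subgroup.inclusion hle)) (charHom χ)) :=
    Module.Finite.of_injective
      ({ toFun := fun f => f.toLinearMap, map_add' := fun _ _ => rfl, map_smul' := fun _ _ => rfl } :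
        Representation.IntertwiningMap ((weightRep U.1 s).comp (Subgroup.inclusion hle))
          (charHom χ) →ₗ[ℂ] weightSpace U.1 s →ₗ[ℂ] ℂ)
      (fun _ _ hfg => Representation.IntertwiningMap.ext hfg)
  refine ⟨Module.Finite.equiv e.symm, ?_⟩
  have hC : (Nat.card C : ℂ) ≠ 0 := by exact_mod_cast Nat.card_pos.ne'
  have : Invertible (Nat.card C : ℂ) := invertibleOfNonzero hC
  rw [e.finrank_eq, ← Representation.card_inv_mul_sum_char_mul_char_eq_finrank]
  congr 1
  refine Finset.sum_congr rfl fun c _ => ?_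
  rw [character_charHom, mul_comm]
  congr 1
  exact (coefGC_cls_irreducible hU (Subgroup.inclusion hle c⁻¹)).symm

end HomPolyDim

/-! ### Induction of injectives and Frobenius reciprocity -/

section InducedInjective

variable {G : Type} [Group G] {S : Subgroup G} [S.FiniteIndex]

/-- In finite index `Ind` is also right adjoint to restriction, which preserves monomorphisms. -/
instance injective_indF (N : Rep.{0} ℂ S) [Injective N] : Injective ((indF S).obj N) := by
  classical
  have : (Rep.resFunctor.{0} (k := ℂ) S.subtype).IsRightAdjoint :=
    (Rep.indResAdjunction.{0} ℂ S.subtype).isRightAdjoint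
  exact Injective.injective_of_adjoint (Rep.resIndAdjunction.{0} ℂ S) N

open scoped Classical in
/-- Frobenius reciprocity. -/
def indHomEquiv (U : Rep.{0} ℂ G) (N : Rep.{0} ℂ S) :
    (U ⟶ (indF S).obj N) ≃ₗ[ℂ] Representation.IntertwiningMap (U.ρ.comp S.subtype) N.ρ :=
  Linear.homCongr ℂ (Iso.refl U) (Rep.indCoindIso.{0} N) ≪≫ₗ
    (Rep.resCoindHomEquiv.{0} S.subtype U N).symm ≪≫ₗ Rep.homLinearEquiv _ _

theorem hom_injective_additive {S : ShortComplex (Rep.{0} ℂ G)} (hS : S.ShortExact)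
    (I : Rep.{0} ℂ G) [Injective I] (h₁ : Module.Finite ℂ (S.X₁ ⟶ I))
    (h₃ : Module.Finite ℂ (S.X₃ ⟶ I)) : Module.Finite ℂ (S.X₂ ⟶ I) ∧
      Module.finrank ℂ (S.X₂ ⟶ I) = Module.finrank ℂ (S.X₁ ⟶ I) + Module.finrank ℂ (S.X₃ ⟶ I) := by
  have := hS.mono_f
  have := hS.epi_g
  have hex : Function.Exact (Linear.leftComp ℂ I S.g) (Linear.leftComp ℂ I S.f) := by
    intro k
    constructor
    · exact fun hk => ⟨hS.exact.desc k hk, hS.exact.g_desc k hk⟩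
    · rintro ⟨l, rfl⟩
      change S.f ≫ S.g ≫ l = 0
      rw [← Category.assoc, S.zero, Limits.zero_comp]
  have hinj : Function.Injective (Linear.leftComp ℂ I S.g) := fun k l hkl =>
    (cancel_epi S.g).1 hkl
  have hsurj : Function.Surjective (Linear.leftComp ℂ I S.f) := fun k =>
    ⟨Injective.factorThru k S.f, Injective.comp_factorThru k S.f⟩
  have h₂ := finite_of_exact hex
  refine ⟨h₂, ?_⟩
  rw [finrank_eq_of_exact hex, LinearMap.finrank_range_of_inj hinj,
    LinearMap.range_eq_top.2 hsurj, finrank_top, add_comm]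

end InducedInjective

section Congruence

variable {G : Type} [Group G]

theorem EP_congr_right (U : Rep.{0} ℂ G) {V W : Rep.{0} ℂ G} (e : V ≅ W) : EP U V = EP U W := by
  refine finsum_congr fun n => ?_
  have key : ∀ {V W : Rep.{0} ℂ G} (e : V ≅ W),
      ((Abelian.Ext.mk₀ e.hom).postcompOfLinear ℂ U (add_zero n)) ∘ₗ
        ((Abelian.Ext.mk₀ e.inv).postcompOfLinear ℂ U (add_zero n)) = LinearMap.id := by
    intro V W e
    refine LinearMap.ext fun x => ?_
    change (x.comp (Abelian.Ext.mk₀ e.inv) (add_zero n)).comp (Abelian.Ext.mk₀ e.hom)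
      (add_zero n) = x
    rw [Abelian.Ext.comp_assoc_of_third_deg_zero, Abelian.Ext.mk₀_comp_mk₀, e.inv_hom_id,
      Abelian.Ext.comp_mk₀_id]
  rw [(LinearEquiv.ofLinearMap _ _ (key e) (key e.symm)).finrank_eq]

end Congruence

/-! ### Euler–Poincaré characteristics along the tower -/

section EulerPoincare

variable {Γ X : Type} [Group Γ] [Finite Γ] [AddCommGroup X] [DistribMulAction Γ X]
  {C : Subgroup Γ} [Fintype C] {s : Torus X} (hle : C ≤ stab Γ s)
  {r : ℕ} {a : AffineAction (crossedSub X C) r} (h : a.IsFull (latIncl C))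

include h

/-- The formula was computed for irreducible `U`. Both sides are additive in `U`, the left one
because the target is injective, so dévissage covers all `U`. -/
theorem finrank_hom_indF_polyRep (χ : C →* ℂˣ) (U : FinRep (Crossed Γ X)) :
    Module.Finite ℂ (U.1 ⟶ (indF (crossedSub X C)).obj (Rep.of (a.polyRep (twistChar hle χ)))) ∧
    (Module.finrank ℂ (U.1 ⟶ (indF (crossedSub X C)).obj
      (Rep.of (a.polyRep (twistChar hle χ)))) : ℂ) =
      (Nat.card C : ℂ)⁻¹ * ∑ c : C, coefGC ((c : Γ)⁻¹) (cls U) s * χ c := by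
  have := injective_polyRep h (twistChar hle χ)
  refine FinRep.devissage (P := fun U => Module.Finite ℂ
      (U.1 ⟶ (indF (crossedSub X C)).obj (Rep.of (a.polyRep (twistChar hle χ)))) ∧
    (Module.finrank ℂ (U.1 ⟶ (indF (crossedSub X C)).obj
      (Rep.of (a.polyRep (twistChar hle χ)))) : ℂ) =
      (Nat.card C : ℂ)⁻¹ * ∑ c : C, coefGC ((c : Γ)⁻¹) (cls U) s * χ c) ?_ ?_ ?_ U
  · intro U hU
    have : Subsingleton (U.1 ⟶ (indF (crossedSub X C)).obj
        (Rep.of (a.polyRep (twistChar hle χ)))) :=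
      ⟨fun f g => Rep.hom_ext (Representation.IntertwiningMap.ext (LinearMap.ext fun v => by
        rw [Subsingleton.elim v 0, map_zero, map_zero]))⟩
    refine ⟨inferInstance, ?_⟩
    rw [Module.finrank_zero_of_subsingleton, cls_eq_zero U hU]
    simp
  · intro U hU
    obtain ⟨h1, h2⟩ := finrank_polyHom hle χ h hU
    let e := indHomEquiv U.1 (Rep.of (a.polyRep (twistChar hle χ)))
    exact ⟨Module.Finite.equiv e.symm, by rw [← h2, e.finrank_eq]⟩
  · rintro S h₁ h₂ h₃ hS ⟨f1, e1⟩ ⟨f3, e3⟩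
    obtain ⟨f2, e2⟩ := hom_injective_additive hS
      ((indF (crossedSub X C)).obj (Rep.of (a.polyRep (twistChar hle χ)))) f1 f3
    refine ⟨f2, ?_⟩
    rw [e2, Nat.cast_add, e1, e3, cls_eq_add hS h₁ h₂ h₃, ← mul_add, ← Finset.sum_add_distrib]
    congr 1
    refine Finset.sum_congr rfl fun c _ => ?_
    rw [map_add, Finsupp.add_apply, add_mul]

/-- Adding `j` to `T` subtracts the value for the twist by `ω_j`, i.e. inserts the factor `1 -
ω_j(c)`. The twist changes `χ`, so the induction is uniform in `χ`. -/
theorem EP_indF_tower {ω : Fin r → C →* ℂˣ} (hω : ∀ i, a.lin i = (ω i).comp (finProj C))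
    (U : FinRep (Crossed Γ X)) (T : Finset (Fin r)) : ∀ χ : C →* ℂˣ,
    ExtPerfect U.1 ((indF (crossedSub X C)).obj (a.tower (twistChar hle χ) T)) ∧
    (EP U.1 ((indF (crossedSub X C)).obj (a.tower (twistChar hle χ) T)) : ℂ) =
      (Nat.card C : ℂ)⁻¹ * ∑ c : C, coefGC ((c : Γ)⁻¹) (cls U) s * χ c *
        ∏ i ∈ T, (1 - (ω i c : ℂ)) := by
  induction T using Finset.induction_on with
  | empty =>
    intro χ
    have e : Rep.of (a.polyRep (twistChar hle χ)) ≅ a.tower (twistChar hle χ) ∅ :=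
      Rep.mkIso (.mk (LinearEquiv.ofTop _ AffineAction.polyKer_empty).symm fun _ => rfl)
    have := injective_polyRep h (twistChar hle χ)
    have := Injective.of_iso e this
    let e' := Linear.homCongr ℂ (Iso.refl U.1) ((indF (crossedSub X C)).mapIso e)
    obtain ⟨h1, h2⟩ := finrank_hom_indF_polyRep hle h χ U
    refine ⟨ExtPerfect.of_injective (Module.Finite.equiv e'), ?_⟩
    rw [EP_of_injective, ← e'.finrank_eq, Int.cast_natCast, h2]
    simp
  | insert j T hj ih =>
    intro χ
    have hlin : twistChar hle χ * a.lin j = twistChar hle (χ * ω j) := by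
      refine MonoidHom.ext fun w => ?_
      rw [MonoidHom.mul_apply, hω, twistChar_apply, twistChar_apply, MonoidHom.mul_apply, mul_assoc]
      rfl
    have hS := indF_shortExact (crossedSub X C) _ (a.towerSeq_shortExact (twistChar hle χ)
      (Finset.subset_insert j T) (Finset.mem_insert_self j T) hj fun i => Finset.mem_insert.1)
    obtain ⟨p2, e2⟩ := ih χ
    obtain ⟨p3, e3⟩ := ih (χ * ω j)
    rw [← hlin] at p3 e3
    have p1 := ExtPerfect.left hS p2 p3
    refine ⟨p1, ?_⟩
    have e := EP_add hS p1 p3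
    have e1 : (EP U.1 ((indF (crossedSub X C)).obj (a.tower (twistChar hle χ) (insert j T))) : ℂ) =
        (EP U.1 ((indF (crossedSub X C)).obj (a.tower (twistChar hle χ) T)) : ℂ) -
        (EP U.1 ((indF (crossedSub X C)).obj (a.tower (twistChar hle χ * a.lin j) T)) : ℂ) :=
      eq_sub_of_add_eq (by exact_mod_cast e.symm)
    rw [e1, e2, e3, ← mul_sub, ← Finset.sum_sub_distrib]
    congr 1
    refine Finset.sum_congr rfl fun c _ => ?_
    rw [Finset.prod_insert hj, MonoidHom.mul_apply, Units.val_mul]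
    ring

theorem EP_indF_charRep {ω : Fin r → C →* ℂˣ} (hω : ∀ i, a.lin i = (ω i).comp (finProj C))
    (U : FinRep (Crossed Γ X)) (χ : C →* ℂˣ) :
    ExtPerfect U.1 ((indF (crossedSub X C)).obj (charRep (twistChar hle χ))) ∧
    (EP U.1 ((indF (crossedSub X C)).obj (charRep (twistChar hle χ))) : ℂ) =
      (Nat.card C : ℂ)⁻¹ * ∑ c : C, coefGC ((c : Γ)⁻¹) (cls U) s * χ c *
        ∏ i, (1 - (ω i c : ℂ)) := by
  obtain ⟨h1, h2⟩ := EP_indF_tower hle h hω U Finset.univ χ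
  let e := (indF (crossedSub X C)).mapIso (a.towerUnivIso (twistChar hle χ))
  refine ⟨ExtPerfect.of_retract e.hom e.inv e.hom_inv_id h1, ?_⟩
  rw [← h2, EP_congr_right _ e]

end EulerPoincare

/-! ### Retracts of induced representations -/

section Retract

variable {G : Type} [Group G] (S : Subgroup G) [S.FiniteIndex]

open scoped Classical in
/-- A representation is a retract of the representation induced from its restriction to a
subgroup of finite index. -/
theorem exists_retract_indF (V : Rep.{0} ℂ G) :
    ∃ (i : V ⟶ (indF S).obj (Rep.res S.subtype V)) (p : (indF S).obj (Rep.res S.subtype V) ⟶ V),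
      i ≫ p = 𝟙 V := by
  let i : V ⟶ (indF S).obj (Rep.res S.subtype V) :=
    Rep.resCoindHomEquiv.{0} S.subtype V (Rep.res S.subtype V) (𝟙 _) ≫ (Rep.indCoindIso.{0} _).inv
  let p : (indF S).obj (Rep.res S.subtype V) ⟶ V :=
    (Rep.indResHomEquiv S.subtype (Rep.res S.subtype V) V).symm (𝟙 _)
  let _ : Fintype (G ⧸ S) := S.fintypeQuotientOfFiniteIndex
  let n : ℂ := Fintype.card (_root_.Quotient (QuotientGroup.rightRel S))
  have : Nonempty (_root_.Quotient (QuotientGroup.rightRel S)) := ⟨Quotient.mk _ 1⟩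
  have hn : n ≠ 0 :=
    Nat.cast_ne_zero.2 (Fintype.card_ne_zero (α := _root_.Quotient (QuotientGroup.rightRel S)))
  refine ⟨i, n⁻¹ • p, ?_⟩
  -- Each coset returns one copy of `v`, so the composite is multiplication by the index, invertible
  -- in `ℂ`.
  have key : i ≫ p = n • 𝟙 V := by
    refine Rep.hom_ext (Representation.IntertwiningMap.ext (LinearMap.ext fun v => ?_))
    have hp : ∀ g w, p.hom.toLinearMap (Representation.IndV.mk S.subtype
        (Rep.res S.subtype V).ρ g w) = V.ρ g⁻¹ w := by
      intro g w
      simp [p]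
    change p.hom.toLinearMap (Rep.coindToInd (Rep.res S.subtype V)
      ((Rep.resCoindHomEquiv.{0} S.subtype V (Rep.res S.subtype V) (𝟙 _)).hom.toLinearMap v)) = n • v
    rw [Rep.coindToInd_apply, map_sum]
    have h1 : ∀ g : G, p.hom.toLinearMap (Representation.IndV.mk S.subtype
        (Rep.res S.subtype V).ρ g (V.ρ g v)) = v := by
      intro g
      rw [hp, ← Module.End.mul_apply, ← map_mul, inv_mul_cancel, map_one, Module.End.one_apply]
    refine (Finset.sum_congr rfl fun q _ => ?_ : _ = ∑ _q : _root_.Quotient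
      (QuotientGroup.rightRel S), v).trans ?_
    · induction q using Quotient.inductionOn with | h g => exact h1 g
    · rw [Finset.sum_const, Finset.card_univ, ← Nat.cast_smul_eq_nsmul ℂ]
  rw [Linear.comp_smul, key, smul_smul, inv_mul_cancel₀ hn, one_smul]

end Retract

/-! ### Identification of `EP` with the Hermitian form -/

section EulerPoincareForm

variable {Γ X : Type} [Group Γ] [Finite Γ] [AddCommGroup X] [DistribMulAction Γ X]
  [Module.Free ℤ X] [Module.Finite ℤ X]

theorem extPerfect_indF_charRep (U : FinRep (Crossed Γ X))
    (ψ : crossedSub X (Subgroup.zpowers (1 : Γ)) →* ℂˣ) :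
    ExtPerfect U.1 ((indF (crossedSub X (Subgroup.zpowers (1 : Γ)))).obj (charRep ψ)) := by
  have : Fintype (Subgroup.zpowers (1 : Γ)) := Fintype.ofFinite _
  let s : Torus X := ψ.comp (latIncl _)
  have hle : Subgroup.zpowers (1 : Γ) ≤ stab Γ s := Subgroup.zpowers_le.2 (one_mem _)
  have hψ : ψ = twistChar hle 1 := by
    refine MonoidHom.ext fun w => ?_
    have h1 : finProj _ w = 1 := Subtype.ext (by
      obtain ⟨k, hk⟩ := Subgroup.mem_zpowers_iff.1 (Subgroup.mem_comap.1 w.2)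
      rw [one_zpow] at hk
      exact hk.symm)
    conv_lhs => rw [eq_latIncl_mul_finIncl _ w, h1, map_one, mul_one]
    rw [twistChar_apply, MonoidHom.one_apply, mul_one]
    rfl
  obtain ⟨r, a, ω, h, hω, -⟩ := exists_affineAction (X := X) (1 : Γ)
  rw [hψ]
  exact (EP_indF_charRep hle h hω U 1).1

/-- `V` is a retract of the induction of its restriction to `X`. Over the commutative group `X`
irreducibles are characters, for which the tower with `γ = 1` applies, and extensions are handled by
the long exact sequence. -/
theorem extPerfect (U V : FinRep (Crossed Γ X)) : ExtPerfect U.1 V.1 := by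
  let K := crossedSub X (Subgroup.zpowers (1 : Γ))
  have hcomm : IsMulCommutative K := ⟨⟨by
    rintro ⟨⟨x, c⟩, hc⟩ ⟨⟨y, d⟩, hd⟩
    rw [Subgroup.mem_comap, Subgroup.zpowers_one_eq_bot, Subgroup.mem_bot] at hc hd
    obtain rfl : c = 1 := hc
    obtain rfl : d = 1 := hd
    refine Subtype.ext (SemidirectProduct.ext ?_ rfl)
    change x * latticeAut Γ X 1 y = y * latticeAut Γ X 1 x
    simp [mul_comm]⟩⟩
  have key : ∀ W : FinRep K, ExtPerfect U.1 ((indF K).obj W.1) := by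
    intro W
    refine FinRep.devissage (P := fun W => ExtPerfect U.1 ((indF K).obj W.1)) ?_ ?_ ?_ W
    · intro W hW
      -- The zero representation is a retract of any character.
      refine (extPerfect_indF_charRep U 1).of_retract ((indF K).map (0 : W.1 ⟶ charRep 1))
        ((indF K).map (0 : charRep 1 ⟶ W.1)) ?_
      have h0 : (0 : W.1 ⟶ charRep 1) ≫ (0 : charRep 1 ⟶ W.1) = 𝟙 W.1 :=
        Rep.hom_ext (Representation.IntertwiningMap.ext (LinearMap.ext fun v =>
          Subsingleton.elim _ _))
      rw [← Functor.map_comp]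
      exact (congrArg (indF K).map h0).trans ((indF K).map_id W.1)
    · intro W hW
      have := W.2
      have h1 : Module.finrank ℂ W.1 = 1 :=
        Representation.IsIrreducible.finrank_eq_one_of_isMulCommutative W.1.ρ
      obtain ⟨ψ, hψ⟩ := exists_character_of_finrank_eq_one W.1.ρ h1
      let e₀ : W.1 ≃ₗ[ℂ] ℂ := LinearEquiv.ofFinrankEq _ _ (h1.trans (Module.finrank_self ℂ).symm)
      let e : W.1 ≅ charRep ψ := Rep.mkIso (.mk e₀ fun k => LinearMap.ext fun v => by
        change e₀ (W.1.ρ k v) = (ψ k : ℂ) * e₀ v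
        rw [hψ, map_smul, smul_eq_mul])
      let e' := (indF K).mapIso e
      exact (extPerfect_indF_charRep U ψ).of_retract e'.hom e'.inv e'.hom_inv_id
    · intro S _ _ _ hS p1 p3
      exact p1.of_left_right (indF_shortExact K S hS) p3
  have := V.2
  obtain ⟨i, p, hip⟩ := exists_retract_indF K V.1
  exact (key ⟨Rep.res K.subtype V.1, V.2⟩).of_retract i p hip

theorem EP_isAdditive (U : FinRep (Crossed Γ X)) :
    IsAdditive fun V : FinRep (Crossed Γ X) => (EP U.1 V.1 : ℂ) := fun S h₁ _ h₃ hS => by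
  change (EP U.1 S.X₂ : ℂ) = EP U.1 S.X₁ + EP U.1 S.X₃
  rw [EP_add hS (extPerfect U ⟨S.X₁, h₁⟩) (extPerfect U ⟨S.X₃, h₃⟩), Int.cast_add]

/-- The linear functional `V ↦ EP(U,V)`. -/
def EPRight (U : FinRep (Crossed Γ X)) : GC (Crossed Γ X) →ₗ[ℂ] ℂ :=
  liftGC _ (EP_isAdditive U)

theorem EPRight_cls (U V : FinRep (Crossed Γ X)) : EPRight U (cls V) = EP U.1 V.1 :=
  liftGC_cls _ (EP_isAdditive U) V

/-- The tower formula is a Fourier expansion over the characters `χ` of `⟨γ⟩`; the weights `χ(γ)⁻¹`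
in `latElem` pick out the term `c = γ`. -/
theorem EPRight_latElem (U : FinRep (Crossed Γ X)) {γ : Γ} {s : Torus X} (hγ : γ ∈ stab Γ s) :
    EPRight U (latElem γ s) = (ellDet X γ⁻¹ : ℂ) * coefGC γ⁻¹ (cls U) s := by
  classical
  have : Fintype (Subgroup.zpowers γ) := Fintype.ofFinite _
  have hC : (Nat.card (Subgroup.zpowers γ) : ℂ) ≠ 0 := by exact_mod_cast Nat.card_pos.ne'
  obtain ⟨r, a, ω, h, hω, hdet⟩ := exists_affineAction (X := X) γ
  have hle := Subgroup.zpowers_le.2 hγ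
  have h1 : ∀ χ : Subgroup.zpowers γ →* ℂˣ, EPRight U (indGC (crossedSub X (Subgroup.zpowers γ))
      (clsChar (twistChar hle χ))) = (Nat.card (Subgroup.zpowers γ) : ℂ)⁻¹ *
        ∑ c : Subgroup.zpowers γ, coefGC ((c : Γ)⁻¹) (cls U) s * χ c * ellDet X (c : Γ)⁻¹ := by
    intro χ
    rw [clsChar, indGC_cls, EPRight_cls, (EP_indF_charRep hle h hω U χ).2]
    simp only [hdet]
  rw [latElem, dif_pos hγ, map_sum]
  simp_rw [map_smul, h1, smul_eq_mul, mul_left_comm _ (Nat.card (Subgroup.zpowers γ) : ℂ)⁻¹,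
    Finset.mul_sum]
  rw [Finset.sum_comm]
  have h2 : ∀ c : Subgroup.zpowers γ, ∑ χ : Subgroup.zpowers γ →* ℂˣ,
      (Nat.card (Subgroup.zpowers γ) : ℂ)⁻¹ * ((χ (zgen γ) : ℂ)⁻¹ *
        (coefGC ((c : Γ)⁻¹) (cls U) s * χ c * ellDet X (c : Γ)⁻¹)) =
      if c = zgen γ then (ellDet X (c : Γ)⁻¹ : ℂ) * coefGC ((c : Γ)⁻¹) (cls U) s else 0 := by
    intro c
    have h3 : ∀ χ : Subgroup.zpowers γ →* ℂˣ, (Nat.card (Subgroup.zpowers γ) : ℂ)⁻¹ *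
        ((χ (zgen γ) : ℂ)⁻¹ * (coefGC ((c : Γ)⁻¹) (cls U) s * χ c * ellDet X (c : Γ)⁻¹)) =
        ((Nat.card (Subgroup.zpowers γ) : ℂ)⁻¹ * (ellDet X (c : Γ)⁻¹ *
          coefGC ((c : Γ)⁻¹) (cls U) s)) * ((χ (zgen γ) : ℂ)⁻¹ * χ c) := fun χ => by ring
    rw [Finset.sum_congr rfl fun χ _ => h3 χ, ← Finset.mul_sum, sum_char]
    have h4 : (c : Γ) = γ ↔ c = zgen γ := ⟨fun h => Subtype.ext h, fun h => congrArg Subtype.val h⟩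
    simp only [h4]
    split_ifs
    · field_simp
    · rw [mul_zero]
  rw [Finset.sum_congr rfl fun c _ => h2 c, Finset.sum_ite_eq' Finset.univ (zgen γ),
    if_pos (Finset.mem_univ _)]

/-- Expand `|Γ| [V]` in the elements `latElem γ s` and evaluate termwise. The coefficient of `U` at
`γ⁻¹` that appears is the conjugate of the one at `γ`. -/
theorem EP_eq_ellForm [Fintype Γ] (U V : FinRep (Crossed Γ X)) : (EP U.1 V.1 : ℂ) =
    ellForm Γ X ((ellLatticeRel Γ X).mkQ (cls U)) ((ellLatticeRel Γ X).mkQ (cls V)) := by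
  have hΓ : (Nat.card Γ : ℂ) ≠ 0 := by exact_mod_cast Nat.card_pos.ne'
  have h1 : (EP U.1 V.1 : ℂ) = EPRight U (cls V) := (EPRight_cls U V).symm
  have h2 := congrArg (EPRight U) (card_smul_eq_sum_latElem (cls V))
  rw [map_smul, map_sum, smul_eq_mul] at h2
  rw [h1, ellForm_mk, eq_inv_mul_iff_mul_eq₀ hΓ, h2]
  refine Finset.sum_congr rfl fun γ _ => ?_
  rw [map_finsuppSum, suppPairing_apply, Finsupp.sum, Finsupp.sum, Finset.mul_sum]
  refine Finset.sum_congr rfl fun s hs => ?_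
  have hγ : γ ∈ stab Γ s := by_contra fun h =>
    Finsupp.mem_support_iff.1 hs (coefGC_eq_zero (cls V) h)
  rw [map_smul, EPRight_latElem U hγ, star_coefGC_cls, smul_eq_mul]
  ring

end EulerPoincareForm

end EllipticTheory

end

/-! ### The theorem -/

open CategoryTheory EllipticTheory DirectSum in
open scoped Classical in
theorem mainTheorem10 (Γ X : Type) [Group Γ] [Finite Γ] [AddCommGroup X] [Module.Free ℤ X]
    [Module.Finite ℤ X] [DistribMulAction Γ X] :
    -- a) the dimension of `Ell(Γ ⋉ X)` is the (finite) number of elliptic conjugacy classes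
    (Module.Finite ℂ (EllLattice Γ X) ∧ (ellipticClasses Γ X).Finite ∧
      Module.finrank ℂ (EllLattice Γ X) = (ellipticClasses Γ X).ncard) ∧
    -- the Euler-Poincaré characteristic is a finite alternating sum of finite dimensions
    (∀ U V : FinRep (Crossed Γ X), (∀ n : ℕ, Module.Finite ℂ (Abelian.Ext U.1 V.1 n)) ∧
      ∃ N : ℕ, ∀ n ≥ N, Subsingleton (Abelian.Ext U.1 V.1 n)) ∧
    -- b) it induces a Hermitian inner product `B` on `Ell(Γ ⋉ X)`
    ∃ B : EllLattice Γ X →ₗ⋆[ℂ] EllLattice Γ X →ₗ[ℂ] ℂ,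
      (∀ U V : FinRep (Crossed Γ X),
        B ((ellLatticeRel Γ X).mkQ (cls U)) ((ellLatticeRel Γ X).mkQ (cls V)) =
          (EP U.1 V.1 : ℂ)) ∧
      (∀ x y, starRingEnd ℂ (B x y) = B y x) ∧
      (∀ x, x ≠ 0 → 0 < (B x x).re) ∧
    -- `Ind_t` induces a map `Ell(Γ_t) → Ell(Γ ⋉ X)`
    ∃ hInd : ∀ t : Torus X,
        ellRel (cotangentRep Γ t) ≤ (ellLatticeRel Γ X).comap (indT Γ t),
      -- c) the map `Ind_t` is an isometry
      (∀ (t : Torus X) (U V : FinRep (stab Γ t)),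
        EP ((indTF Γ t).obj U.1) ((indTF Γ t).obj V.1) =
          ellPairing (cotangentRep Γ t) U.1 V.1) ∧
      (∀ t : Torus X,
        ∃ b : Ell (cotangentRep Γ t) →ₗ⋆[ℂ] Ell (cotangentRep Γ t) →ₗ[ℂ] ℂ,
          (∀ U V : FinRep (stab Γ t),
            b ((ellRel (cotangentRep Γ t)).mkQ (cls U)) ((ellRel (cotangentRep Γ t)).mkQ (cls V)) =
              (ellPairing (cotangentRep Γ t) U.1 V.1 : ℂ)) ∧
          ∀ x y, B (Submodule.mapQ _ _ (indT Γ t) (hInd t) x)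
            (Submodule.mapQ _ _ (indT Γ t) (hInd t) y) = b x y) ∧
      -- d) the direct sum of the maps `Ind_t` over `T / Γ` is an isomorphism
      (∀ R : Set (Torus X), IsOrbitTransversal Γ R →
        Function.Bijective (DirectSum.toModule ℂ R (EllLattice Γ X)
          (fun t : R => Submodule.mapQ _ _ (indT Γ t.1) (hInd t.1)) :
            (⨁ t : R, Ell (cotangentRep Γ t.1)) →ₗ[ℂ] EllLattice Γ X)) := by
  have := Fintype.ofFinite Γ
  have hEP : ∀ (t : Torus X) (U V : FinRep (stab Γ t)),
      (EP ((indTF Γ t).obj U.1) ((indTF Γ t).obj V.1) : ℂ) =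
        ellForm Γ X ((ellLatticeRel Γ X).mkQ (indT Γ t (cls U)))
          ((ellLatticeRel Γ X).mkQ (indT Γ t (cls V))) := fun t U V => by
    rw [indT_cls, indT_cls, ← EP_eq_ellForm]
  refine ⟨ellLattice_dimension, extPerfect, ellForm Γ X, fun U V => (EP_eq_ellForm U V).symm,
    star_ellForm, fun x hx => ellForm_self_pos hx, ellRel_le_comap_indT Γ, fun t U V => ?_,
    fun t => ?_, fun R hR => indT_bijective hR _⟩
  · have h := (hEP t U V).trans (ellPairing_cotangentRep t U V).symm
    exact_mod_cast h
  · let M := Submodule.mapQ _ _ (indT Γ t) (ellRel_le_comap_indT Γ t)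
    -- The form on `Ell(Γ_t)` is taken to be the pullback along `Ind_t`, so the isometry is
    -- definitional and the content is that it computes `e_{Γ_t}`.
    refine ⟨((ellForm Γ X).comp M).compl₂ M, fun U V => ?_, fun x y => rfl⟩
    exact (ellPairing_cotangentRep t U V).symm
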